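/- Let $X$ be a (real or complex) Banach space and let $A$ be the infinitesimal generator of an analytic semigroup $e^{tA}$, $t\ge 0$, on $X$ (on a real space: analytic after complexification). Let $g:X\to X$, $t_0<T$, and let $u:[t_0,T]\to X$ be a solution of $$u'(t)=F(u(t))=Au(t)+g(u(t)),\qquad t_0\le t\le T .$$ Suppose that $u\in C^5([t_0,T];X)$ and that, for some $r>0$, $g$ is five times continuously (real) Fréchet differentiable in the strip $\{x:\ \|x-u(t)\|<r \text{ for some } t\in[t_0,T]\}$, with derivatives of orders $1,\dots,5$ uniformly bounded there. Let $\varphi_0(z)=e^z$ and $\varphi_k(z)=\int_0^1 e^{(1-\theta)z}\frac{\theta^{k-1}}{(k-1)!}\,d\theta$ for $k\ge1$. Consider an explicit exponential Runge–Kutta method with $s$ stages, nodes $c_i\ge 0$ and coefficient functions $a_{ij}(z)$, $b_i(z)$ that are finite real linear combinations of functions $\varphi_k(\sigma z)$ with $k\ge 0$, $\sigma\ge0$. With constant step size $h>0$ and $u_0=u(t_0)$ it reads $$U_{ni}=u_n+c_ih\varphi_1(c_ihA)F(u_n)+h\sum_{j=2}^{i-1}a_{ij}(hA)D_{nj},\qquad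 u_{n+1}=u_n+h\varphi_1(hA)F(u_n)+h\sum_{i=2}^{s}b_i(hA)D_{ni},$$ with $D_{ni}=g(U_{ni})-g(u_n)$, where for $\tau\ge0$ the term $\tau\varphi_1(\tau A)F(w)$ is understood as $(e^{\tau A}-I)w+\tau\varphi_1(\tau A)g(w)$ (the same thing if $w$ lies in the domain of $A$). Put $$\psi_{j,i}(Z)=\sum_{k=2}^{i-1}a_{ik}(Z)\frac{c_k^{j-1}}{(j-1)!}-c_i^j\varphi_j(c_iZ).$$ Assume that for all real square matrices $Z,J,K$ of the same (arbitrary) format 1. $\sum_{i=2}^s b_i(Z)c_i=\varphi_2(Z)$, 2. $\sum_{i=2}^s b_i(Z)\frac{c_i^2}{2!}=\varphi_3(Z)$, 3. $\sum_{i=2}^s b_i(Z)J\psi_{2,i}(Z)=0$, 4. $\sum_{i=2}^s b_i(Z)\frac{c_i^3}{3!}=\varphi_4(Z)$, 5. $\sum_{i=2}^s b_i(Z)J\psi_{3,i}(Z)=0$, 6. $\sum_{i=2}^s b_i(Z)J\sum_{j=2}^{i-1}a_{ij}(Z)J\psi_{2,j}(Z)=0$, 7. $\sum_{i=2}^s b_i(Z)c_iK\psi_{2,i}(Z)=0$,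 and that, for all real square matrices $Z,J,K,L$ of the same (arbitrary) format and all bilinear maps $B$ of the corresponding dimension, 8. $\sum_{i=2}^s b_i(0)\frac{c_i^4}{4!}=\varphi_5(0)$, 9. $\sum_{i=2}^s b_i(0)J\psi_{4,i}(Z)=0$, 10. $\sum_{i=2}^s b_i(0)J\sum_{j=2}^{i-1}a_{ij}(Z)J\psi_{3,j}(Z)=0$, 11. $\sum_{i=2}^s b_i(0)J\sum_{j=2}^{i-1}a_{ij}(Z)J\sum_{k=2}^{j-1}a_{jk}(Z)J\psi_{2,k}(Z)=0$, 12. $\sum_{i=2}^s b_i(0)J\sum_{j=2}^{i-1}a_{ij}(Z)c_jK\psi_{2,j}(Z)=0$, 13. $\sum_{i=2}^s b_i(0)c_iK\psi_{3,i}(Z)=0$, 14. $\sum_{i=2}^s b_i(0)c_iK\sum_{j=2}^{i-1}a_{ij}(Z)J\psi_{2,j}(Z)=0$, 15. $\sum_{i=2}^s b_i(0)B\big(\psi_{2,i}(Z),\psi_{2,i}(Z)\big)=0$, 16. $\sum_{i=2}^s b_i(0)c_i^2L\psi_{2,i}(Z)=0$. Then the method converges with order $5$: there are constants $h_0>0$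 and $C$, independent of $n$ and $h$, such that for all $0<h\le h_0$ and all integers $n\ge0$ with $t_n=t_0+nh\le T$, $$\|u_n-u(t_n)\|\le C h^5 .$$ -/

import Mathlib

open Set Filter Topology
open scoped NNReal Nat

namespace ExpRK

noncomputable section

universe v

/-! ### Analytic semigroups -/

/-- The open sector of half-angle `δ` around the positive real axis (without the vertex). -/
def sector (δ : ℝ) : Set ℂ := {z | z ≠ 0 ∧ |z.arg| < δ}

/-- `S` is a semigroup of bounded operators on the complex Banach space `Y` that is analytic in
the sector of half-angle `δ` and strongly continuous at the vertex of the sector. -/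
structure IsSectorialSemigroup {Y : Type v} [NormedAddCommGroup Y] [NormedSpace ℂ Y]
    (δ : ℝ) (S : ℂ → Y →L[ℂ] Y) : Prop where
  map_zero : S 0 = 1
  map_add : ∀ z ∈ sector δ, ∀ w ∈ sector δ, S (z + w) = S z * S w
  analytic : DifferentiableOn ℂ S (sector δ)
  tendsto_zero : ∀ y, Tendsto (fun z => S z y) (𝓝[sector δ] 0) (𝓝 y)

/-- Strongly continuous (`C₀`) semigroups `(T t)_{t ≥ 0}` of bounded operators; the values of `T`
at negative times are irrelevant. -/
structure IsC0Semigroup {X : Type v} [NormedAddCommGroup X] [NormedSpace ℝ X]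
    (T : ℝ → X →L[ℝ] X) : Prop where
  map_zero : T 0 = 1
  map_add : ∀ s t, 0 ≤ s → 0 ≤ t → T (s + t) = T s * T t
  continuousOn : ∀ x, ContinuousOn (fun t => T t x) (Ici 0)

/-- A `C₀`-semigroup on a Banach space `X` is analytic if it extends analytically to a sector
around the positive real axis. Analyticity in a sector needs complex scalars: if `X` is a complex
Banach space, take `Y = X` and `ι = id`; if `X` is real, the extension lives on a complexification
`Y` of `X`, which contains `X` as a closed real subspace through `ι`. -/
def IsAnalyticSemigroup {X : Type v} [NormedAddCommGroup X] [NormedSpace ℝ X]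
    (T : ℝ → X →L[ℝ] X) : Prop :=
  IsC0Semigroup T ∧
    ∃ (Y : Type v) (_ : NormedAddCommGroup Y) (_ : NormedSpace ℂ Y) (_ : CompleteSpace Y)
      (ι : X →ₗᵢ[ℝ] Y) (δ : ℝ) (S : ℂ → Y →L[ℂ] Y),
      0 < δ ∧ δ ≤ Real.pi / 2 ∧ IsSectorialSemigroup δ S ∧
        ∀ t : ℝ, 0 ≤ t → ∀ x, S (t : ℂ) (ι x) = ι (T t x)

/-- The (possibly unbounded) linear operator `A` is the infinitesimal generator of `T`: its graph
consists of the pairs `(x, y)` with `y = lim_{t → 0+} (T t x - x) / t`. -/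
def IsGenerator {X : Type v} [NormedAddCommGroup X] [NormedSpace ℝ X]
    (A : X →ₗ.[ℝ] X) (T : ℝ → X →L[ℝ] X) : Prop :=
  ∀ x y, (x, y) ∈ A.graph ↔ Tendsto (fun t : ℝ => t⁻¹ • (T t x - x)) (𝓝[>] 0) (𝓝 y)

/-! ### The functions `φ_k` and the coefficients of a method -/

/-- `phi T k τ = φ_k(τ A)` for `T t = e^{tA}`: `φ_0(τ A) = e^{τ A}` and
`φ_k(τ A) x = ∫_0^1 e^{(1-θ) τ A} x θ^{k-1}/(k-1)! dθ` for `k ≥ 1`. -/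
def phi {X : Type v} [NormedAddCommGroup X] [NormedSpace ℝ X] (T : ℝ → X →L[ℝ] X) :
    ℕ → ℝ → X → X
  | 0, τ, x => T τ x
  | k + 1, τ, x => ∫ θ in (0 : ℝ)..1, (θ ^ k / (k ! : ℝ)) • T ((1 - θ) * τ) x

/-- A coefficient function: a finite linear combination `z ↦ ∑ r • φ_k(σ z)` of the functions
`φ_k` and scaled versions thereof; `f (k, σ)` is the factor of `φ_k(σ z)`. -/
abbrev Coeff := ℕ × ℝ≥0 →₀ ℝ

/-- The operator `f(τ A)` for `T t = e^{tA}`. -/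
def Coeff.op {X : Type v} [NormedAddCommGroup X] [NormedSpace ℝ X] (f : Coeff)
    (T : ℝ → X →L[ℝ] X) (τ : ℝ) (x : X) : X :=
  f.sum fun p r => r • phi T p.1 ((p.2 : ℝ) * τ) x

/-- An explicit exponential Runge–Kutta method with `s` stages. Only `c i`, `b i` with
`2 ≤ i ≤ s` and `a i j` with `2 ≤ j < i ≤ s` are used. -/
structure Method where
  s : ℕ
  c : ℕ → ℝ≥0
  a : ℕ → ℕ → Coeff
  b : ℕ → Coeff

/-! ### The numerical scheme -/

section Scheme

variable {X : Type v} [NormedAddCommGroup X] [NormedSpace ℝ X]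

/-- The term `τ φ_1(τ A) F(w)` with `F(w) = A w + g(w)`. The operator `τ φ_1(τ A) A = e^{τ A} - 1`
extends continuously from the domain of `A` to all of `X`; see `phiF_eq`. -/
def phiF (T : ℝ → X →L[ℝ] X) (g : X → X) (τ : ℝ) (w : X) : X :=
  (T τ w - w) + τ • phi T 1 τ (g w)

/-- For `w` in the domain of the generator `A`, `phiF` is literally `τ φ_1(τ A) (A w + g w)`. -/
theorem phiF_eq [CompleteSpace X] {T : ℝ → X →L[ℝ] X} {A : X →ₗ.[ℝ] X} (hT : IsC0Semigroup T)
    (hA : IsGenerator A T) (g : X → X) {τ : ℝ} (hτ : 0 ≤ τ) (w : A.domain) :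
    phiF T g τ w = τ • phi T 1 τ (A w + g w) := by
  have hci : ∀ x : X, ContinuousOn (fun θ : ℝ => T ((1 - θ) * τ) x) (uIcc (0 : ℝ) 1) := by
    intro x
    refine (hT.continuousOn x).comp (by fun_prop) ?_
    intro θ hθ
    rw [uIcc_of_le zero_le_one] at hθ
    exact mul_nonneg (by linarith [hθ.2]) hτ
  have hint : ∀ x : X, IntervalIntegrable (fun θ : ℝ => T ((1 - θ) * τ) x)
      MeasureTheory.volume 0 1 := fun x => (hci x).intervalIntegrable
  have hphi : ∀ x : X, phi T 1 τ x = ∫ θ in (0 : ℝ)..1, T ((1 - θ) * τ) x := by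
    intro x; simp [phi]
  have hlin : T τ (w : X) - w = τ • ∫ θ in (0 : ℝ)..1, T ((1 - θ) * τ) (A w) := by
    have hsub : τ • ∫ θ in (0 : ℝ)..1, T ((1 - θ) * τ) (A w) = ∫ t in (0 : ℝ)..τ, T t (A w) := by
      have h1 := intervalIntegral.integral_comp_sub_left (a := 0) (b := 1)
        (fun θ : ℝ => T (θ * τ) (A w)) 1
      rw [h1]
      simpa using intervalIntegral.smul_integral_comp_mul_right (a := 0) (b := 1)
        (fun t : ℝ => T t (A w)) τ
    have hcont : ∀ x : X, ContinuousOn (fun t => T t x) (Icc 0 τ) := fun x =>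
      (hT.continuousOn x).mono fun t ht => ht.1
    rw [hsub, intervalIntegral.integral_eq_sub_of_hasDeriv_right_of_le hτ (hcont w) (f' :=
      fun t => T t (A w))]
    · simp [hT.map_zero]
    · intro t ht
      have hgen := (hA w (A w)).1 (A.mem_graph w)
      have hlim : Tendsto (fun r : ℝ => T t (r⁻¹ • (T r w - (w : X)))) (𝓝[>] 0) (𝓝 (T t (A w))) :=
        ((T t).continuous.tendsto _).comp hgen
      rw [hasDerivWithinAt_iff_tendsto_slope' (by simp)]
      have hshift : Tendsto (fun y : ℝ => y - t) (𝓝[>] t) (𝓝[>] 0) := by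
        refine tendsto_nhdsWithin_iff.2 ⟨?_, ?_⟩
        · have : Tendsto (fun y : ℝ => y - t) (𝓝 t) (𝓝 (t - t)) := by
            exact (continuous_id.sub continuous_const).tendsto t
          rw [sub_self] at this
          exact this.mono_left nhdsWithin_le_nhds
        · filter_upwards [self_mem_nhdsWithin] with y hy
          exact sub_pos.2 (mem_Ioi.1 hy)
      refine (hlim.comp hshift).congr' ?_
      filter_upwards [self_mem_nhdsWithin] with y hy
      have hy' : 0 ≤ y - t := (sub_pos.2 (mem_Ioi.1 hy)).le
      have hadd : T y = T t * T (y - t) := by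
        rw [← hT.map_add t (y - t) ht.1.le hy']; congr 1; ring
      simp [slope, hadd]
    · exact ((hcont (A w)).mono (by rw [uIcc_of_le hτ])).intervalIntegrable
  rw [phiF, hphi, hphi, hlin, ← smul_add, ← intervalIntegral.integral_add (hint _) (hint _)]
  simp

/-- The internal stages
`U_i = w + c_i h φ_1(c_i h A) F(w) + h ∑_{j=2}^{i-1} a_{ij}(h A) (g(U_j) - g(w))`
of one step of size `h` from `w`. -/
def stage (M : Method) (T : ℝ → X →L[ℝ] X) (g : X → X) (h : ℝ) (w : X) (i : ℕ) : X :=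
  w + phiF T g ((M.c i : ℝ) * h) w +
    h • ∑ j : Finset.Ico 2 i, (M.a i j).op T h (g (stage M T g h w j) - g w)
termination_by i
decreasing_by exact (Finset.mem_Ico.1 j.2).2

theorem stage_eq (M : Method) (T : ℝ → X →L[ℝ] X) (g : X → X) (h : ℝ) (w : X) (i : ℕ) :
    stage M T g h w i = w + phiF T g ((M.c i : ℝ) * h) w +
      h • ∑ j ∈ Finset.Ico 2 i, (M.a i j).op T h (g (stage M T g h w j) - g w) := by
  rw [stage, Finset.sum_coe_sort (Finset.Ico 2 i)
    (fun j => (M.a i j).op T h (g (stage M T g h w j) - g w))]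

/-- One step of size `h`:
`w ↦ w + h φ_1(h A) F(w) + h ∑_{i=2}^{s} b_i(h A) (g(U_i) - g(w))`. -/
def step (M : Method) (T : ℝ → X →L[ℝ] X) (g : X → X) (h : ℝ) (w : X) : X :=
  w + phiF T g h w + h • ∑ i ∈ Finset.Icc 2 M.s, (M.b i).op T h (g (stage M T g h w i) - g w)

/-- The numerical solution `u_n` with constant step size `h` and initial value `u₀`. -/
def numSol (M : Method) (T : ℝ → X →L[ℝ] X) (g : X → X) (h : ℝ) (u₀ : X) : ℕ → X
  | 0 => u₀
  | n + 1 => step M T g h (numSol M T g h u₀ n)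

end Scheme

/-! ### The stiff order conditions -/

/-- `Mat d`: square matrices of format `d`, as linear maps of `ℝ^d`. -/
abbrev Mat (d : ℕ) := EuclideanSpace ℝ (Fin d) →L[ℝ] EuclideanSpace ℝ (Fin d)

/-- `t ↦ e^{tZ}`. -/
def expSG {d : ℕ} (Z : Mat d) (t : ℝ) : Mat d := NormedSpace.exp (t • Z)

/-- `φ_k(Z)` for a square matrix `Z`. -/
def phiMat {d : ℕ} (k : ℕ) (Z : Mat d) : EuclideanSpace ℝ (Fin d) → EuclideanSpace ℝ (Fin d) :=
  phi (expSG Z) k 1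

/-- `f(Z)` for a coefficient function `f` and a square matrix `Z`. -/
def Coeff.mat {d : ℕ} (f : Coeff) (Z : Mat d) :
    EuclideanSpace ℝ (Fin d) → EuclideanSpace ℝ (Fin d) :=
  f.op (expSG Z) 1

namespace Method

variable (M : Method) {d : ℕ}

/-- `ψ_{j,i}(Z) = ∑_{k=2}^{i-1} a_{ik}(Z) c_k^{j-1}/(j-1)! - c_i^j φ_j(c_i Z)`. -/
def psi (j i : ℕ) (Z : Mat d) (x : EuclideanSpace ℝ (Fin d)) : EuclideanSpace ℝ (Fin d) :=
  ∑ k ∈ Finset.Ico 2 i, ((M.c k : ℝ) ^ (j - 1) / ((j - 1)! : ℝ)) • (M.a i k).mat Z x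
    - (M.c i : ℝ) ^ j • phiMat j ((M.c i : ℝ) • Z) x

/-- Quadrature condition `∑ b_i(Z) c_i^m / m! = φ_{m+1}(Z)` at the matrix `Z`. -/
def QuadCond (m : ℕ) (Z : Mat d) : Prop :=
  ∀ x, ∑ i ∈ Finset.Icc 2 M.s, ((M.c i : ℝ) ^ m / (m ! : ℝ)) • (M.b i).mat Z x = phiMat (m + 1) Z x

/-- The stiff order conditions 1–7 (up to order four), for arbitrary square matrices. -/
structure FullConditions : Prop where
  cond1 : ∀ (d : ℕ) (Z : Mat d), M.QuadCond 1 Z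
  cond2 : ∀ (d : ℕ) (Z : Mat d), M.QuadCond 2 Z
  cond3 : ∀ (d : ℕ) (Z J : Mat d) x,
    ∑ i ∈ Finset.Icc 2 M.s, (M.b i).mat Z (J (M.psi 2 i Z x)) = 0
  cond4 : ∀ (d : ℕ) (Z : Mat d), M.QuadCond 3 Z
  cond5 : ∀ (d : ℕ) (Z J : Mat d) x,
    ∑ i ∈ Finset.Icc 2 M.s, (M.b i).mat Z (J (M.psi 3 i Z x)) = 0
  cond6 : ∀ (d : ℕ) (Z J : Mat d) x,
    ∑ i ∈ Finset.Icc 2 M.s, (M.b i).mat Z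
      (J (∑ j ∈ Finset.Ico 2 i, (M.a i j).mat Z (J (M.psi 2 j Z x)))) = 0
  cond7 : ∀ (d : ℕ) (Z K : Mat d) x,
    ∑ i ∈ Finset.Icc 2 M.s, (M.b i).mat Z ((M.c i : ℝ) • K (M.psi 2 i Z x)) = 0

/-- The weakened conditions 8–16 of order five: condition 8 only at `Z = 0`, and conditions 9–16
with `b_i(0)` in place of `b_i(Z)`. -/
structure WeakConditions : Prop where
  cond8 : ∀ d : ℕ, M.QuadCond 4 (0 : Mat d)
  cond9 : ∀ (d : ℕ) (Z J : Mat d) x,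
    ∑ i ∈ Finset.Icc 2 M.s, (M.b i).mat 0 (J (M.psi 4 i Z x)) = 0
  cond10 : ∀ (d : ℕ) (Z J : Mat d) x,
    ∑ i ∈ Finset.Icc 2 M.s, (M.b i).mat 0
      (J (∑ j ∈ Finset.Ico 2 i, (M.a i j).mat Z (J (M.psi 3 j Z x)))) = 0
  cond11 : ∀ (d : ℕ) (Z J : Mat d) x,
    ∑ i ∈ Finset.Icc 2 M.s, (M.b i).mat 0
      (J (∑ j ∈ Finset.Ico 2 i, (M.a i j).mat Z
        (J (∑ k ∈ Finset.Ico 2 j, (M.a j k).mat Z (J (M.psi 2 k Z x)))))) = 0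
  cond12 : ∀ (d : ℕ) (Z J K : Mat d) x,
    ∑ i ∈ Finset.Icc 2 M.s, (M.b i).mat 0
      (J (∑ j ∈ Finset.Ico 2 i, (M.a i j).mat Z ((M.c j : ℝ) • K (M.psi 2 j Z x)))) = 0
  cond13 : ∀ (d : ℕ) (Z K : Mat d) x,
    ∑ i ∈ Finset.Icc 2 M.s, (M.b i).mat 0 ((M.c i : ℝ) • K (M.psi 3 i Z x)) = 0
  cond14 : ∀ (d : ℕ) (Z J K : Mat d) x,
    ∑ i ∈ Finset.Icc 2 M.s, (M.b i).mat 0 ((M.c i : ℝ) •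
      K (∑ j ∈ Finset.Ico 2 i, (M.a i j).mat Z (J (M.psi 2 j Z x)))) = 0
  cond15 : ∀ (d : ℕ) (Z : Mat d)
      (B : EuclideanSpace ℝ (Fin d) →ₗ[ℝ] EuclideanSpace ℝ (Fin d) →ₗ[ℝ] EuclideanSpace ℝ (Fin d))
      x y,
    ∑ i ∈ Finset.Icc 2 M.s, (M.b i).mat 0 (B (M.psi 2 i Z x) (M.psi 2 i Z y)) = 0
  cond16 : ∀ (d : ℕ) (Z L : Mat d) x,
    ∑ i ∈ Finset.Icc 2 M.s, (M.b i).mat 0 ((M.c i : ℝ) ^ 2 • L (M.psi 2 i Z x)) = 0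

end Method

/-! ### The initial value problem -/

section Problem

variable {X : Type v} [NormedAddCommGroup X] [NormedSpace ℝ X]

/-- `u` solves `u'(t) = A u(t) + g(u(t))` on `[t₀, t₁]`; in particular `u(t)` lies in the domain
of `A` (one-sided derivatives at the end points). -/
def IsSolution (A : X →ₗ.[ℝ] X) (g : X → X) (t₀ t₁ : ℝ) (u : ℝ → X) : Prop :=
  ∀ t ∈ Icc t₀ t₁, ∃ hx : u t ∈ A.domain,
    HasDerivWithinAt u (A ⟨u t, hx⟩ + g (u t)) (Icc t₀ t₁) t

/-- Regularity: `u` is `C⁵` on `[t₀, t₁]` and `g` is `C⁵` in a strip of some width `r > 0` along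
`u`, with uniformly bounded derivatives there. (The derivatives of `u` are bounded by compactness
of `[t₀, t₁]`.) -/
structure IsRegular (g : X → X) (t₀ t₁ : ℝ) (u : ℝ → X) : Prop where
  smooth_u : ContDiffOn ℝ 5 u (Icc t₀ t₁)
  smooth_g : ∃ r > 0, ContDiffOn ℝ 5 g (Metric.thickening r (u '' Icc t₀ t₁)) ∧
    ∃ R : ℝ, ∀ k : ℕ, 1 ≤ k → k ≤ 5 → ∀ x ∈ Metric.thickening r (u '' Icc t₀ t₁),
      ‖iteratedFDeriv ℝ k g x‖ ≤ R

end Problem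

end

end ExpRK

/-!
Insert the exact solution into the scheme. The resulting local error is `h⁵` times a principal
part, up to `O(h⁶)`: conditions 1–7 remove all lower orders. They are identities between matrix
functions with arbitrary `Z`, and matrices of suitable formats turn them into identities between
the coefficient functions themselves, which then hold for the operators `hA`. Conditions 8–16 are
only required with `b_i(0)`; they leave a principal part in which every term carries a factor
`b_i(hA) - b_i(0)` or `φ₅(hA) - φ₅(0)`. Such a factor is `hA` times a bounded operator, so that by
parabolic smoothing and Abel summation the sum over all steps, propagated by the semigroup, stays
bounded instead of growing like `1/h`. The remaining errors are summed by the discrete Gronwall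
lemma.
-/

namespace ExpRK

noncomputable section

universe v

/-! ### Strongly continuous semigroups -/

section Semigroup

variable {X : Type v} [NormedAddCommGroup X] [NormedSpace ℝ X] [CompleteSpace X]
  {T : ℝ → X →L[ℝ] X} {A : X →ₗ.[ℝ] X}

theorem IsC0Semigroup.exists_norm_le (hT : IsC0Semigroup T) (R : ℝ) :
    ∃ C : ℝ, 0 < C ∧ ∀ t ∈ Icc 0 R, ‖T t‖ ≤ C := by
  obtain ⟨C, hC⟩ := banach_steinhaus (g := fun t : Icc (0 : ℝ) R => T t) fun x => by
    obtain ⟨C, hC⟩ := isCompact_Icc.exists_bound_of_continuousOn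
      ((hT.continuousOn x).mono (Icc_subset_Ici_self : Icc 0 R ⊆ Ici 0))
    exact ⟨C, fun t => hC t t.2⟩
  exact ⟨max C 1, by positivity, fun t ht => (hC ⟨t, ht⟩).trans (le_max_left _ _)⟩

theorem IsC0Semigroup.continuousOn_uncurry (hT : IsC0Semigroup T) :
    ContinuousOn (fun p : ℝ × X => T p.1 p.2) (Ici 0 ×ˢ univ) := by
  rintro ⟨t, x⟩ ⟨ht, -⟩
  obtain ⟨C, -, hC⟩ := hT.exists_norm_le (t + 1)
  have h_time : Tendsto (fun p : ℝ × X => T p.1 x) (𝓝[Ici 0 ×ˢ univ] (t, x)) (𝓝 (T t x)) :=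
    (hT.continuousOn x t ht).tendsto.comp (tendsto_nhdsWithin_iff.2
      ⟨(continuous_fst.tendsto (t, x)).mono_left nhdsWithin_le_nhds,
        eventually_mem_nhdsWithin.mono fun p hp => hp.1⟩)
  have h_space : Tendsto (fun p : ℝ × X => T p.1 (p.2 - x)) (𝓝[Ici 0 ×ˢ univ] (t, x)) (𝓝 0) := by
    have h_lim : Tendsto (fun p : ℝ × X => C * ‖p.2 - x‖) (𝓝[Ici 0 ×ˢ univ] (t, x)) (𝓝 0) := by
      have : Continuous fun p : ℝ × X => C * ‖p.2 - x‖ := by fun_prop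
      simpa using (this.tendsto (t, x)).mono_left nhdsWithin_le_nhds
    refine squeeze_zero_norm' ?_ h_lim
    have h_near : ∀ᶠ p : ℝ × X in 𝓝 (t, x), p.1 < t + 1 :=
      continuous_fst.continuousAt.eventually (gt_mem_nhds (lt_add_one t))
    filter_upwards [nhdsWithin_le_nhds h_near, eventually_mem_nhdsWithin] with p hp hp'
    exact (T p.1).le_of_opNorm_le (hC _ ⟨hp'.1, hp.le⟩) _
  simpa [ContinuousWithinAt] using h_space.add h_time

theorem IsC0Semigroup.continuousOn_sub_apply (hT : IsC0Semigroup T) {h : ℝ} {w : ℝ → X}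
    (hw : ContinuousOn w (Icc 0 h)) : ContinuousOn (fun s => T (h - s) (w s)) (Icc 0 h) :=
  hT.continuousOn_uncurry.comp ((continuousOn_const.sub continuousOn_id).prodMk hw)
    fun _ hs => ⟨sub_nonneg.2 hs.2, mem_univ _⟩

theorem IsC0Semigroup.intervalIntegrable_sub_apply (hT : IsC0Semigroup T) {h : ℝ} (hh : 0 ≤ h)
    {w : ℝ → X} (hw : ContinuousOn w (Icc 0 h)) :
    IntervalIntegrable (fun s => T (h - s) (w s)) MeasureTheory.volume 0 h :=
  (hT.continuousOn_sub_apply hw).intervalIntegrable_of_Icc hh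

theorem tendsto_sub_self_nhdsGT (s : ℝ) : Tendsto (fun r : ℝ => r - s) (𝓝[>] s) (𝓝[>] 0) := by
  refine tendsto_nhdsWithin_iff.2 ⟨?_, ?_⟩
  · have h_cont : Continuous fun r : ℝ => r - s := by fun_prop
    simpa using (h_cont.tendsto s).mono_left (nhdsWithin_le_nhds (s := Ioi s))
  · filter_upwards [self_mem_nhdsWithin] with r hr using sub_pos.2 (mem_Ioi.1 hr)

/-- Duhamel's integrand: if `y' = A y + q` at `s`, the terms with the unbounded operator `A`
cancel in the derivative of `r ↦ e^{(h-r)A} y(r)`. -/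
theorem IsGenerator.hasDerivWithinAt_sub_apply (hT : IsC0Semigroup T) (hA : IsGenerator A T)
    {y : ℝ → X} {y' q : X} {h s : ℝ} (hs : s < h) (hy : HasDerivWithinAt y y' (Ioi s) s)
    (hyA : (y s, y' - q) ∈ A.graph) :
    HasDerivWithinAt (fun r => T (h - r) (y r)) (T (h - s) q) (Ioi s) s := by
  rw [hasDerivWithinAt_iff_tendsto_slope' (by simp)] at hy ⊢
  have h_quot := hy.sub (((hA _ _).1 hyA).comp (tendsto_sub_self_nhdsGT s))
  rw [sub_sub_cancel] at h_quot
  have h_pair : Tendsto (fun r : ℝ => (h - r, slope y s r - (r - s)⁻¹ • (T (r - s) (y s) - y s)))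
      (𝓝[>] s) (𝓝[Ici 0 ×ˢ univ] (h - s, q)) := by
    refine tendsto_nhdsWithin_iff.2 ⟨Tendsto.prodMk_nhds ?_ h_quot, ?_⟩
    · exact ((continuous_const.sub continuous_id).tendsto s).mono_left nhdsWithin_le_nhds
    · filter_upwards [Ioc_mem_nhdsGT hs] with r hr using ⟨sub_nonneg.2 hr.2, mem_univ _⟩
  refine ((hT.continuousOn_uncurry (h - s, q) ⟨sub_nonneg.2 hs.le, mem_univ _⟩).tendsto.comp
    h_pair).congr' ?_
  filter_upwards [Ioc_mem_nhdsGT hs] with r hr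
  have hadd : T (h - s) (y s) = T (h - r) (T (r - s) (y s)) := by
    rw [← sub_add_sub_cancel h r s, hT.map_add _ _ (sub_nonneg.2 hr.2) (sub_nonneg.2 hr.1.le)]
    rfl
  simp only [Function.comp, slope, vsub_eq_sub, hadd, map_sub, map_smul]
  module

theorem IsGenerator.variation_of_constants (hT : IsC0Semigroup T) (hA : IsGenerator A T)
    {y y' q : ℝ → X} {h : ℝ} (hh : 0 ≤ h) (hyc : ContinuousOn y (Icc 0 h))
    (hqc : ContinuousOn q (Icc 0 h)) (hy : ∀ s ∈ Ioo 0 h, HasDerivWithinAt y (y' s) (Ioi s) s)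
    (hyA : ∀ s ∈ Ioo 0 h, (y s, y' s - q s) ∈ A.graph) :
    y h = T h (y 0) + ∫ s in (0 : ℝ)..h, T (h - s) (q s) := by
  rw [intervalIntegral.integral_eq_sub_of_hasDeriv_right_of_le hh (hT.continuousOn_sub_apply hyc)
    (fun s hs => hA.hasDerivWithinAt_sub_apply hT hs.2 (hy s hs) (hyA s hs))
    (hT.intervalIntegrable_sub_apply hh hqc)]
  simp [hT.map_zero]

end Semigroup

/-! ### The operators `φ_k(τA)` and `f(τA)` -/

section Operators

variable {X : Type v} [NormedAddCommGroup X] [NormedSpace ℝ X] {T : ℝ → X →L[ℝ] X}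

theorem IsC0Semigroup.continuous_max_apply (hT : IsC0Semigroup T) (x : X) :
    Continuous fun t : ℝ => T (max t 0) x :=
  (hT.continuousOn x).comp_continuous (by fun_prop) fun t => le_max_right t 0

theorem phi_succ_max (k : ℕ) (τ : ℝ) (x : X) : phi T (k + 1) (max τ 0) x =
    ∫ θ in (0 : ℝ)..1, (θ ^ k / (k ! : ℝ)) • T (max ((1 - θ) * τ) 0) x := by
  refine intervalIntegral.integral_congr fun θ hθ => ?_
  rw [uIcc_of_le zero_le_one] at hθ
  simp only [mul_max_of_nonneg _ _ (sub_nonneg.2 hθ.2), mul_zero]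

theorem IsC0Semigroup.intervalIntegrable_phi (hT : IsC0Semigroup T) (k : ℕ) (τ : ℝ) (x : X) :
    IntervalIntegrable (fun θ : ℝ => (θ ^ k / (k ! : ℝ)) • T (max ((1 - θ) * τ) 0) x)
      MeasureTheory.volume 0 1 := by
  have := (hT.continuous_max_apply x).comp (show Continuous fun θ : ℝ => (1 - θ) * τ by fun_prop)
  exact Continuous.intervalIntegrable (Continuous.smul (by fun_prop) this) _ _

theorem norm_integral_pow_div_factorial_smul_le (k : ℕ) {f : ℝ → X} {C : ℝ}
    (hf : ∀ θ ∈ Icc (0 : ℝ) 1, ‖f θ‖ ≤ C) :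
    ‖∫ θ in (0 : ℝ)..1, (θ ^ k / (k ! : ℝ)) • f θ‖ ≤ C := by
  have h_integrand : ∀ θ ∈ uIoc (0 : ℝ) 1, ‖(θ ^ k / (k ! : ℝ)) • f θ‖ ≤ C := by
    intro θ hθ
    rw [uIoc_of_le zero_le_one] at hθ
    have h_weight : θ ^ k / (k ! : ℝ) ≤ 1 := div_le_one_of_le₀
      ((pow_le_one₀ hθ.1.le hθ.2).trans (by exact_mod_cast Nat.factorial_pos k)) (by positivity)
    rw [norm_smul, Real.norm_of_nonneg (div_nonneg (pow_nonneg hθ.1.le _) (by positivity))]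
    exact (mul_le_of_le_one_left (norm_nonneg _) h_weight).trans (hf θ (Ioc_subset_Icc_self hθ))
  simpa using intervalIntegral.norm_integral_le_of_norm_le_const h_integrand

theorem norm_phi_le {R C : ℝ} (hC : ∀ t ∈ Icc 0 R, ‖T t‖ ≤ C) (k : ℕ) {τ : ℝ}
    (hτ : τ ∈ Icc 0 R) (x : X) : ‖phi T k τ x‖ ≤ C * ‖x‖ := by
  cases k with
  | zero => exact (T τ).le_of_opNorm_le (hC _ hτ) _
  | succ k =>
    refine norm_integral_pow_div_factorial_smul_le k fun θ hθ => (T _).le_of_opNorm_le (hC _ ?_) _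
    exact ⟨mul_nonneg (by linarith [hθ.2]) hτ.1, by nlinarith [hθ.1, hτ.1, hτ.2]⟩

variable [CompleteSpace X]

/-- `φ_k(τ A)` as a continuous linear map; the value at `τ < 0` is that at `τ = 0`. -/
def IsC0Semigroup.phiCLM (hT : IsC0Semigroup T) (k : ℕ) (τ : ℝ) : X →L[ℝ] X :=
  LinearMap.mkContinuousOfExistsBound
    { toFun := phi T k (max τ 0)
      map_add' := fun x y => by
        cases k with
        | zero => simp [phi]
        | succ k =>
          simp only [phi_succ_max, _root_.map_add, smul_add]
          exact intervalIntegral.integral_add (hT.intervalIntegrable_phi k τ x)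
            (hT.intervalIntegrable_phi k τ y)
      map_smul' := fun r x => by
        cases k with
        | zero => simp [phi]
        | succ k => simp only [phi, map_smul, smul_comm _ r, intervalIntegral.integral_smul,
            RingHom.id_apply] }
    (by
      obtain ⟨C, -, hC⟩ := hT.exists_norm_le (max τ 0)
      exact ⟨C, norm_phi_le hC k ⟨le_max_right _ _, le_rfl⟩⟩)

namespace IsC0Semigroup

variable (hT : IsC0Semigroup T)

theorem phiCLM_apply (k : ℕ) {τ : ℝ} (hτ : 0 ≤ τ) (x : X) : hT.phiCLM k τ x = phi T k τ x := by
  change phi T k (max τ 0) x = _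
  rw [max_eq_left hτ]

theorem phiCLM_zero_left {τ : ℝ} (hτ : 0 ≤ τ) : hT.phiCLM 0 τ = T τ :=
  ContinuousLinearMap.ext fun x => hT.phiCLM_apply 0 hτ x

theorem phiCLM_zero_right (k : ℕ) (x : X) : hT.phiCLM k 0 x = (k ! : ℝ)⁻¹ • x := by
  rw [hT.phiCLM_apply k le_rfl]
  cases k with
  | zero => simp [phi, hT.map_zero]
  | succ k =>
    have h_pow : ∫ θ in (0 : ℝ)..1, θ ^ k = ((k : ℝ) + 1)⁻¹ := by simp [integral_pow]
    simp only [phi, mul_zero, hT.map_zero]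
    rw [intervalIntegral.integral_smul_const, intervalIntegral.integral_div, h_pow,
      Nat.factorial_succ, Nat.cast_mul, Nat.cast_succ, mul_inv, div_eq_mul_inv]
    rfl

theorem continuous_phiCLM_apply (k : ℕ) (x : X) : Continuous fun τ => hT.phiCLM k τ x := by
  change Continuous fun τ => phi T k (max τ 0) x
  cases k with
  | zero => exact hT.continuous_max_apply x
  | succ k =>
    simp only [phi_succ_max]
    refine intervalIntegral.continuous_parametric_intervalIntegral_of_continuous' ?_ 0 1
    have := (hT.continuous_max_apply x).comp
      (show Continuous fun p : ℝ × ℝ => (1 - p.2) * p.1 by fun_prop)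
    exact Continuous.smul (by fun_prop) this

theorem exists_norm_phiCLM_le (R : ℝ) : ∃ C : ℝ, 0 < C ∧ ∀ k, ∀ τ ≤ R, ‖hT.phiCLM k τ‖ ≤ C := by
  obtain ⟨C, hC0, hC⟩ := hT.exists_norm_le (max R 0)
  refine ⟨C, hC0, fun k τ hτ => ContinuousLinearMap.opNorm_le_bound _ hC0.le fun x => ?_⟩
  exact norm_phi_le hC k ⟨le_max_right _ _, max_le_max hτ le_rfl⟩ x

/-- `f(τ A)` as a continuous linear map that depends linearly on the coefficient function `f`. -/
def coeffCLM (τ : ℝ) : Coeff →ₗ[ℝ] X →L[ℝ] X :=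
  Finsupp.lsum ℝ fun p => LinearMap.toSpanSingleton ℝ _ (hT.phiCLM p.1 ((p.2 : ℝ) * τ))

theorem coeffCLM_eq_sum (f : Coeff) (τ : ℝ) :
    hT.coeffCLM τ f = f.sum fun p r => r • hT.phiCLM p.1 ((p.2 : ℝ) * τ) := rfl

theorem coeffCLM_single (k : ℕ) (σ : ℝ≥0) (a τ : ℝ) :
    hT.coeffCLM τ (Finsupp.single (k, σ) a) = a • hT.phiCLM k (σ * τ) := by
  rw [coeffCLM_eq_sum, Finsupp.sum_single_index]
  exact zero_smul ℝ _

theorem coeffCLM_apply (f : Coeff) {τ : ℝ} (hτ : 0 ≤ τ) (x : X) :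
    hT.coeffCLM τ f x = f.op T τ x := by
  rw [coeffCLM_eq_sum, Coeff.op, Finsupp.sum, Finsupp.sum, sum_apply]
  refine Finset.sum_congr rfl fun p _ => ?_
  rw [smul_apply, hT.phiCLM_apply _ (mul_nonneg (NNReal.coe_nonneg _) hτ)]

theorem exists_norm_coeffCLM_le (f : Coeff) (R : ℝ) :
    ∃ C : ℝ, 0 < C ∧ ∀ τ ≤ R, ‖hT.coeffCLM τ f‖ ≤ C := by
  choose C hC0 hC using fun p : ℕ × ℝ≥0 => hT.exists_norm_phiCLM_le (p.2 * R)
  have h_sum : 0 ≤ ∑ p ∈ f.support, ‖f p‖ * C p :=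
    Finset.sum_nonneg fun p _ => mul_nonneg (norm_nonneg _) (hC0 p).le
  refine ⟨(∑ p ∈ f.support, ‖f p‖ * C p) + 1, by positivity, fun τ hτ => ?_⟩
  rw [coeffCLM_eq_sum]
  refine (norm_sum_le_of_le _ fun p _ => ?_).trans (le_add_of_nonneg_right zero_le_one)
  rw [norm_smul]
  gcongr
  exact hC p _ _ (mul_le_mul_of_nonneg_left hτ p.2.2)

theorem integral_pow_smul (k : ℕ) {h : ℝ} (hh : 0 ≤ h) (x : X) :
    ∫ s in (0 : ℝ)..h, T (h - s) ((s ^ k / (k ! : ℝ)) • x) =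
      h ^ (k + 1) • hT.phiCLM (k + 1) h x := by
  have h_scale := intervalIntegral.smul_integral_comp_mul_right (a := 0) (b := 1)
    (fun s : ℝ => T (h - s) ((s ^ k / (k ! : ℝ)) • x)) h
  rw [zero_mul, one_mul] at h_scale
  rw [hT.phiCLM_apply _ hh, phi, ← h_scale, pow_succ', mul_smul,
    ← intervalIntegral.integral_smul (h ^ k)]
  congr 2
  funext θ
  rw [map_smul, smul_smul, show h - θ * h = (1 - θ) * h by ring]
  congr 1
  ring

theorem integral_sum_pow_smul (n : ℕ) (x : ℕ → X) {h : ℝ} (hh : 0 ≤ h) :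
    ∫ s in (0 : ℝ)..h, T (h - s) (∑ k ∈ Finset.range n, (s ^ k / (k ! : ℝ)) • x k) =
      ∑ k ∈ Finset.range n, h ^ (k + 1) • hT.phiCLM (k + 1) h (x k) := by
  simp only [map_sum]
  rw [intervalIntegral.integral_finsetSum fun k _ =>
    hT.intervalIntegrable_sub_apply hh (Continuous.continuousOn (by fun_prop))]
  exact Finset.sum_congr rfl fun k _ => hT.integral_pow_smul k hh (x k)

end IsC0Semigroup

/-! ### The generator and the recursion `φ_k(z) = 1/k! + z φ_{k+1}(z)` -/

variable {A : X →ₗ.[ℝ] X}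

namespace IsGenerator

theorem pow_smul_phiCLM (hT : IsC0Semigroup T) (hA : IsGenerator A T) {x y : X}
    (hxy : (x, y) ∈ A.graph) (k : ℕ) {τ : ℝ} (hτ : 0 ≤ τ) :
    τ ^ k • hT.phiCLM k τ x =
      (τ ^ k / (k ! : ℝ)) • x + τ ^ (k + 1) • hT.phiCLM (k + 1) τ y := by
  cases k with
  | zero =>
    have h_duhamel := hA.variation_of_constants hT (y := fun _ => x) (y' := fun _ => 0)
      (q := fun _ => -y) hτ continuousOn_const continuousOn_const
      (fun s _ => hasDerivWithinAt_const _ _ _) fun s _ => by simpa using hxy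
    have h_int := hT.integral_pow_smul 0 hτ y
    simp only [map_neg, intervalIntegral.integral_neg, pow_zero, Nat.factorial_zero, Nat.cast_one,
      div_one, one_smul] at h_duhamel h_int ⊢
    rw [h_int] at h_duhamel
    rw [hT.phiCLM_zero_left hτ]
    nth_rewrite 2 [h_duhamel]
    abel
  | succ k =>
    have h_deriv : ∀ s : ℝ, HasDerivAt (fun s : ℝ => (s ^ (k + 1) / ((k + 1)! : ℝ)) • x)
        ((s ^ k / (k ! : ℝ)) • x) s := fun s => by
      convert ((hasDerivAt_pow (k + 1) s).div_const ((k + 1)! : ℝ)).smul_const x using 2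
      rw [Nat.factorial_succ, Nat.cast_mul, Nat.add_sub_cancel,
        mul_div_mul_left _ _ (Nat.cast_ne_zero.2 k.succ_ne_zero)]
    have h_duhamel := hA.variation_of_constants hT
      (y := fun s => (s ^ (k + 1) / ((k + 1)! : ℝ)) • x)
      (q := fun s => (s ^ k / (k ! : ℝ)) • x - (s ^ (k + 1) / ((k + 1)! : ℝ)) • y) hτ
      (by fun_prop) (by fun_prop) (fun s _ => (h_deriv s).hasDerivWithinAt) fun s _ => by
        rw [sub_sub_cancel]
        exact A.graph.smul_mem _ hxy
    simp only [map_sub] at h_duhamel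
    rw [intervalIntegral.integral_sub
        (hT.intervalIntegrable_sub_apply hτ (Continuous.continuousOn (by fun_prop)))
        (hT.intervalIntegrable_sub_apply hτ (Continuous.continuousOn (by fun_prop))),
      hT.integral_pow_smul _ hτ, hT.integral_pow_smul _ hτ] at h_duhamel
    rw [h_duhamel]
    simp

theorem mem_graph_iff (hT : IsC0Semigroup T) (hA : IsGenerator A T) {x y : X} :
    (x, y) ∈ A.graph ↔ ∀ τ : ℝ, 0 ≤ τ → T τ x = x + τ • hT.phiCLM 1 τ y := by
  refine ⟨fun hxy τ hτ => ?_, fun h => (hA x y).2 ?_⟩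
  · simpa [hT.phiCLM_zero_left hτ] using hA.pow_smul_phiCLM hT hxy 0 hτ
  · have h_lim := ((hT.continuous_phiCLM_apply 1 y).tendsto 0).mono_left
      (nhdsWithin_le_nhds (s := Ioi 0))
    rw [hT.phiCLM_zero_right, Nat.factorial_one, Nat.cast_one, inv_one, one_smul] at h_lim
    refine h_lim.congr' ?_
    filter_upwards [self_mem_nhdsWithin] with τ hτ
    rw [h τ (mem_Ioi.1 hτ).le, add_sub_cancel_left, inv_smul_smul₀ (mem_Ioi.1 hτ).ne']

theorem isClosed_graph (hT : IsC0Semigroup T) (hA : IsGenerator A T) :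
    IsClosed (A.graph : Set (X × X)) := by
  have h_inter : (A.graph : Set (X × X)) =
      ⋂ τ ∈ Ici (0 : ℝ), {p : X × X | T τ p.1 = p.1 + τ • hT.phiCLM 1 τ p.2} := by
    ext ⟨x, y⟩
    simp [hA.mem_graph_iff hT]
  rw [h_inter]
  exact isClosed_biInter fun τ _ => isClosed_eq (by fun_prop) (by fun_prop)

theorem apply_eq_sum_of_mem_graph (hT : IsC0Semigroup T) (hA : IsGenerator A T) {x q : ℕ → X}
    {τ : ℝ} (hτ : 0 ≤ τ) (n : ℕ) (hx : ∀ k < n, (x k, x (k + 1) - q k) ∈ A.graph) :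
    T τ (x 0) = ∑ k ∈ Finset.range n, (τ ^ k / (k ! : ℝ)) • x k -
      ∑ k ∈ Finset.range n, τ ^ (k + 1) • hT.phiCLM (k + 1) τ (q k) +
        τ ^ n • hT.phiCLM n τ (x n) := by
  induction n with
  | zero => simp [hT.phiCLM_zero_left hτ]
  | succ n ih =>
    rw [ih fun k hk => hx k (hk.trans n.lt_succ_self),
      hA.pow_smul_phiCLM hT (hx n n.lt_succ_self) n hτ, Finset.sum_range_succ,
      Finset.sum_range_succ, map_sub]
    module

end IsGenerator

end Operators

/-! ### Parabolic smoothing -/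

section Sector

variable {Y : Type v} [NormedAddCommGroup Y] [NormedSpace ℂ Y] {δ : ℝ} {S : ℂ → Y →L[ℂ] Y}

theorem isOpen_sector (hδ : δ ≤ Real.pi) : IsOpen (sector δ) := by
  rw [isOpen_iff_mem_nhds]
  rintro z ⟨hz, h_arg⟩
  have hz_slit : z ∈ Complex.slitPlane := by
    rw [Complex.mem_slitPlane_iff_arg]
    exact ⟨fun h => by rw [h, abs_of_pos Real.pi_pos] at h_arg; linarith, hz⟩
  filter_upwards [(Complex.continuousAt_arg hz_slit).abs.eventually (gt_mem_nhds h_arg),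
    isOpen_ne.mem_nhds hz] with w hw_arg hw
  exact ⟨hw, hw_arg⟩

theorem ofReal_mul_mem_sector {t : ℝ} (ht : 0 < t) {z : ℂ} (hz : z ∈ sector δ) :
    (t : ℂ) * z ∈ sector δ :=
  ⟨mul_ne_zero (by exact_mod_cast ht.ne') hz.1, by rw [Complex.arg_real_mul z ht]; exact hz.2⟩

theorem exists_closedBall_subset_sector (hδ : 0 < δ) (hδ' : δ ≤ Real.pi) :
    ∃ κ : ℝ, 0 < κ ∧ ∀ t : ℝ, 0 < t → Metric.closedBall (t : ℂ) (κ * t) ⊆ sector δ := by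
  have h_one : (1 : ℂ) ∈ sector δ := ⟨one_ne_zero, by simpa using hδ⟩
  obtain ⟨κ, hκ, hκδ⟩ := Metric.nhds_basis_closedBall.mem_iff.1 ((isOpen_sector hδ').mem_nhds h_one)
  refine ⟨κ, hκ, fun t ht z hz => ?_⟩
  have ht' : (t : ℂ) ≠ 0 := by exact_mod_cast ht.ne'
  rw [← mul_div_cancel₀ z ht']
  refine ofReal_mul_mem_sector ht (hκδ ?_)
  rw [mem_closedBall_iff_norm] at hz ⊢
  rwa [div_sub_one ht', norm_div, Complex.norm_of_nonneg ht.le, div_le_iff₀ ht]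

namespace IsSectorialSemigroup

variable [CompleteSpace Y]

theorem exists_norm_le (hS : IsSectorialSemigroup δ S) :
    ∃ ε C : ℝ, 0 < ε ∧ 0 < C ∧ ∀ z ∈ sector δ, ‖z‖ < ε → ‖S z‖ ≤ C := by
  by_contra! h_unbounded
  have h_seq : ∀ n : ℕ, ∃ z ∈ sector δ, ‖z‖ < 1 / ((n : ℝ) + 1) ∧ (n : ℝ) + 1 < ‖S z‖ := fun n =>
    h_unbounded _ _ (by positivity) (by positivity)
  choose z hz hz_small hz_large using h_seq
  have h_lim : Tendsto z atTop (𝓝[sector δ] 0) :=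
    tendsto_nhdsWithin_iff.2 ⟨squeeze_zero_norm (fun n => (hz_small n).le)
      tendsto_one_div_add_atTop_nhds_zero_nat, Eventually.of_forall hz⟩
  obtain ⟨C, hC⟩ := banach_steinhaus (g := fun n => S (z n)) fun y => by
    obtain ⟨C, hC⟩ := ((hS.tendsto_zero y).comp h_lim).norm.bddAbove_range
    exact ⟨C, fun n => hC ⟨n, rfl⟩⟩
  obtain ⟨n, hn⟩ := exists_nat_gt C
  linarith [hC n, hz_large n]

theorem exists_norm_deriv_le (hS : IsSectorialSemigroup δ S) (hδ : 0 < δ) (hδ' : δ ≤ Real.pi) :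
    ∃ ε C : ℝ, 0 < ε ∧ 0 < C ∧ ∀ t : ℝ, 0 < t → t < ε →
      DifferentiableAt ℂ S t ∧ ‖deriv S t‖ ≤ C / t := by
  obtain ⟨ε, C, hε, hC0, hC⟩ := hS.exists_norm_le
  obtain ⟨κ, hκ, h_ball⟩ := exists_closedBall_subset_sector hδ hδ'
  refine ⟨ε / (1 + κ), C / κ, by positivity, by positivity, fun t ht htε => ⟨?_, ?_⟩⟩
  · exact hS.analytic.differentiableAt ((isOpen_sector hδ').mem_nhds
      (h_ball t ht (Metric.mem_closedBall_self (by positivity))))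
  · rw [div_div]
    refine Complex.norm_deriv_le_of_forall_mem_sphere_norm_le (by positivity)
      ((hS.analytic.mono (h_ball t ht)).diffContOnCl_ball subset_rfl) fun z hz =>
        hC z (h_ball t ht (Metric.sphere_subset_closedBall hz)) ?_
    rw [mem_sphere_iff_norm] at hz
    rw [lt_div_iff₀ (by positivity)] at htε
    calc ‖z‖ ≤ ‖z - t‖ + ‖(t : ℂ)‖ := by simpa using norm_add_le (z - t) (t : ℂ)
      _ = t * (1 + κ) := by rw [hz, Complex.norm_of_nonneg ht.le]; ring
      _ < ε := htε

end IsSectorialSemigroup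

end Sector

section RiemannSum

variable {E : Type*} [NormedAddCommGroup E] [NormedSpace ℝ E] {f : ℝ → E}

theorem norm_smul_sum_sub_integral_le [CompleteSpace E] (hf : Continuous f) {h : ℝ}
    (hh : 0 ≤ h) {B : ℕ → ℝ} (n : ℕ)
    (hB : ∀ j < n, ∀ s ∈ Icc 0 h, ‖f (j * h) - f (j * h + s)‖ ≤ B j) :
    ‖h • ∑ j ∈ Finset.range n, f (j * h) - ∫ s in (0 : ℝ)..n * h, f s‖ ≤
      h * ∑ j ∈ Finset.range n, B j := by
  induction n with
  | zero => simp
  | succ n ih =>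
    have h_last : ∫ s in (n * h : ℝ)..n * h + h, (f (n * h) - f s) =
        h • f (n * h) - ∫ s in (n * h : ℝ)..n * h + h, f s := by
      rw [intervalIntegral.integral_sub (by simp) (hf.intervalIntegrable _ _),
        intervalIntegral.integral_const, add_sub_cancel_left]
    have h_last_le : ‖∫ s in (n * h : ℝ)..n * h + h, (f (n * h) - f s)‖ ≤ h * B n := by
      refine (intervalIntegral.norm_integral_le_of_norm_le_const (C := B n)
        fun s hs => ?_).trans_eq ?_
      · rw [uIoc_of_le (by linarith)] at hs
        have := hB n n.lt_succ_self (s - n * h) ⟨by linarith [hs.1], by linarith [hs.2]⟩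
        rwa [add_sub_cancel] at this
      · rw [add_sub_cancel_left, abs_of_nonneg hh, mul_comm]
    rw [Nat.cast_succ, add_one_mul,
      ← intervalIntegral.integral_add_adjacent_intervals (hf.intervalIntegrable 0 (n * h))
        (hf.intervalIntegrable (n * h) (n * h + h)),
      Finset.sum_range_succ, Finset.sum_range_succ, smul_add, mul_add, add_sub_add_comm, ← h_last]
    exact norm_add_le_of_le (ih fun j hj => hB j (hj.trans n.lt_succ_self)) h_last_le

theorem integral_comp_add_sub (hf : Continuous f) (a L : ℝ) :
    ∫ s in (0 : ℝ)..L, (f (s + a) - f s) =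
      (∫ s in L..L + a, f s) - ∫ s in (0 : ℝ)..a, f s := by
  have h_shift : Continuous fun s => f (s + a) := by fun_prop
  have hi := fun b c => hf.intervalIntegrable (μ := MeasureTheory.volume) b c
  rw [intervalIntegral.integral_sub (h_shift.intervalIntegrable _ _) (hi _ _),
    intervalIntegral.integral_comp_add_right, zero_add,
    intervalIntegral.integral_interval_sub_interval_comm (hi _ _) (hi _ _) (hi _ _)]
  rw [intervalIntegral.integral_symm a 0, intervalIntegral.integral_symm (L + a) L]
  abel

end RiemannSum

section Smoothing

variable {X : Type v} [NormedAddCommGroup X] [NormedSpace ℝ X] {T : ℝ → X →L[ℝ] X}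

theorem IsC0Semigroup.apply_add (hT : IsC0Semigroup T) {s t : ℝ} (hs : 0 ≤ s) (ht : 0 ≤ t)
    (x : X) : T (s + t) x = T s (T t x) := by
  rw [hT.map_add s t hs ht]
  rfl

theorem IsC0Semigroup.apply_comm (hT : IsC0Semigroup T) {s t : ℝ} (hs : 0 ≤ s) (ht : 0 ≤ t)
    (x : X) : T s (T t x) = T t (T s x) := by
  rw [← hT.apply_add hs ht, add_comm, hT.apply_add ht hs]

namespace IsAnalyticSemigroup

theorem exists_norm_apply_sub_le_near_zero (hT : IsAnalyticSemigroup T) :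
    ∃ ε C : ℝ, 0 < ε ∧ 0 < C ∧ ∀ t a : ℝ, 0 < t → 0 ≤ a → t + a < ε → ∀ x,
      ‖T t (T a x - x)‖ ≤ C * (a / t) * ‖x‖ := by
  obtain ⟨hT0, Y, _, _, _, ι, δ, S, hδ, hδ', hS, hSι⟩ := hT
  obtain ⟨ε, C, hε, hC0, hC⟩ := hS.exists_norm_deriv_le hδ (by linarith [Real.pi_pos])
  refine ⟨ε, C, hε, hC0, fun t a ht ha htε x => ?_⟩
  have h_deriv : ∀ z ∈ Complex.ofRealCLM '' Icc t (t + a),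
      DifferentiableAt ℂ S z ∧ ‖deriv S z‖ ≤ C / t := by
    rintro _ ⟨r, hr, rfl⟩
    obtain ⟨h_diff, h_norm⟩ := hC r (by linarith [hr.1]) (by linarith [hr.2])
    exact ⟨h_diff, h_norm.trans (by gcongr; exact hr.1)⟩
  have h_mean := ((convex_Icc t (t + a)).linear_image
    Complex.ofRealCLM.toLinearMap).norm_image_sub_le_of_norm_deriv_le
    (fun z hz => (h_deriv z hz).1) (fun z hz => (h_deriv z hz).2)
    ⟨t, ⟨le_rfl, by linarith⟩, rfl⟩ ⟨t + a, ⟨by linarith, le_rfl⟩, rfl⟩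
  change ‖S ((t + a : ℝ) : ℂ) - S (t : ℂ)‖ ≤ C / t * ‖((t + a : ℝ) : ℂ) - (t : ℂ)‖ at h_mean
  have h_embed : ι (T t (T a x - x)) = (S ((t + a : ℝ) : ℂ) - S (t : ℂ)) (ι x) := by
    rw [map_sub, ← hT0.apply_add ht.le ha, map_sub, sub_apply, hSι _ (by linarith), hSι _ ht.le]
  rw [← ι.norm_map, h_embed, ← ι.norm_map x]
  refine (ContinuousLinearMap.le_of_opNorm_le _ h_mean _).trans_eq ?_
  rw [← Complex.ofReal_sub, add_sub_cancel_left, Complex.norm_of_nonneg ha]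
  ring

theorem exists_norm_apply_sub_le_div [CompleteSpace X] (hT : IsAnalyticSemigroup T) {R : ℝ}
    (hR : 0 < R) :
    ∃ η C : ℝ, 0 < η ∧ 0 < C ∧ ∀ t a : ℝ, 0 < t → t ≤ R → 0 ≤ a → a < η → ∀ x,
      ‖T t (T a x - x)‖ ≤ C * (a / t) * ‖x‖ := by
  obtain ⟨ε, C, hε, hC0, hC⟩ := hT.exists_norm_apply_sub_le_near_zero
  obtain ⟨B, hB0, hB⟩ := hT.1.exists_norm_le R
  set η := ε / 2 with hη
  have hη0 : 0 < η := by positivity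
  refine ⟨η, B * (C * (1 + R / η)), hη0, by positivity, fun t a ht htR ha haη x => ?_⟩
  -- Peel off `T t'` with `t'` comparable to `t` but close enough to `0` for the local estimate.
  set t' := min t η with ht'
  have ht'0 : 0 < t' := lt_min ht hη0
  have h_split : T t (T a x - x) = T (t - t') (T t' (T a x - x)) := by
    rw [← hT.1.apply_add (sub_nonneg.2 (min_le_left _ _)) ht'0.le, sub_add_cancel]
  have h_compare : a / t' ≤ (1 + R / η) * (a / t) := by
    have hRη : R / η * η = R := div_mul_cancel₀ _ hη0.ne'
    have h_le : t ≤ (1 + R / η) * t' := by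
      rcases min_choice t η with h | h <;> rw [ht', h]
      · nlinarith [div_pos hR hη0]
      · nlinarith
    rw [← mul_div_assoc, div_le_div_iff₀ ht'0 ht]
    nlinarith
  have h_local := hC t' a ht'0 ha (by linarith [min_le_right t η]) x
  calc _ ≤ B * (C * (a / t') * ‖x‖) := by
        rw [h_split]
        exact (T _).le_of_opNorm_le_of_le
          (hB _ ⟨sub_nonneg.2 (min_le_left _ _), by linarith⟩) h_local
    _ ≤ B * (C * ((1 + R / η) * (a / t)) * ‖x‖) := by gcongr
    _ = _ := by ring

theorem exists_norm_apply_sub_le [CompleteSpace X] (hT : IsAnalyticSemigroup T) {R : ℝ}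
    (hR : 0 < R) :
    ∃ C : ℝ, 0 < C ∧ ∀ κ t a : ℝ, 0 < κ → κ ≤ R → t ∈ Icc 0 R → a ∈ Icc 0 κ → ∀ x,
      ‖T t (T a x - x)‖ ≤ C * (κ / (t + κ)) * ‖x‖ := by
  obtain ⟨η, C, hη, hC0, hC⟩ := hT.exists_norm_apply_sub_le_div hR
  obtain ⟨B, hB0, hB⟩ := hT.1.exists_norm_le R
  have hRη : 0 < R / η := by positivity
  refine ⟨2 * C + B * (B + 1) * (2 * (1 + R / η)), by positivity,
    fun κ t a hκ hκR ht ha x => ?_⟩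
  have htκ : 0 < t + κ := by linarith [ht.1]
  rw [add_mul, add_mul]
  by_cases h_small : κ < t ∧ κ < η
  · have ht0 : 0 < t := hκ.trans h_small.1
    have h_ratio : a / t ≤ 2 * (κ / (t + κ)) := by
      rw [← mul_div_assoc, div_le_div_iff₀ ht0 htκ]
      nlinarith [ha.2, h_small.1]
    calc _ ≤ C * (a / t) * ‖x‖ := hC t a ht0 ht.2 ha.1 (ha.2.trans_lt h_small.2) x
      _ ≤ C * (2 * (κ / (t + κ))) * ‖x‖ := by gcongr
      _ = 2 * C * (κ / (t + κ)) * ‖x‖ := by ring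
      _ ≤ _ := le_add_of_nonneg_right (by positivity)
  · have h_ratio : 1 ≤ 2 * (1 + R / η) * (κ / (t + κ)) := by
      rw [← mul_div_assoc, le_div_iff₀ htκ, one_mul]
      rcases not_and_or.1 h_small with h | h
      · nlinarith
      · nlinarith [ht.2, div_mul_cancel₀ R hη.ne']
    have h_diff : ‖T a x - x‖ ≤ (B + 1) * ‖x‖ := by
      have := (T a).le_of_opNorm_le (hB a ⟨ha.1, ha.2.trans hκR⟩) x
      linarith [norm_sub_le (T a x) x]
    calc _ ≤ B * ((B + 1) * ‖x‖) := (T t).le_of_opNorm_le_of_le (hB t ht) h_diff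
      _ = B * (B + 1) * ‖x‖ * 1 := by ring
      _ ≤ B * (B + 1) * ‖x‖ * (2 * (1 + R / η) * (κ / (t + κ))) := by gcongr
      _ = B * (B + 1) * (2 * (1 + R / η)) * (κ / (t + κ)) * ‖x‖ := by ring
      _ ≤ _ := le_add_of_nonneg_left (by positivity)

theorem exists_norm_apply_sub_sub_le [CompleteSpace X] (hT : IsAnalyticSemigroup T) {R : ℝ}
    (hR : 0 < R) :
    ∃ C : ℝ, 0 < C ∧ ∀ κ t a b : ℝ, 0 < κ → κ ≤ R → t ∈ Icc 0 R → a ∈ Icc 0 κ → b ∈ Icc 0 κ →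
      ∀ x, ‖T t (T a (T b x - x) - (T b x - x))‖ ≤ C * (κ / (t + κ)) ^ 2 * ‖x‖ := by
  obtain ⟨C, hC0, hC⟩ := hT.exists_norm_apply_sub_le hR
  refine ⟨4 * C ^ 2, by positivity, fun κ t a b hκ hκR ht ha hb x => ?_⟩
  have ht2 : t / 2 ∈ Icc 0 R := ⟨by linarith [ht.1], by linarith [ht.1, ht.2]⟩
  have h_half : κ / (t / 2 + κ) ≤ 2 * (κ / (t + κ)) := by
    rw [← mul_div_assoc, div_le_div_iff₀ (by linarith [ht2.1]) (by linarith [ht.1])]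
    nlinarith
  have h_split : T t (T a (T b x - x) - (T b x - x)) =
      T (t / 2) (T a (T (t / 2) (T b x - x)) - T (t / 2) (T b x - x)) := by
    rw [hT.1.apply_comm ha.1 ht2.1, ← map_sub, ← hT.1.apply_add ht2.1 ht2.1, add_halves]
  have hq : 0 ≤ κ / (t / 2 + κ) := div_nonneg hκ.le (by linarith [ht2.1])
  calc _ ≤ C * (κ / (t / 2 + κ)) * (C * (κ / (t / 2 + κ)) * ‖x‖) := by
        rw [h_split]
        refine (hC κ _ a hκ hκR ht2 ha _).trans ?_
        gcongr
        exact hC κ _ b hκ hκR ht2 hb x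
    _ = C ^ 2 * (κ / (t / 2 + κ)) ^ 2 * ‖x‖ := by ring
    _ ≤ C ^ 2 * (2 * (κ / (t + κ))) ^ 2 * ‖x‖ := by gcongr
    _ = _ := by ring

end IsAnalyticSemigroup

theorem exists_sum_inv_sq_le : ∃ C : ℝ, 0 < C ∧ ∀ n : ℕ,
    ∑ j ∈ Finset.range n, 1 / ((j : ℝ) + 1) ^ 2 ≤ C := by
  have h_summable : Summable fun j : ℕ => 1 / ((j : ℝ) + 1) ^ 2 := by
    simpa using (summable_nat_add_iff 1).2 (Real.summable_one_div_nat_pow.2 one_lt_two)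
  exact ⟨∑' j : ℕ, 1 / ((j : ℝ) + 1) ^ 2, h_summable.tsum_pos (fun j => by positivity) 0 (by simp),
    fun n => h_summable.sum_le_tsum _ fun j _ => by positivity⟩

theorem IsC0Semigroup.norm_integral_apply_sub_le (hT : IsC0Semigroup T) {a L B : ℝ} (ha : 0 ≤ a)
    (hL : 0 ≤ L) (hB : ∀ t ∈ Icc 0 (L + a), ‖T t‖ ≤ B) (x : X) :
    ‖∫ s in (0 : ℝ)..L, T (max s 0) (T a x - x)‖ ≤ 2 * B * a * ‖x‖ := by
  have h_shift : ∀ s ∈ uIcc 0 L, T (max s 0) (T a x - x) = T (max (s + a) 0) x - T (max s 0) x := by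
    intro s hs
    rw [uIcc_of_le hL] at hs
    rw [max_eq_left hs.1, max_eq_left (add_nonneg hs.1 ha), _root_.map_sub, hT.apply_add hs.1 ha]
  have h_norm : ∀ b, 0 ≤ b → b ≤ L → ‖∫ s in b..b + a, T (max s 0) x‖ ≤ B * ‖x‖ * a := by
    intro b hb hbL
    refine (intervalIntegral.norm_integral_le_of_norm_le_const fun s hs => ?_).trans_eq
      (by rw [add_sub_cancel_left, abs_of_nonneg ha])
    rw [uIoc_of_le (by linarith)] at hs
    rw [max_eq_left (hb.trans hs.1.le)]
    exact (T s).le_of_opNorm_le (hB s ⟨hb.trans hs.1.le, by linarith [hs.2]⟩) x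
  rw [intervalIntegral.integral_congr h_shift, integral_comp_add_sub (hT.continuous_max_apply x)]
  refine (norm_sub_le_of_le (h_norm L hL le_rfl) (?_ : _ ≤ B * ‖x‖ * a)).trans_eq (by ring)
  simpa using h_norm 0 le_rfl hL

variable [CompleteSpace X]

namespace IsAnalyticSemigroup

/-- The sum is a Riemann sum for `h⁻¹ ∫₀^{nh} e^{sA} (e^{θhA} - 1) ds`, in which all but the two
ends of the interval cancel; by the second difference bound its `j`-th error term is `O(j⁻²)`. -/
theorem exists_norm_sum_apply_sub_le (hT : IsAnalyticSemigroup T) (R : ℝ) {σ : ℝ} (hσ : 0 ≤ σ) :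
    ∃ C : ℝ, 0 < C ∧ ∀ h : ℝ, 0 < h → ∀ n : ℕ, n * h ≤ R → ∀ θ ∈ Icc 0 σ, ∀ x,
      ‖∑ j ∈ Finset.range n, T (j * h) (T (θ * h) x - x)‖ ≤ C * ‖x‖ := by
  set R' := (σ + 1) * (|R| + 1) with hR'
  have hRR' : |R| + 1 ≤ R' := by nlinarith [abs_nonneg R]
  obtain ⟨C, hC0, hC⟩ := hT.exists_norm_apply_sub_sub_le (show 0 < R' by positivity)
  obtain ⟨K, hK0, hK⟩ := exists_sum_inv_sq_le
  obtain ⟨B, hB0, hB⟩ := hT.1.exists_norm_le (2 * R')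
  refine ⟨C * (σ + 1) ^ 2 * K + 2 * B * σ, by positivity, fun h hh n hn θ hθ x => ?_⟩
  rcases n.eq_zero_or_pos with rfl | hn0
  · simpa using by positivity
  have hnR : n * h ≤ |R| + 1 := by linarith [le_abs_self R]
  have hhR : h ≤ |R| + 1 := by nlinarith [(Nat.one_le_cast (α := ℝ)).2 hn0]
  have hθσ : θ * h ≤ σ * h := by gcongr; exact hθ.2
  have hκ : (σ + 1) * h ≤ R' := by rw [hR']; gcongr
  have h_riemann := norm_smul_sum_sub_integral_le (hT.1.continuous_max_apply (T (θ * h) x - x))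
    hh.le (B := fun j => C * (σ + 1) ^ 2 * ‖x‖ * (1 / ((j : ℝ) + 1) ^ 2)) n fun j hj s hs => by
      have hjh : (j : ℝ) * h ∈ Icc 0 R' :=
        ⟨by positivity, le_trans (by gcongr) (hnR.trans hRR')⟩
      have h_weight : (σ + 1) * h / (j * h + (σ + 1) * h) ≤ (σ + 1) * (1 / ((j : ℝ) + 1)) := by
        rw [← add_mul, mul_div_mul_right _ _ hh.ne', mul_one_div]
        gcongr
        linarith
      rw [max_eq_left hjh.1, max_eq_left (add_nonneg hjh.1 hs.1), hT.1.apply_add hjh.1 hs.1,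
        norm_sub_rev, ← map_sub]
      calc _ ≤ C * ((σ + 1) * h / (j * h + (σ + 1) * h)) ^ 2 * ‖x‖ :=
            hC _ _ s _ (by positivity) hκ hjh ⟨hs.1, by nlinarith [hs.2, mul_nonneg hσ hh.le]⟩
              ⟨mul_nonneg hθ.1 hh.le, by linarith⟩ x
        _ ≤ C * ((σ + 1) * (1 / ((j : ℝ) + 1))) ^ 2 * ‖x‖ := by gcongr
        _ = _ := by rw [mul_pow, one_div_pow]; ring
  have h_integral := hT.1.norm_integral_apply_sub_le (mul_nonneg hθ.1 hh.le)
    (by positivity : 0 ≤ n * h) (fun t ht => hB t ⟨ht.1, by linarith [ht.2]⟩) x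
  have h_max : ∀ j : ℕ, max ((j : ℝ) * h) 0 = j * h := fun j => max_eq_left (by positivity)
  simp only [h_max, ← Finset.mul_sum] at h_riemann
  refine le_of_mul_le_mul_left ?_ hh
  calc h * ‖∑ j ∈ Finset.range n, T (j * h) (T (θ * h) x - x)‖
      = ‖h • ∑ j ∈ Finset.range n, T (j * h) (T (θ * h) x - x)‖ := by
        rw [norm_smul, Real.norm_of_nonneg hh.le]
    _ ≤ _ := norm_le_norm_sub_add _ (∫ s in (0 : ℝ)..n * h, T (max s 0) (T (θ * h) x - x))
    _ ≤ h * (C * (σ + 1) ^ 2 * ‖x‖ * K) + 2 * B * (σ * h) * ‖x‖ := by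
        refine add_le_add (h_riemann.trans ?_) (h_integral.trans ?_)
        · gcongr
          exact hK n
        · gcongr
    _ = _ := by ring

theorem exists_norm_sum_phiCLM_sub_le (hT : IsAnalyticSemigroup T) (R : ℝ) (k : ℕ) (σ : ℝ≥0) :
    ∃ C : ℝ, 0 < C ∧ ∀ h : ℝ, 0 < h → ∀ n : ℕ, n * h ≤ R → ∀ x,
      ‖∑ j ∈ Finset.range n, T (j * h) ((hT.1.phiCLM k (σ * h) - hT.1.phiCLM k 0) x)‖ ≤
        C * ‖x‖ := by
  obtain ⟨C, hC0, hC⟩ := hT.exists_norm_sum_apply_sub_le R σ.2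
  refine ⟨C, hC0, fun h hh n hn x => ?_⟩
  have hσh : 0 ≤ σ * h := mul_nonneg σ.2 hh.le
  rw [sub_apply, hT.1.phiCLM_apply _ hσh, hT.1.phiCLM_apply _ le_rfl]
  cases k with
  | zero => simpa [phi, hT.1.map_zero] using hC h hh n hn σ ⟨σ.2, le_rfl⟩ x
  | succ k =>
    have h_sum : ∑ j ∈ Finset.range n, T (j * h) (phi T (k + 1) (σ * h) x - phi T (k + 1) 0 x) =
        ∫ θ in (0 : ℝ)..1, (θ ^ k / (k ! : ℝ)) •
          ∑ j ∈ Finset.range n, T (j * h) (T (max ((1 - θ) * σ * h) 0) x - x) := by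
      have hi := fun τ => hT.1.intervalIntegrable_phi k τ x
      have h_phi : ∀ τ, 0 ≤ τ → phi T (k + 1) τ x =
          ∫ θ in (0 : ℝ)..1, (θ ^ k / (k ! : ℝ)) • T (max ((1 - θ) * τ) 0) x := fun τ hτ => by
        rw [← phi_succ_max, max_eq_left hτ]
      rw [h_phi _ hσh, h_phi 0 le_rfl, ← intervalIntegral.integral_sub (hi _) (hi _)]
      have h_comm := ContinuousLinearMap.intervalIntegral_comp_comm
        (∑ j ∈ Finset.range n, T (j * h)) ((hi (σ * h)).sub (hi 0))
      simp only [sum_apply] at h_comm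
      rw [← h_comm]
      congr 1
      funext θ
      simp [Finset.smul_sum, hT.1.map_zero, mul_assoc, smul_sub]
    rw [h_sum]
    refine norm_integral_pow_div_factorial_smul_le k fun θ hθ => ?_
    have hθσ : (1 - θ) * σ ∈ Icc 0 (σ : ℝ) :=
      ⟨mul_nonneg (by linarith [hθ.2]) σ.2, mul_le_of_le_one_left σ.2 (by linarith [hθ.1])⟩
    rw [max_eq_left (mul_nonneg hθσ.1 hh.le)]
    exact hC h hh n hn _ hθσ x

theorem exists_norm_sum_coeffCLM_sub_le (hT : IsAnalyticSemigroup T) (R : ℝ) (f : Coeff) :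
    ∃ C : ℝ, 0 < C ∧ ∀ h : ℝ, 0 < h → ∀ n : ℕ, n * h ≤ R → ∀ x,
      ‖∑ j ∈ Finset.range n, T (j * h) ((hT.1.coeffCLM h f - hT.1.coeffCLM 0 f) x)‖ ≤ C * ‖x‖ := by
  induction f using Finsupp.induction_linear with
  | zero => exact ⟨1, one_pos, fun h _ n _ x => by simp⟩
  | add f g hf hg =>
    obtain ⟨C, hC0, hC⟩ := hf
    obtain ⟨D, hD0, hD⟩ := hg
    refine ⟨C + D, by positivity, fun h hh n hn x => ?_⟩
    simp only [map_add, add_sub_add_comm, add_apply, Finset.sum_add_distrib, add_mul]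
    exact norm_add_le_of_le (hC h hh n hn x) (hD h hh n hn x)
  | single p r =>
    obtain ⟨C, hC0, hC⟩ := hT.exists_norm_sum_phiCLM_sub_le R p.1 p.2
    refine ⟨(‖r‖ + 1) * C, by positivity, fun h hh n hn x => ?_⟩
    simp only [hT.1.coeffCLM_single p.1 p.2, ← smul_sub, smul_apply, map_smul, ← Finset.smul_sum,
      norm_smul, mul_zero]
    calc _ ≤ ‖r‖ * (C * ‖x‖) := by gcongr; exact hC h hh n hn x
      _ ≤ (‖r‖ + 1) * (C * ‖x‖) := by gcongr; linarith
      _ = _ := by ring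

end IsAnalyticSemigroup

end Smoothing

/-- Abel summation. -/
theorem norm_sum_convolution_sub_le {E : Type*} [NormedAddCommGroup E] [NormedSpace ℝ E]
    (P : ℕ → E →L[ℝ] E) {C : ℝ} (n : ℕ)
    (hC : ∀ m ≤ n, ∀ x, ‖∑ j ∈ Finset.range m, P j x‖ ≤ C * ‖x‖) (w : ℕ → E) :
    ‖∑ j ∈ Finset.range n, P (n - 1 - j) (w j) - ∑ j ∈ Finset.range n, P j (w 0)‖ ≤
      C * ∑ j ∈ Finset.range n, ‖w (j + 1) - w j‖ := by
  induction n generalizing w with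
  | zero => simp
  | succ n ih =>
    have h_reindex : ∑ j ∈ Finset.range n, P (n + 1 - 1 - (j + 1)) (w (j + 1)) =
        ∑ j ∈ Finset.range n, P (n - 1 - j) (w (j + 1)) :=
      Finset.sum_congr rfl fun j _ => by rw [show n + 1 - 1 - (j + 1) = n - 1 - j by omega]
    have h_split : ∑ j ∈ Finset.range (n + 1), P (n + 1 - 1 - j) (w j) -
        ∑ j ∈ Finset.range (n + 1), P j (w 0) =
        (∑ j ∈ Finset.range n, P (n - 1 - j) (w (j + 1)) - ∑ j ∈ Finset.range n, P j (w (0 + 1))) +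
          ∑ j ∈ Finset.range n, P j (w 1 - w 0) := by
      rw [Finset.sum_range_succ', Finset.sum_range_succ, h_reindex]
      simp only [Nat.add_sub_cancel, map_sub, Finset.sum_sub_distrib, Nat.sub_zero, zero_add]
      abel
    rw [h_split, Finset.sum_range_succ', mul_add]
    exact norm_add_le_of_le (ih (fun m hm => hC m (hm.trans n.le_succ)) fun j => w (j + 1))
      (hC n n.le_succ _)

theorem norm_sum_convolution_le {E : Type*} [NormedAddCommGroup E] [NormedSpace ℝ E]
    (P : ℕ → E →L[ℝ] E) {C : ℝ} (n : ℕ)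
    (hC : ∀ m ≤ n, ∀ x, ‖∑ j ∈ Finset.range m, P j x‖ ≤ C * ‖x‖) (w : ℕ → E) :
    ‖∑ j ∈ Finset.range n, P (n - 1 - j) (w j)‖ ≤
      C * (‖w 0‖ + ∑ j ∈ Finset.range n, ‖w (j + 1) - w j‖) := by
  rw [mul_add]
  exact (norm_le_norm_add_norm_sub' _ _).trans
    (add_le_add (hC n le_rfl (w 0)) (norm_sum_convolution_sub_le P n hC w))

/-! ### Coefficient functions as scalar functions -/

/-- The functional `F ↦ ∫_0^1 F((1-θ)σ) θ^{k-1}/(k-1)! dθ` for `k ≥ 1`, and `F ↦ F(σ)` for `k = 0`.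
It sends `t ↦ e^{tz}` to `φ_k(σz)`. -/
def phiTest (F : ℝ → ℝ) : ℕ → ℝ → ℝ
  | 0, σ => F σ
  | k + 1, σ => ∫ θ in (0 : ℝ)..1, (θ ^ k / (k ! : ℝ)) * F ((1 - θ) * σ)

/-- The extension of `phiTest` to coefficient functions. -/
def Coeff.test (F : ℝ → ℝ) : Coeff →ₗ[ℝ] ℝ :=
  Finsupp.lsum ℝ fun p => LinearMap.toSpanSingleton ℝ ℝ (phiTest F p.1 p.2)

/-- The value `f(z)` of a coefficient function at a real number `z`. -/
def Coeff.eval (z : ℝ) : Coeff →ₗ[ℝ] ℝ := Coeff.test fun t => Real.exp (t * z)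

section Test

variable {F G : ℝ → ℝ}

theorem intervalIntegrable_phiTest (hF : Continuous F) (k : ℕ) (σ : ℝ) :
    IntervalIntegrable (fun θ : ℝ => (θ ^ k / (k ! : ℝ)) * F ((1 - θ) * σ))
      MeasureTheory.volume 0 1 :=
  Continuous.intervalIntegrable (by fun_prop) _ _

theorem phiTest_add (hF : Continuous F) (hG : Continuous G) (k : ℕ) (σ : ℝ) :
    phiTest (F + G) k σ = phiTest F k σ + phiTest G k σ := by
  cases k with
  | zero => rfl
  | succ k =>
    simp only [phiTest, Pi.add_apply, mul_add]
    exact intervalIntegral.integral_add (intervalIntegrable_phiTest hF k σ)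
      (intervalIntegrable_phiTest hG k σ)

theorem phiTest_smul (c : ℝ) (F : ℝ → ℝ) (k : ℕ) (σ : ℝ) :
    phiTest (c • F) k σ = c * phiTest F k σ := by
  cases k with
  | zero => rfl
  | succ k =>
    simp only [phiTest, Pi.smul_apply, smul_eq_mul, ← intervalIntegral.integral_const_mul,
      mul_left_comm c]

theorem abs_phiTest_le {ε R : ℝ} (hF : ∀ t ∈ Icc 0 R, |F t| ≤ ε) (k : ℕ) {σ : ℝ}
    (hσ : σ ∈ Icc 0 R) : |phiTest F k σ| ≤ ε := by
  cases k with
  | zero => exact hF _ hσ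
  | succ k =>
    refine norm_integral_pow_div_factorial_smul_le (f := fun θ => F ((1 - θ) * σ)) k fun θ hθ =>
      hF _ ?_
    exact ⟨mul_nonneg (sub_nonneg.2 hθ.2) hσ.1,
      (mul_le_of_le_one_left hσ.1 (sub_le_self 1 hθ.1)).trans hσ.2⟩

namespace Coeff

theorem test_eq_sum (F : ℝ → ℝ) (f : Coeff) :
    test F f = ∑ p ∈ f.support, f p * phiTest F p.1 p.2 := rfl

theorem test_add (hF : Continuous F) (hG : Continuous G) (f : Coeff) :
    test (F + G) f = test F f + test G f := by
  simp only [test_eq_sum, phiTest_add hF hG, mul_add, Finset.sum_add_distrib]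

theorem test_smul (c : ℝ) (F : ℝ → ℝ) (f : Coeff) : test (c • F) f = c * test F f := by
  simp only [test_eq_sum, phiTest_smul, Finset.mul_sum, mul_left_comm]

theorem test_polynomial_exp {f : Coeff} (hf : ∀ z, eval z f = 0) (P : Polynomial ℝ) :
    test (fun t => P.eval (Real.exp t)) f = 0 := by
  induction P using Polynomial.induction_on' with
  | add P Q hP hQ =>
    simp only [Polynomial.eval_add]
    exact (test_add (by fun_prop) (by fun_prop) f).trans (by rw [hP, hQ, add_zero])
  | monomial n a =>
    simp only [Polynomial.eval_monomial, ← Real.exp_nat_mul, mul_comm (n : ℝ)]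
    exact (test_smul a _ f).trans (mul_eq_zero_of_right a (hf n))

theorem abs_test_le {f : Coeff} {ε R : ℝ} (hfR : ∀ p ∈ f.support, (p.2 : ℝ) ≤ R)
    (hF : ∀ t ∈ Icc 0 R, |F t| ≤ ε) : |test F f| ≤ (∑ p ∈ f.support, |f p|) * ε := by
  rw [test_eq_sum, Finset.sum_mul]
  refine (Finset.abs_sum_le_sum_abs _ _).trans (Finset.sum_le_sum fun p hp => ?_)
  rw [abs_mul]
  gcongr
  exact abs_phiTest_le hF _ ⟨p.2.coe_nonneg, hfR p hp⟩

/-- The polynomials in `e^t` are dense in the continuous functions on a compact interval. -/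
theorem test_eq_zero {f : Coeff} (hf : ∀ z, eval z f = 0) (hF : Continuous F) : test F f = 0 := by
  obtain ⟨R, hR⟩ := (f.support.image fun p => (p.2 : ℝ)).bddAbove
  have hfR : ∀ p ∈ f.support, (p.2 : ℝ) ≤ R := fun p hp => hR (Finset.mem_image_of_mem _ hp)
  have h_small : ∀ ε > 0, |test F f| ≤ (∑ p ∈ f.support, |f p|) * ε := by
    intro ε hε
    obtain ⟨P, hP⟩ := exists_polynomial_near_of_continuousOn 1 (Real.exp R)
      (fun s => F (Real.log s)) (hF.comp_continuousOn (Real.continuousOn_log.mono fun s hs =>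
        (zero_lt_one.trans_le hs.1).ne')) ε hε
    have h_split : test F f = test (F + (-1 : ℝ) • fun t => P.eval (Real.exp t)) f := by
      rw [test_add hF (by fun_prop), test_smul, test_polynomial_exp hf, mul_zero, add_zero]
    rw [h_split]
    refine abs_test_le hfR fun t ht => ?_
    have h_near := (hP _ ⟨Real.one_le_exp ht.1, Real.exp_le_exp.2 ht.2⟩).le
    rw [Real.log_exp, abs_sub_comm] at h_near
    simpa [sub_eq_add_neg] using h_near
  have h_lim : Tendsto (fun ε : ℝ => (∑ p ∈ f.support, |f p|) * ε) (𝓝[>] 0) (𝓝 0) := by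
    simpa using ((continuous_id.tendsto (0 : ℝ)).mono_left nhdsWithin_le_nhds).const_mul
      (∑ p ∈ f.support, |f p|)
  exact abs_nonpos_iff.1 (ge_of_tendsto h_lim (eventually_mem_nhdsWithin.mono h_small))

end Coeff

/-- Separation of variables: a relation `∑ f_i(z) w_i = 0` for real `z` remains valid if the
functionals `f ↦ f(z)` are replaced by any linear map that only depends on the values of `f`. -/
theorem sum_map_eq_zero_of_eval {ι W W' : Type*} [AddCommGroup W] [Module ℝ W] [AddCommGroup W']
    [Module ℝ W'] (N : Coeff →ₗ[ℝ] W →ₗ[ℝ] W') (hN : ∀ f, (∀ z, Coeff.eval z f = 0) → N f = 0)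
    (s : Finset ι) (f : ι → Coeff) (w : ι → W)
    (h : ∀ z, ∑ i ∈ s, Coeff.eval z (f i) • w i = 0) : ∑ i ∈ s, N (f i) (w i) = 0 := by
  classical
  set b := Module.Basis.ofVectorSpace ℝ W
  have h_coord : ∀ m, N (∑ i ∈ s, b.repr (w i) m • f i) = 0 := by
    refine fun m => hN _ fun z => ?_
    have h_repr := congrArg (fun x => b.repr x m) (h z)
    simp only [map_sum, map_smul, Finsupp.finsetSum_apply, Finsupp.smul_apply, map_zero,
      Finsupp.zero_apply, smul_eq_mul] at h_repr ⊢
    rw [← h_repr]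
    exact Finset.sum_congr rfl fun i _ => mul_comm _ _
  set S := s.biUnion fun i => (b.repr (w i)).support
  have h_expand : ∀ i ∈ s, N (f i) (w i) = ∑ m ∈ S, N (b.repr (w i) m • f i) (b m) := by
    intro i hi
    conv_lhs => rw [← b.linearCombination_repr (w i), Finsupp.linearCombination_apply,
      Finsupp.sum_of_support_subset _ (Finset.subset_biUnion_of_mem
        (fun i => (b.repr (w i)).support) hi) _ (by simp), map_sum]
    simp [S]
  rw [Finset.sum_congr rfl h_expand, Finset.sum_comm]
  refine Finset.sum_eq_zero fun m _ => ?_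
  simpa using LinearMap.congr_fun (h_coord m) (b m)

end Test

section Transfer

variable {X : Type v} [NormedAddCommGroup X] [NormedSpace ℝ X] {T : ℝ → X →L[ℝ] X}

theorem dual_phi_max_eq_phiTest [CompleteSpace X] (hT : IsC0Semigroup T) (ℓ : StrongDual ℝ X)
    (k : ℕ) {σ τ : ℝ} (hσ : 0 ≤ σ) (hτ : 0 ≤ τ) (x : X) :
    ℓ (phi T k (σ * τ) x) = phiTest (fun t => ℓ (T (max (t * τ) 0) x)) k σ := by
  rw [← max_eq_left (mul_nonneg hσ hτ)]
  cases k with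
  | zero => rfl
  | succ k =>
    rw [phi_succ_max, ← ContinuousLinearMap.intervalIntegral_comp_comm ℓ
      (hT.intervalIntegrable_phi k (σ * τ) x)]
    simp only [phiTest, map_smul, smul_eq_mul, mul_assoc]

namespace IsC0Semigroup

variable [CompleteSpace X] (hT : IsC0Semigroup T) {ι κ : Type*} {h : ℝ} (hh : 0 ≤ h) (s : Finset ι)

theorem coeffCLM_zero_apply (f : Coeff) (x : X) : hT.coeffCLM 0 f x = Coeff.eval 0 f • x := by
  rw [hT.coeffCLM_apply f le_rfl, Coeff.op, Coeff.eval, Coeff.test_eq_sum, Finsupp.sum,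
    Finset.sum_smul]
  refine Finset.sum_congr rfl fun p _ => ?_
  rw [mul_smul]
  congr 1
  obtain ⟨_ | k, σ⟩ := p
  · simp [phi, phiTest, hT.map_zero]
  · simp only [phi, phiTest, mul_zero, hT.map_zero, Real.exp_zero, mul_one]
    exact intervalIntegral.integral_smul_const _ _

include hh

theorem coeffCLM_eq_zero {f : Coeff} (hf : ∀ z, Coeff.eval z f = 0) : hT.coeffCLM h f = 0 := by
  ext x
  refine SeparatingDual.eq_zero_of_forall_dual_eq_zero (R := ℝ) fun ℓ => ?_
  have h_cont : Continuous fun t => ℓ (T (max (t * h) 0) x) :=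
    ℓ.continuous.comp ((hT.continuous_max_apply x).comp (continuous_mul_const h))
  rw [hT.coeffCLM_apply f hh, Coeff.op, Finsupp.sum, map_sum, ← Coeff.test_eq_zero hf h_cont,
    Coeff.test_eq_sum]
  refine Finset.sum_congr rfl fun p _ => ?_
  rw [map_smul, smul_eq_mul, dual_phi_max_eq_phiTest hT ℓ p.1 p.2.coe_nonneg hh]

theorem sum_coeffCLM_apply_eq_zero (f : ι → Coeff) (w : ι → X)
    (hw : ∀ z, ∑ i ∈ s, Coeff.eval z (f i) • w i = 0) :
    ∑ i ∈ s, hT.coeffCLM h (f i) (w i) = 0 :=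
  sum_map_eq_zero_of_eval ((ContinuousLinearMap.coeLM ℝ).comp (hT.coeffCLM h))
    (fun f hf => by rw [LinearMap.comp_apply, hT.coeffCLM_eq_zero hh hf, _root_.map_zero]) s f w hw

theorem sum_smul_coeffCLM_eq_zero (r : ι → ℝ) (f : ι → Coeff)
    (hf : ∀ z, ∑ i ∈ s, r i * Coeff.eval z (f i) = 0) :
    ∑ i ∈ s, r i • hT.coeffCLM h (f i) = 0 := by
  simpa using hT.coeffCLM_eq_zero hh (f := ∑ i ∈ s, r i • f i) fun z => by simpa using hf z

theorem sum_coeffCLM_comp_coeffCLM_eq_zero (f g : ι → Coeff)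
    (hfg : ∀ z₁ z₂, ∑ i ∈ s, Coeff.eval z₁ (f i) * Coeff.eval z₂ (g i) = 0) (J : X →L[ℝ] X)
    (x : X) : ∑ i ∈ s, hT.coeffCLM h (f i) (J (hT.coeffCLM h (g i) x)) = 0 := by
  refine hT.sum_coeffCLM_apply_eq_zero hh s f _ fun z₁ => ?_
  simpa [sum_apply] using congrArg (fun P : X →L[ℝ] X => J (P x))
    (hT.sum_smul_coeffCLM_eq_zero hh s _ g (hfg z₁))

theorem sum_sum_coeffCLM_comp_coeffCLM_eq_zero (t : ι → Finset κ) (f g : ι → κ → Coeff)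
    (hfg : ∀ z₁ z₂, ∑ i ∈ s, ∑ j ∈ t i, Coeff.eval z₁ (f i j) * Coeff.eval z₂ (g i j) = 0)
    (J : X →L[ℝ] X) (x : X) :
    ∑ i ∈ s, ∑ j ∈ t i, hT.coeffCLM h (f i j) (J (hT.coeffCLM h (g i j) x)) = 0 := by
  rw [Finset.sum_sigma']
  exact hT.sum_coeffCLM_comp_coeffCLM_eq_zero hh (s.sigma t) (fun p => f p.1 p.2)
    (fun p => g p.1 p.2) (fun z₁ z₂ => by simpa only [Finset.sum_sigma] using hfg z₁ z₂) J x

theorem sum_coeffCLM_comp_sum_coeffCLM_comp_coeffCLM_eq_zero (t : ι → Finset κ) (f : ι → Coeff)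
    (g k : ι → κ → Coeff)
    (hfg : ∀ z₁ z₂ z₃, ∑ i ∈ s, ∑ j ∈ t i,
      Coeff.eval z₁ (f i) * Coeff.eval z₂ (g i j) * Coeff.eval z₃ (k i j) = 0)
    (J K : X →L[ℝ] X) (x : X) :
    ∑ i ∈ s, hT.coeffCLM h (f i)
      (J (∑ j ∈ t i, hT.coeffCLM h (g i j) (K (hT.coeffCLM h (k i j) x)))) = 0 := by
  refine hT.sum_coeffCLM_apply_eq_zero hh s f _ fun z₁ => ?_
  have h_inner := hT.sum_sum_coeffCLM_comp_coeffCLM_eq_zero hh s t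
    (fun i j => Coeff.eval z₁ (f i) • g i j) k (fun z₂ z₃ => by simpa using hfg z₁ z₂ z₃) K x
  simpa [Finset.smul_sum] using congrArg J h_inner

theorem sum_smul_bilin_coeffCLM_eq_zero (r : ι → ℝ) (f : ι → Coeff)
    (hf : ∀ z₁ z₂, ∑ i ∈ s, r i * (Coeff.eval z₁ (f i) * Coeff.eval z₂ (f i)) = 0)
    (B : X →L[ℝ] X →L[ℝ] X) (x y : X) :
    ∑ i ∈ s, r i • B (hT.coeffCLM h (f i) x) (hT.coeffCLM h (f i) y) = 0 := by
  let N : Coeff →ₗ[ℝ] X →ₗ[ℝ] X := (ContinuousLinearMap.coeLM ℝ).comp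
    (B.toLinearMap.comp (((ContinuousLinearMap.apply ℝ X x).toLinearMap).comp (hT.coeffCLM h)))
  have h_sep := sum_map_eq_zero_of_eval N
    (fun f hf => by simp [N, hT.coeffCLM_eq_zero hh hf]) s f
    (fun i => r i • hT.coeffCLM h (f i) y) fun z₁ => by
      simpa [sum_apply, smul_smul, mul_comm] using congrArg (fun P : X →L[ℝ] X => P y)
        (hT.sum_smul_coeffCLM_eq_zero hh s (fun i => r i * Coeff.eval z₁ (f i)) f
          fun z₂ => by simpa [mul_assoc] using hf z₁ z₂)
  simpa [N] using h_sep

end IsC0Semigroup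

end Transfer

/-! ### The order conditions for coefficient functions -/

section Matrices

variable {d : ℕ}

theorem expSG_apply_eigenvector {Z : Mat d} {z : ℝ} {x : EuclideanSpace ℝ (Fin d)}
    (hx : Z x = z • x) (t : ℝ) : expSG Z t x = Real.exp (t * z) • x := by
  have h_pow : ∀ n : ℕ, ((t • Z) ^ n) x = ((t * z) ^ n) • x := by
    intro n
    induction n with
    | zero => simp
    | succ n ih =>
      rw [pow_succ', mul_apply_eq_comp, ih, map_smul, smul_apply, hx, smul_smul, smul_smul,
        pow_succ, mul_assoc]
  have h_matrix := (ContinuousLinearMap.apply ℝ _ x).hasSum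
    (NormedSpace.exp_series_hasSum_exp' (𝕂 := ℝ) (t • Z))
  have h_scalar := (NormedSpace.exp_series_hasSum_exp' (𝕂 := ℝ) (t * z)).smul_const x
  rw [← Real.exp_eq_exp_ℝ] at h_scalar
  refine h_matrix.unique (h_scalar.congr_fun fun n => ?_)
  simp [h_pow, smul_smul]

theorem phi_expSG_apply_eigenvector {Z : Mat d} {z : ℝ} {x : EuclideanSpace ℝ (Fin d)}
    (hx : Z x = z • x) (k : ℕ) (σ : ℝ) :
    phi (expSG Z) k σ x = phiTest (fun t => Real.exp (t * z)) k σ • x := by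
  cases k with
  | zero => exact expSG_apply_eigenvector hx σ
  | succ k =>
    simp only [phi, phiTest, expSG_apply_eigenvector hx, smul_smul]
    exact intervalIntegral.integral_smul_const _ _

namespace Coeff

theorem eval_single (z : ℝ) (k : ℕ) (σ : ℝ≥0) (r : ℝ) :
    eval z (Finsupp.single (k, σ) r) = r * phiTest (fun t => Real.exp (t * z)) k σ := by
  simp [eval, test]

theorem mat_apply_eigenvector (f : Coeff) {Z : Mat d} {z : ℝ}
    {x : EuclideanSpace ℝ (Fin d)} (hx : Z x = z • x) : f.mat Z x = eval z f • x := by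
  rw [mat, op, eval, test_eq_sum, Finsupp.sum, Finset.sum_smul]
  exact Finset.sum_congr rfl fun p _ => by
    rw [mul_one, phi_expSG_apply_eigenvector hx, smul_smul]

theorem mat_apply_smul (f : Coeff) {Z : Mat d} {z : ℝ} {x : EuclideanSpace ℝ (Fin d)}
    (hx : Z x = z • x) (r : ℝ) : f.mat Z (r • x) = (r * eval z f) • x := by
  rw [f.mat_apply_eigenvector (x := r • x) (z := z) (by rw [map_smul, hx, smul_comm]), smul_smul,
    mul_comm]

theorem mat_zero_apply (f : Coeff) (x : EuclideanSpace ℝ (Fin d)) :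
    f.mat 0 x = eval 0 f • x := f.mat_apply_eigenvector (by simp)

end Coeff

/-- `ψ_{j,i}` as a coefficient function. -/
def Method.psiCoeff (M : Method) (j i : ℕ) : Coeff :=
  ∑ k ∈ Finset.Ico 2 i, ((M.c k : ℝ) ^ (j - 1) / ((j - 1)! : ℝ)) • M.a i k
    - Finsupp.single (j, M.c i) ((M.c i : ℝ) ^ j)

theorem phiMat_smul_apply_eigenvector (k : ℕ) (σ : ℝ≥0) {Z : Mat d} {z : ℝ}
    {x : EuclideanSpace ℝ (Fin d)} (hx : Z x = z • x) :
    phiMat k ((σ : ℝ) • Z) x = Coeff.eval z (Finsupp.single (k, σ) 1) • x := by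
  rw [phiMat, phi_expSG_apply_eigenvector (z := σ * z) (by rw [smul_apply, hx, smul_smul]),
    Coeff.eval_single, one_mul]
  cases k <;> simp [phiTest, mul_assoc]

theorem Method.psi_apply_eigenvector (M : Method) (j i : ℕ) {Z : Mat d} {z : ℝ}
    {x : EuclideanSpace ℝ (Fin d)} (hx : Z x = z • x) :
    M.psi j i Z x = Coeff.eval z (M.psiCoeff j i) • x := by
  simp only [Method.psi, Method.psiCoeff, phiMat_smul_apply_eigenvector j _ hx,
    Coeff.mat_apply_eigenvector _ hx, Coeff.eval_single, map_sub, map_sum, map_smul, smul_eq_mul,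
    sub_smul, Finset.sum_smul, smul_smul, one_mul]

/-- A diagonal matrix with prescribed eigenvalues, with a shift `J` and a bilinear map `B` that
connect its eigenvectors: evaluating a matrix condition at these yields the corresponding relation
between the values of the coefficient functions at independent real arguments. -/
theorem exists_diagonal_shift (z : Fin 4 → ℝ) : ∃ (Z J : Mat 4)
    (B : EuclideanSpace ℝ (Fin 4) →ₗ[ℝ] EuclideanSpace ℝ (Fin 4) →ₗ[ℝ] EuclideanSpace ℝ (Fin 4))
    (e : Fin 4 → EuclideanSpace ℝ (Fin 4)), (∀ i, Z (e i) = z i • e i) ∧ e 0 ≠ 0 ∧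
      J (e 1) = e 0 ∧ J (e 2) = e 1 ∧ J (e 3) = e 2 ∧ B (e 1) (e 2) = e 0 := by
  let b := (EuclideanSpace.basisFun (Fin 4) ℝ).toBasis
  refine ⟨LinearMap.toContinuousLinearMap (b.constr ℝ fun i => z i • b i),
    LinearMap.toContinuousLinearMap (b.constr ℝ ![0, b 0, b 1, b 2]),
    b.constr ℝ ![0, b.constr ℝ ![0, 0, b 0, 0], 0, 0], b, fun i => ?_, b.ne_zero 0, ?_, ?_, ?_, ?_⟩
  all_goals simp

end Matrices

section ScalarConditions

variable {M : Method}

theorem Method.QuadCond.eval_eq {d m : ℕ} {Z : Mat d} {z : ℝ} {x : EuclideanSpace ℝ (Fin d)}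
    (hM : M.QuadCond m Z) (hx : x ≠ 0) (hZ : Z x = z • x) :
    ∑ i ∈ Finset.Icc 2 M.s, ((M.c i : ℝ) ^ m / (m ! : ℝ)) * Coeff.eval z (M.b i) =
      Coeff.eval z (Finsupp.single (m + 1, 1) 1) := by
  refine smul_left_injective ℝ hx ?_
  simpa [Coeff.mat_apply_eigenvector _ hZ, smul_smul, Finset.sum_smul] using
    (hM x).trans (by simpa using phiMat_smul_apply_eigenvector (m + 1) 1 hZ)

theorem Method.FullConditions.eval_cond3 (hM : M.FullConditions) (z₁ z₂ : ℝ) :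
    ∑ i ∈ Finset.Icc 2 M.s, Coeff.eval z₁ (M.b i) * Coeff.eval z₂ (M.psiCoeff 2 i) = 0 := by
  obtain ⟨Z, J, _, e, hZ, he, hJ₁, -⟩ := exists_diagonal_shift ![z₁, z₂, 0, 0]
  simpa [M.psi_apply_eigenvector _ _ (hZ _), hJ₁, Coeff.mat_apply_smul _ (hZ _),
    ← Finset.sum_smul, he, mul_comm] using hM.cond3 4 Z J (e 1)

theorem Method.FullConditions.eval_cond5 (hM : M.FullConditions) (z₁ z₂ : ℝ) :
    ∑ i ∈ Finset.Icc 2 M.s, Coeff.eval z₁ (M.b i) * Coeff.eval z₂ (M.psiCoeff 3 i) = 0 := by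
  obtain ⟨Z, J, _, e, hZ, he, hJ₁, -⟩ := exists_diagonal_shift ![z₁, z₂, 0, 0]
  simpa [M.psi_apply_eigenvector _ _ (hZ _), hJ₁, Coeff.mat_apply_smul _ (hZ _),
    ← Finset.sum_smul, he, mul_comm] using hM.cond5 4 Z J (e 1)

theorem Method.FullConditions.eval_cond6 (hM : M.FullConditions) (z₁ z₂ z₃ : ℝ) :
    ∑ i ∈ Finset.Icc 2 M.s, ∑ j ∈ Finset.Ico 2 i, Coeff.eval z₁ (M.b i) *
      Coeff.eval z₂ (M.a i j) * Coeff.eval z₃ (M.psiCoeff 2 j) = 0 := by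
  obtain ⟨Z, J, _, e, hZ, he, hJ₁, hJ₂, -⟩ := exists_diagonal_shift ![z₁, z₂, z₃, 0]
  simpa [M.psi_apply_eigenvector _ _ (hZ _), hJ₁, hJ₂, Coeff.mat_apply_smul _ (hZ _),
    ← Finset.sum_smul, he, Finset.mul_sum, mul_comm, mul_left_comm] using hM.cond6 4 Z J (e 2)

theorem Method.FullConditions.eval_cond7 (hM : M.FullConditions) (z₁ z₂ : ℝ) :
    ∑ i ∈ Finset.Icc 2 M.s,
      Coeff.eval z₁ (M.b i) * Coeff.eval z₂ ((M.c i : ℝ) • M.psiCoeff 2 i) = 0 := by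
  obtain ⟨Z, J, _, e, hZ, he, hJ₁, -⟩ := exists_diagonal_shift ![z₁, z₂, 0, 0]
  simpa [M.psi_apply_eigenvector _ _ (hZ _), hJ₁, Coeff.mat_apply_smul _ (hZ _), smul_smul,
    ← Finset.sum_smul, he, mul_comm, mul_left_comm] using hM.cond7 4 Z J (e 1)

theorem Method.WeakConditions.eval_cond9 (hM : M.WeakConditions) (z : ℝ) :
    ∑ i ∈ Finset.Icc 2 M.s, Coeff.eval 0 (M.b i) * Coeff.eval z (M.psiCoeff 4 i) = 0 := by
  obtain ⟨Z, J, _, e, hZ, he, hJ₁, -⟩ := exists_diagonal_shift ![0, z, 0, 0]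
  simpa [M.psi_apply_eigenvector _ _ (hZ _), hJ₁, Coeff.mat_zero_apply, smul_smul,
    ← Finset.sum_smul, he, mul_comm] using hM.cond9 4 Z J (e 1)

theorem Method.WeakConditions.eval_cond10 (hM : M.WeakConditions) (z₁ z₂ : ℝ) :
    ∑ i ∈ Finset.Icc 2 M.s, ∑ j ∈ Finset.Ico 2 i, Coeff.eval z₁ (Coeff.eval 0 (M.b i) • M.a i j) *
      Coeff.eval z₂ (M.psiCoeff 3 j) = 0 := by
  obtain ⟨Z, J, _, e, hZ, he, hJ₁, hJ₂, -⟩ := exists_diagonal_shift ![0, z₁, z₂, 0]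
  simpa [M.psi_apply_eigenvector _ _ (hZ _), hJ₁, hJ₂, Coeff.mat_apply_smul _ (hZ _),
    Coeff.mat_zero_apply, smul_smul, ← Finset.sum_smul, he, Finset.mul_sum, mul_comm,
    mul_left_comm] using hM.cond10 4 Z J (e 2)

theorem Method.WeakConditions.eval_cond11 (hM : M.WeakConditions) (z₁ z₂ z₃ : ℝ) :
    ∑ i ∈ Finset.Icc 2 M.s, ∑ j ∈ Finset.Ico 2 i, ∑ k ∈ Finset.Ico 2 j,
      Coeff.eval z₁ (Coeff.eval 0 (M.b i) • M.a i j) *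
      Coeff.eval z₂ (M.a j k) * Coeff.eval z₃ (M.psiCoeff 2 k) = 0 := by
  obtain ⟨Z, J, _, e, hZ, he, hJ₁, hJ₂, hJ₃, -⟩ := exists_diagonal_shift ![0, z₁, z₂, z₃]
  simpa [M.psi_apply_eigenvector _ _ (hZ _), hJ₁, hJ₂, hJ₃, Coeff.mat_apply_smul _ (hZ _),
    Coeff.mat_zero_apply, smul_smul, ← Finset.sum_smul, he, Finset.mul_sum, Finset.sum_mul,
    mul_comm, mul_left_comm] using hM.cond11 4 Z J (e 3)

theorem Method.WeakConditions.eval_cond12 (hM : M.WeakConditions) (z₁ z₂ : ℝ) :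
    ∑ i ∈ Finset.Icc 2 M.s, ∑ j ∈ Finset.Ico 2 i, Coeff.eval z₁ (Coeff.eval 0 (M.b i) • M.a i j) *
      Coeff.eval z₂ ((M.c j : ℝ) • M.psiCoeff 2 j) = 0 := by
  obtain ⟨Z, J, _, e, hZ, he, hJ₁, hJ₂, -⟩ := exists_diagonal_shift ![0, z₁, z₂, 0]
  simpa [M.psi_apply_eigenvector _ _ (hZ _), hJ₁, hJ₂, Coeff.mat_apply_smul _ (hZ _),
    Coeff.mat_zero_apply, smul_smul, ← Finset.sum_smul, he, Finset.mul_sum, mul_comm,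
    mul_left_comm] using hM.cond12 4 Z J J (e 2)

theorem Method.WeakConditions.eval_cond13 (hM : M.WeakConditions) (z : ℝ) :
    ∑ i ∈ Finset.Icc 2 M.s,
      (Coeff.eval 0 (M.b i) * M.c i) * Coeff.eval z (M.psiCoeff 3 i) = 0 := by
  obtain ⟨Z, J, _, e, hZ, he, hJ₁, -⟩ := exists_diagonal_shift ![0, z, 0, 0]
  simpa [M.psi_apply_eigenvector _ _ (hZ _), hJ₁, Coeff.mat_zero_apply, smul_smul,
    ← Finset.sum_smul, he, mul_assoc] using hM.cond13 4 Z J (e 1)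

theorem Method.WeakConditions.eval_cond14 (hM : M.WeakConditions) (z₁ z₂ : ℝ) :
    ∑ i ∈ Finset.Icc 2 M.s, ∑ j ∈ Finset.Ico 2 i,
      Coeff.eval z₁ ((Coeff.eval 0 (M.b i) * M.c i) • M.a i j) *
      Coeff.eval z₂ (M.psiCoeff 2 j) = 0 := by
  obtain ⟨Z, J, _, e, hZ, he, hJ₁, hJ₂, -⟩ := exists_diagonal_shift ![0, z₁, z₂, 0]
  simpa [M.psi_apply_eigenvector _ _ (hZ _), hJ₁, hJ₂, Coeff.mat_apply_smul _ (hZ _),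
    Coeff.mat_zero_apply, smul_smul, ← Finset.sum_smul, he, Finset.mul_sum, mul_comm,
    mul_left_comm] using hM.cond14 4 Z J J (e 2)

theorem Method.WeakConditions.eval_cond15 (hM : M.WeakConditions) (z₁ z₂ : ℝ) :
    ∑ i ∈ Finset.Icc 2 M.s, Coeff.eval 0 (M.b i) *
      (Coeff.eval z₁ (M.psiCoeff 2 i) * Coeff.eval z₂ (M.psiCoeff 2 i)) = 0 := by
  obtain ⟨Z, _, B, e, hZ, he, -, -, -, hB⟩ := exists_diagonal_shift ![0, z₁, z₂, 0]
  simpa [M.psi_apply_eigenvector _ _ (hZ _), hB, Coeff.mat_zero_apply, smul_smul,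
    ← Finset.sum_smul, he, mul_comm, mul_left_comm] using hM.cond15 4 Z B (e 1) (e 2)

theorem Method.WeakConditions.eval_cond16 (hM : M.WeakConditions) (z : ℝ) :
    ∑ i ∈ Finset.Icc 2 M.s,
      (Coeff.eval 0 (M.b i) * (M.c i : ℝ) ^ 2) * Coeff.eval z (M.psiCoeff 2 i) = 0 := by
  obtain ⟨Z, J, _, e, hZ, he, hJ₁, -⟩ := exists_diagonal_shift ![0, z, 0, 0]
  simpa [M.psi_apply_eigenvector _ _ (hZ _), hJ₁, Coeff.mat_zero_apply, smul_smul,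
    ← Finset.sum_smul, he, mul_assoc] using hM.cond16 4 Z J (e 1)

end ScalarConditions

/-! ### Smooth extensions and Taylor expansions -/

section Calculus

variable {E F : Type*} [NormedAddCommGroup E] [NormedSpace ℝ E] [NormedAddCommGroup F]
  [NormedSpace ℝ F]

theorem hasDerivAt_iteratedDeriv {w : ℝ → E} {n k : ℕ} (hw : ContDiff ℝ n w) (hk : k < n) (t : ℝ) :
    HasDerivAt (iteratedDeriv k w) (iteratedDeriv (k + 1) w t) t := by
  rw [iteratedDeriv_succ]
  exact (hw.differentiable_iteratedDeriv k (by exact_mod_cast hk) t).hasDerivAt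

theorem contDiff_succ_const_add_integral [CompleteSpace E] {n : ℕ} {w : ℝ → E} (hw : ContDiff ℝ n w)
    (c : E) (a : ℝ) : ContDiff ℝ (n + 1 : ℕ) fun t => c + ∫ s in a..t, w s := by
  have h_deriv : ∀ t, HasDerivAt (fun t => c + ∫ s in a..t, w s) (w t) t := fun t =>
    (hw.continuous.integral_hasStrictDerivAt a t).hasDerivAt.const_add c
  rw [Nat.cast_add, Nat.cast_one, contDiff_succ_iff_deriv]
  refine ⟨fun t => (h_deriv t).differentiableAt, by simp, ?_⟩
  rwa [show deriv (fun t => c + ∫ s in a..t, w s) = w from funext fun t => (h_deriv t).deriv]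

theorem exists_contDiff_extension [CompleteSpace E] {a b : ℝ} (hab : a < b) (n : ℕ) {u : ℝ → E}
    (hu : ContDiffOn ℝ n u (Icc a b)) : ∃ w : ℝ → E, ContDiff ℝ n w ∧ EqOn w u (Icc a b) := by
  induction n generalizing u with
  | zero =>
    refine ⟨IccExtend hab.le ((Icc a b).domRestrict u), ?_, fun t ht => ?_⟩
    · rw [Nat.cast_zero, contDiff_zero]
      exact (continuousOn_iff_continuous_domRestrict.1 hu.continuousOn).Icc_extend'
    · rw [IccExtend_of_mem hab.le _ ht]; rfl
  | succ n ih =>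
    obtain ⟨h_diff, -, h_deriv⟩ := (contDiffOn_succ_iff_derivWithin (uniqueDiffOn_Icc hab)).1
      (by exact_mod_cast hu : ContDiffOn ℝ ((n : WithTop ℕ∞) + 1) u (Icc a b))
    obtain ⟨w, hw, hwu⟩ := ih h_deriv
    refine ⟨_, contDiff_succ_const_add_integral hw (u a) a, fun t ht => ?_⟩
    have h_ftc := intervalIntegral.integral_eq_sub_of_hasDeriv_right_of_le ht.1
      (hu.continuousOn.mono (Icc_subset_Icc_right ht.2)) (f' := w) (fun s hs => by
        have hs' : s ∈ Ioo a b := ⟨hs.1, hs.2.trans_le ht.2⟩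
        rw [hwu (Ioo_subset_Icc_self hs')]
        exact ((h_diff s (Ioo_subset_Icc_self hs')).hasDerivWithinAt.hasDerivAt
          (Icc_mem_nhds hs'.1 hs'.2)).hasDerivWithinAt)
      (hw.continuous.intervalIntegrable _ _)
    simp [h_ftc]

theorem norm_sub_sum_iteratedFDeriv_le [CompleteSpace F] {f : E → F} {n : ℕ} {x y : E} {C : ℝ}
    (hf : ∀ t ∈ Icc (0 : ℝ) 1, ContDiffAt ℝ (n + 1) f (x + t • y))
    (hC : ∀ t ∈ Icc (0 : ℝ) 1, ‖iteratedFDeriv ℝ (n + 1) f (x + t • y)‖ ≤ C) :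
    ‖f (x + y) - ∑ k ∈ Finset.range (n + 1), (k ! : ℝ)⁻¹ • iteratedFDeriv ℝ k f x fun _ => y‖ ≤
      C * ‖y‖ ^ (n + 1) := by
  rw [map_add_eq_sum_add_integral_iteratedFDeriv hf, add_sub_cancel_left,
    ← intervalIntegral.integral_smul]
  have h_integrand : ∀ t ∈ uIoc (0 : ℝ) 1,
      ‖(n ! : ℝ)⁻¹ • (1 - t) ^ n • iteratedFDeriv ℝ (n + 1) f (x + t • y) fun _ => y‖ ≤
        C * ‖y‖ ^ (n + 1) := by
    intro t ht
    rw [uIoc_of_le zero_le_one] at ht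
    have h_factorial : ‖(n ! : ℝ)⁻¹‖ ≤ 1 := by
      rw [norm_inv, RCLike.norm_natCast]
      exact inv_le_one_of_one_le₀ (by exact_mod_cast n.factorial_pos)
    have h_weight : ‖(1 - t) ^ n‖ ≤ 1 := by
      rw [norm_pow, Real.norm_of_nonneg (sub_nonneg.2 ht.2)]
      exact pow_le_one₀ (sub_nonneg.2 ht.2) (by linarith [ht.1])
    rw [norm_smul, norm_smul]
    refine (mul_le_of_le_one_left (by positivity) h_factorial).trans
      ((mul_le_of_le_one_left (by positivity) h_weight).trans ?_)
    refine (ContinuousMultilinearMap.le_of_opNorm_le (hC t ⟨ht.1.le, ht.2⟩) _).trans_eq ?_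
    simp
  simpa using intervalIntegral.norm_integral_le_of_norm_le_const h_integrand

theorem exists_taylor_bound [CompleteSpace E] (n : ℕ) {w : ℝ → E} (hw : ContDiff ℝ n w)
    (a b R : ℝ) : ∃ C : ℝ, 0 ≤ C ∧ ∀ t ∈ Icc a b, ∀ τ ∈ Icc 0 R,
      ‖w (t + τ) - ∑ k ∈ Finset.range n, (τ ^ k / (k ! : ℝ)) • iteratedDeriv k w t‖ ≤
        C * τ ^ n := by
  obtain ⟨C, hC⟩ := isCompact_Icc.exists_bound_of_continuousOn
    ((hw.continuous_iteratedFDeriv le_rfl).continuousOn (s := Icc a (b + R)))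
  have h_mem : ∀ t ∈ Icc a b, ∀ τ ∈ Icc 0 R, ∀ θ ∈ Icc (0 : ℝ) 1, t + θ • τ ∈ Icc a (b + R) := by
    intro t ht τ hτ θ hθ
    have h_mul : θ * τ ≤ τ := mul_le_of_le_one_left hτ.1 hθ.2
    have h_nonneg : 0 ≤ θ * τ := mul_nonneg hθ.1 hτ.1
    rw [smul_eq_mul]
    exact ⟨by linarith [ht.1], by linarith [ht.2, hτ.2]⟩
  refine ⟨max C 0, le_max_right _ _, fun t ht τ hτ => ?_⟩
  have h_bound : ∀ θ ∈ Icc (0 : ℝ) 1, ‖iteratedFDeriv ℝ n w (t + θ • τ)‖ ≤ max C 0 := fun θ hθ =>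
    (hC _ (h_mem t ht τ hτ θ hθ)).trans (le_max_left _ _)
  cases n with
  | zero => simpa using h_bound 1 ⟨zero_le_one, le_rfl⟩
  | succ n =>
    have h_taylor := norm_sub_sum_iteratedFDeriv_le
      (fun θ _ => (by exact_mod_cast hw : ContDiff ℝ (n + 1) w).contDiffAt) h_bound
    simpa [iteratedFDeriv_apply_eq_iteratedDeriv_mul_prod, smul_smul, ← div_eq_inv_mul,
      abs_of_nonneg hτ.1] using h_taylor

/-- Differentiating `v' = A v + f` repeatedly, using that `A` is closed. -/
theorem iteratedDeriv_mem_graph {A : E →ₗ.[ℝ] E} (hA : IsClosed (A.graph : Set (E × E)))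
    {t₀ t₁ : ℝ} {v f : ℝ → E} {n : ℕ} (hv : ContDiff ℝ (n + 1 : ℕ) v) (hf : ContDiff ℝ n f)
    (h_ode : ∀ t ∈ Ico t₀ t₁, (v t, deriv v t - f t) ∈ A.graph) {k : ℕ} (hk : k ≤ n) :
    ∀ t ∈ Ico t₀ t₁,
      (iteratedDeriv k v t, iteratedDeriv (k + 1) v t - iteratedDeriv k f t) ∈ A.graph := by
  induction k with
  | zero => simpa [iteratedDeriv_one] using h_ode
  | succ k ih =>
    intro t ht
    have h_deriv : HasDerivAt (fun s => (iteratedDeriv k v s,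
        iteratedDeriv (k + 1) v s - iteratedDeriv k f s))
        (iteratedDeriv (k + 1) v t, iteratedDeriv (k + 1 + 1) v t - iteratedDeriv (k + 1) f t) t :=
      (hasDerivAt_iteratedDeriv hv (by omega) t).prodMk
        ((hasDerivAt_iteratedDeriv hv (by omega) t).sub
          (hasDerivAt_iteratedDeriv hf (by omega) t))
    refine hA.mem_of_tendsto ((hasDerivWithinAt_iff_tendsto_slope' (s := Ioi t) (by simp)).1
      h_deriv.hasDerivWithinAt) ?_
    filter_upwards [Ioo_mem_nhdsGT ht.2] with s hs
    exact A.graph.smul_mem _ (A.graph.sub_mem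
      (ih (by omega) s ⟨ht.1.trans hs.1.le, hs.2⟩) (ih (by omega) t ht))

end Calculus

/-! ### The problem along a smooth extension of the solution -/

section SmoothProblem

variable {X : Type v} [NormedAddCommGroup X] [NormedSpace ℝ X]

/-- A smooth extension `v` of the solution to the real line, with smooth extensions `f`, `G`, `H`
of `g`, `g'`, `g''` along the solution. The solution times are `[t₀, t₁)`. -/
structure SmoothProblem (A : X →ₗ.[ℝ] X) (g : X → X) (t₀ t₁ : ℝ) (v f : ℝ → X)
    (G : ℝ → X →L[ℝ] X) (H : ℝ → X →L[ℝ] X →L[ℝ] X) (r K : ℝ) : Prop where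
  v_smooth : ContDiff ℝ (5 : ℕ) v
  f_smooth : ContDiff ℝ (5 : ℕ) f
  G_smooth : ContDiff ℝ (4 : ℕ) G
  H_smooth : ContDiff ℝ (3 : ℕ) H
  r_pos : 0 < r
  graph : ∀ k ≤ 4, ∀ t ∈ Ico t₀ t₁,
    (iteratedDeriv k v t, iteratedDeriv (k + 1) v t - iteratedDeriv k f t) ∈ A.graph
  f_eq : ∀ t ∈ Icc t₀ (t₁ + r), f t = g (v t)
  expand : ∀ t ∈ Icc t₀ (t₁ + r), ∀ e, ‖e‖ < r →
    ‖g (v t + e) - f t - G t e - (1 / 2 : ℝ) • H t e e‖ ≤ K * ‖e‖ ^ 3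
  lip : ∀ t ∈ Icc t₀ t₁, ∀ x ∈ Metric.ball (v t) r, ∀ y ∈ Metric.ball (v t) r,
    ‖g x - g y‖ ≤ K * ‖x - y‖

theorem IsSolution.mem_graph {A : X →ₗ.[ℝ] X} {g : X → X} {t₀ t₁ : ℝ} (ht : t₀ < t₁) {u v : ℝ → X}
    (hu : IsSolution A g t₀ t₁ u) (hv : Differentiable ℝ v) (hvu : EqOn v u (Icc t₀ t₁)) {t : ℝ}
    (htt : t ∈ Icc t₀ t₁) : (v t, deriv v t - g (v t)) ∈ A.graph := by
  obtain ⟨hx, h_deriv⟩ := hu t htt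
  have h_eq : deriv v t = A ⟨u t, hx⟩ + g (u t) :=
    (uniqueDiffOn_Icc ht t htt).eq_deriv _ (hv t).hasDerivAt.hasDerivWithinAt
      (h_deriv.congr hvu (hvu htt))
  rw [h_eq, hvu htt, add_sub_cancel_right]
  exact A.mem_graph ⟨u t, hx⟩

theorem exists_ball_subset_thickening {Y : Type*} [PseudoMetricSpace Y] {t₀ t₁ ρ : ℝ} (ht : t₀ ≤ t₁)
    (hρ : 0 < ρ) {v : ℝ → Y} (hv : Continuous v) : ∃ r > 0, ∀ t ∈ Icc t₀ (t₁ + r),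
      Metric.ball (v t) r ⊆ Metric.thickening ρ (v '' Icc t₀ t₁) := by
  obtain ⟨ε, hε, hεv⟩ :=
    Metric.continuousAt_iff.1 (hv.continuousAt (x := t₁)) (ρ / 2) (by positivity)
  refine ⟨min (ε / 2) (ρ / 2), by positivity, fun t htr x hx => ?_⟩
  rw [Metric.mem_ball, lt_min_iff] at hx
  rw [Metric.mem_thickening_iff]
  rcases le_total t t₁ with htt | htt
  · exact ⟨v t, mem_image_of_mem v ⟨htr.1, htt⟩, by linarith⟩
  · refine ⟨v t₁, mem_image_of_mem v ⟨ht, le_rfl⟩, ?_⟩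
    have h_near : dist (v t) (v t₁) < ρ / 2 := hεv (by
      rw [Real.dist_eq, abs_of_nonneg (by linarith)]
      linarith [htr.2, min_le_left (ε / 2) (ρ / 2)])
    linarith [dist_triangle x (v t) (v t₁)]

theorem norm_sub_taylor_two_le [CompleteSpace X] {g : X → X} {x : X} {r K : ℝ}
    (hg : ContDiffOn ℝ 3 g (Metric.ball x r))
    (hK : ∀ y ∈ Metric.ball x r, ‖iteratedFDeriv ℝ 3 g y‖ ≤ K) {e : X} (he : ‖e‖ < r) :
    ‖g (x + e) - g x - fderiv ℝ g x e - (1 / 2 : ℝ) • fderiv ℝ (fderiv ℝ g) x e e‖ ≤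
      K * ‖e‖ ^ 3 := by
  have h_mem : ∀ t ∈ Icc (0 : ℝ) 1, x + t • e ∈ Metric.ball x r := by
    intro t ht
    rw [mem_ball_iff_norm, add_sub_cancel_left, norm_smul, Real.norm_of_nonneg ht.1]
    exact (mul_le_of_le_one_left (norm_nonneg e) ht.2).trans_lt he
  have h_taylor := norm_sub_sum_iteratedFDeriv_le (n := 2)
    (fun t ht => hg.contDiffAt (Metric.isOpen_ball.mem_nhds (h_mem t ht)))
    fun t ht => hK _ (h_mem t ht)
  simpa [Finset.sum_range_succ, iteratedFDeriv_two_apply, sub_sub, add_assoc] using h_taylor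

set_option maxSynthPendingDepth 3 in
theorem exists_smoothProblem [CompleteSpace X] {A : X →ₗ.[ℝ] X}
    (hA : IsClosed (A.graph : Set (X × X))) {g : X → X} {t₀ t₁ : ℝ} (ht : t₀ < t₁) {u : ℝ → X}
    (hu : IsSolution A g t₀ t₁ u) (hreg : IsRegular g t₀ t₁ u) :
    ∃ v f G H r K, SmoothProblem A g t₀ t₁ v f G H r K ∧ EqOn v u (Icc t₀ t₁) := by
  obtain ⟨ρ, hρ, hg, R, hR⟩ := hreg.smooth_g
  obtain ⟨v, hv, hvu⟩ := exists_contDiff_extension ht 5 hreg.smooth_u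
  rw [← hvu.image_eq] at hg hR
  obtain ⟨r, hr, h_ball⟩ := exists_ball_subset_thickening ht.le hρ hv.continuous
  set Ω := Metric.thickening ρ (v '' Icc t₀ t₁)
  have hΩ : IsOpen Ω := Metric.isOpen_thickening
  have h_lt : t₀ < t₁ + r := by linarith
  have h_sub : Icc t₀ t₁ ⊆ Icc t₀ (t₁ + r) := Icc_subset_Icc_right (by linarith)
  have h_maps : MapsTo v (Icc t₀ (t₁ + r)) Ω := fun t htr =>
    h_ball t htr (Metric.mem_ball_self hr)
  have hg' : ContDiffOn ℝ 4 (fderiv ℝ g) Ω := hg.fderiv_of_isOpen hΩ (by norm_num)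
  have hg'' : ContDiffOn ℝ 3 (fderiv ℝ (fderiv ℝ g)) Ω := hg'.fderiv_of_isOpen hΩ (by norm_num)
  obtain ⟨f, hf, hfv⟩ := exists_contDiff_extension h_lt 5 (hg.comp hv.contDiffOn h_maps)
  obtain ⟨G, hG, hGv⟩ := exists_contDiff_extension h_lt 4
    (hg'.comp (hv.of_le (by norm_num)).contDiffOn h_maps)
  obtain ⟨H, hH, hHv⟩ := exists_contDiff_extension h_lt 3
    (hg''.comp (hv.of_le (by norm_num)).contDiffOn h_maps)
  have h_ode : ∀ t ∈ Ico t₀ t₁, (v t, deriv v t - f t) ∈ A.graph := fun t htt => by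
    rw [hfv (h_sub (Ico_subset_Icc_self htt))]
    exact hu.mem_graph ht (hv.differentiable (by norm_num)) hvu (Ico_subset_Icc_self htt)
  refine ⟨v, f, G, H, r, R, ⟨hv, hf, hG, hH, hr, fun k hk => ?_, hfv, ?_, ?_⟩, hvu⟩
  · exact iteratedDeriv_mem_graph hA hv (hf.of_le (by norm_num)) h_ode hk
  · intro t htt e he
    rw [hfv htt, hGv htt, hHv htt]
    exact norm_sub_taylor_two_le ((hg.of_le (by norm_num)).mono (h_ball t htt))
      (fun x hx => hR 3 (by norm_num) (by norm_num) x (h_ball t htt hx)) he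
  · intro t htt x hx y hy
    have h_ballt := h_ball t (h_sub htt)
    refine (convex_ball (v t) r).norm_image_sub_le_of_norm_fderiv_le (fun z hz =>
      (hg.contDiffAt (hΩ.mem_nhds (h_ballt hz))).differentiableAt (by norm_num))
      (fun z hz => ?_) hy hx
    rw [← norm_iteratedFDeriv_one]
    exact hR 1 le_rfl (by norm_num) z (h_ballt hz)

end SmoothProblem

/-! ### Terms of order `h^k`, uniformly in time -/

section Order

/-- The filter along which the step size `h` of `(h, t)` tends to `0+`, uniformly in the time
`t ∈ [t₀, t₁)`. -/
def stepFilter (t₀ t₁ : ℝ) : Filter (ℝ × ℝ) := 𝓝[>] 0 ×ˢ 𝓟 (Ico t₀ t₁)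

variable {E E' : Type*} [NormedAddCommGroup E] [NormedAddCommGroup E'] {t₀ t₁ : ℝ}

theorem eventually_stepFilter {P : ℝ × ℝ → Prop} : (∀ᶠ p in stepFilter t₀ t₁, P p) ↔
    ∃ h₀ > 0, ∀ h t, 0 < h → h ≤ h₀ → t ∈ Ico t₀ t₁ → P (h, t) := by
  simp only [stepFilter, eventually_prod_principal_iff,
    (nhdsGT_basis_Ioc (0 : ℝ)).eventually_iff, mem_Ioc, and_imp]
  exact ⟨fun ⟨h₀, hh₀, hP⟩ => ⟨h₀, hh₀, fun h t hh hhh₀ ht => hP hh hhh₀ t ht⟩,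
    fun ⟨h₀, hh₀, hP⟩ => ⟨h₀, hh₀, fun h hh hhh₀ t ht => hP h t hh hhh₀ ht⟩⟩

/-- `F(h, t) = O(h^k)`, uniformly for `t ∈ [t₀, t₁)`. -/
def IsOrd (t₀ t₁ : ℝ) (k : ℕ) (F : ℝ × ℝ → E) : Prop :=
  F =O[stepFilter t₀ t₁] fun p => p.1 ^ k

theorem IsOrd.of_bound {k : ℕ} {F : ℝ × ℝ → E} (C h₀ : ℝ) (hh₀ : 0 < h₀)
    (hF : ∀ h t, 0 < h → h ≤ h₀ → t ∈ Ico t₀ t₁ → ‖F (h, t)‖ ≤ C * h ^ k) : IsOrd t₀ t₁ k F :=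
  Asymptotics.IsBigO.of_bound C (eventually_stepFilter.2 ⟨h₀, hh₀, fun h t hh hhh₀ ht => by
    rw [Real.norm_of_nonneg (pow_nonneg hh.le k)]
    exact hF h t hh hhh₀ ht⟩)

theorem isOrd_iff {k : ℕ} {F : ℝ × ℝ → E} : IsOrd t₀ t₁ k F ↔ ∃ C h₀ : ℝ, 0 < h₀ ∧ 0 ≤ C ∧
    ∀ h t, 0 < h → h ≤ h₀ → t ∈ Ico t₀ t₁ → ‖F (h, t)‖ ≤ C * h ^ k := by
  refine ⟨fun hF => ?_, fun ⟨C, h₀, hh₀, _, hF⟩ => .of_bound C h₀ hh₀ hF⟩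
  obtain ⟨C, hC, hF⟩ := hF.exists_nonneg
  obtain ⟨h₀, hh₀, hF⟩ := eventually_stepFilter.1 hF.bound
  refine ⟨C, h₀, hh₀, hC, fun h t hh hhh₀ ht => ?_⟩
  simpa [abs_of_pos hh] using hF h t hh hhh₀ ht

theorem IsOrd.add {k : ℕ} {F F' : ℝ × ℝ → E} (h : IsOrd t₀ t₁ k F) (h' : IsOrd t₀ t₁ k F') :
    IsOrd t₀ t₁ k fun p => F p + F' p := Asymptotics.IsBigO.add h h'

theorem IsOrd.sub {k : ℕ} {F F' : ℝ × ℝ → E} (h : IsOrd t₀ t₁ k F) (h' : IsOrd t₀ t₁ k F') :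
    IsOrd t₀ t₁ k fun p => F p - F' p := Asymptotics.IsBigO.sub h h'

theorem IsOrd.sum {ι : Type*} {s : Finset ι} {k : ℕ} {F : ι → ℝ × ℝ → E}
    (h : ∀ i ∈ s, IsOrd t₀ t₁ k (F i)) : IsOrd t₀ t₁ k fun p => ∑ i ∈ s, F i p :=
  Asymptotics.IsBigO.fun_sum h

theorem IsOrd.mono {k m : ℕ} {F : ℝ × ℝ → E} (hF : IsOrd t₀ t₁ m F) (hkm : k ≤ m) :
    IsOrd t₀ t₁ k F := by
  refine Asymptotics.IsBigO.trans hF (Asymptotics.IsBigO.of_bound 1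
    (eventually_stepFilter.2 ⟨1, one_pos, fun h _ hh hh₁ _ => ?_⟩))
  rw [Real.norm_of_nonneg (by positivity), Real.norm_of_nonneg (by positivity), one_mul]
  exact pow_le_pow_of_le_one hh.le hh₁ hkm

theorem IsOrd.congr {k : ℕ} {F F' : ℝ × ℝ → E} (hF : IsOrd t₀ t₁ k F)
    (h_eq : ∀ h t, 0 < h → t ∈ Ico t₀ t₁ → F' (h, t) = F (h, t)) : IsOrd t₀ t₁ k F' :=
  Asymptotics.IsBigO.congr' hF
    (eventually_stepFilter.2 ⟨1, one_pos, fun h t hh _ ht => (h_eq h t hh ht).symm⟩)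
    EventuallyEq.rfl

theorem IsOrd.tendsto_zero {k : ℕ} (hk : k ≠ 0) {F : ℝ × ℝ → E} (hF : IsOrd t₀ t₁ k F) :
    Tendsto F (stepFilter t₀ t₁) (𝓝 0) := by
  have h_fst : Tendsto Prod.fst (stepFilter t₀ t₁) (𝓝 0) :=
    tendsto_fst.mono_right nhdsWithin_le_nhds
  exact Asymptotics.IsBigO.trans_tendsto hF (by simpa [hk] using h_fst.pow k)

theorem isOrd_of_continuous {w : ℝ → E} (hw : Continuous w) :
    IsOrd t₀ t₁ 0 fun p => w p.2 := by
  obtain ⟨C, hC⟩ := isCompact_Icc.exists_bound_of_continuousOn (hw.continuousOn (s := Icc t₀ t₁))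
  exact IsOrd.of_bound C 1 one_pos fun _ t _ _ ht => by
    simpa using hC t (Ico_subset_Icc_self ht)

variable [NormedSpace ℝ E] [NormedSpace ℝ E']

theorem IsOrd.const_smul {k : ℕ} {F : ℝ × ℝ → E} (h : IsOrd t₀ t₁ k F) (c : ℝ) :
    IsOrd t₀ t₁ k fun p => c • F p := Asymptotics.IsBigO.const_smul_left h c

theorem IsOrd.clm_apply {k m : ℕ} {P : ℝ × ℝ → E →L[ℝ] E'} {F : ℝ × ℝ → E}
    (hP : IsOrd t₀ t₁ k P) (hF : IsOrd t₀ t₁ m F) : IsOrd t₀ t₁ (k + m) fun p => P p (F p) := by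
  have h_opNorm : (fun p => P p (F p)) =O[stepFilter t₀ t₁] fun p => ‖P p‖ * ‖F p‖ :=
    Asymptotics.IsBigO.of_bound 1 (Eventually.of_forall fun p => by
      simpa using (P p).le_opNorm (F p))
  simpa only [IsOrd, pow_add] using h_opNorm.trans (hP.norm_left.mul hF.norm_left)

theorem IsOrd.pow_smul {k : ℕ} {F : ℝ × ℝ → E} (hF : IsOrd t₀ t₁ k F) (m : ℕ) :
    IsOrd t₀ t₁ (m + k) fun p => p.1 ^ m • F p := by
  simpa only [IsOrd, pow_add, smul_eq_mul] using
    (Asymptotics.isBigO_refl (fun p : ℝ × ℝ => p.1 ^ m) (stepFilter t₀ t₁)).smul hF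

theorem isOrd_iteratedDeriv {w : ℝ → E} {n k : ℕ} (hw : ContDiff ℝ n w) (hk : k ≤ n) :
    IsOrd t₀ t₁ 0 fun p => iteratedDeriv k w p.2 :=
  isOrd_of_continuous (hw.continuous_iteratedDeriv k (by exact_mod_cast hk))

theorem isOrd_taylor [CompleteSpace E] {w : ℝ → E} {n m : ℕ} (hw : ContDiff ℝ n w) (hm : m ≤ n)
    (c : ℝ≥0) : IsOrd t₀ t₁ m fun p => w (p.2 + c * p.1) -
      ∑ k ∈ Finset.range m, (((c : ℝ) * p.1) ^ k / (k ! : ℝ)) • iteratedDeriv k w p.2 := by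
  obtain ⟨C, -, hC⟩ := exists_taylor_bound m (hw.of_le (by exact_mod_cast hm)) t₀ t₁ c
  refine IsOrd.of_bound (C * (c : ℝ) ^ m) 1 one_pos fun h t hh hh₁ ht => ?_
  refine (hC t (Ico_subset_Icc_self ht) (c * h) ⟨by positivity, ?_⟩).trans_eq (by ring)
  exact mul_le_of_le_one_right (NNReal.coe_nonneg c) hh₁

variable {X : Type v} [NormedAddCommGroup X] [NormedSpace ℝ X] [CompleteSpace X]
  {T : ℝ → X →L[ℝ] X} (hT : IsC0Semigroup T)

theorem isOrd_coeffCLM (f : Coeff) : IsOrd t₀ t₁ 0 fun p => hT.coeffCLM p.1 f := by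
  obtain ⟨C, -, hC⟩ := hT.exists_norm_coeffCLM_le f 1
  exact IsOrd.of_bound C 1 one_pos fun h _ _ hh₁ _ => by simpa using hC h hh₁

theorem isOrd_phiCLM (k : ℕ) (c : ℝ≥0) : IsOrd t₀ t₁ 0 fun p => hT.phiCLM k (c * p.1) := by
  obtain ⟨C, -, hC⟩ := hT.exists_norm_phiCLM_le c
  exact IsOrd.of_bound C 1 one_pos fun _ _ _ hh₁ _ => by
    simpa using hC k _ (mul_le_of_le_one_right (NNReal.coe_nonneg c) hh₁)

end Order

/-! ### Expansion of the exact solution -/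

section Exact

variable {X : Type v} [NormedAddCommGroup X] [NormedSpace ℝ X] [CompleteSpace X]
  {T : ℝ → X →L[ℝ] X} {A : X →ₗ.[ℝ] X}
  {g : X → X} {t₀ t₁ : ℝ} {v f : ℝ → X} {G : ℝ → X →L[ℝ] X} {H : ℝ → X →L[ℝ] X →L[ℝ] X} {r K : ℝ}

theorem SmoothProblem.isOrd_node (hT : IsC0Semigroup T) (hA : IsGenerator A T)
    (hP : SmoothProblem A g t₀ t₁ v f G H r K) (c : ℝ≥0) :
    IsOrd t₀ t₁ 5 fun p => v (p.2 + c * p.1) - (v p.2 + phiF T g (c * p.1) (v p.2) +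
      ((c * p.1) ^ 2 • hT.phiCLM 2 (c * p.1) (iteratedDeriv 1 f p.2) +
       (c * p.1) ^ 3 • hT.phiCLM 3 (c * p.1) (iteratedDeriv 2 f p.2) +
       (c * p.1) ^ 4 • hT.phiCLM 4 (c * p.1) (iteratedDeriv 3 f p.2))) := by
  have h_taylor := isOrd_taylor (t₀ := t₀) (t₁ := t₁) hP.v_smooth le_rfl c
  have h_tail : IsOrd t₀ t₁ 5 fun p => p.1 ^ 5 • ((c : ℝ) ^ 5 • hT.phiCLM 5 (c * p.1)
      (iteratedDeriv 4 f p.2 - iteratedDeriv 5 v p.2)) :=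
    (((isOrd_phiCLM hT 5 c).clm_apply ((isOrd_iteratedDeriv hP.f_smooth (by norm_num)).sub
      (isOrd_iteratedDeriv hP.v_smooth le_rfl))).const_smul _).pow_smul 5
  refine (h_taylor.add h_tail).congr fun h t hh ht => ?_
  have hτ : 0 ≤ (c : ℝ) * h := by positivity
  have hf : g (v t) = iteratedDeriv 0 f t := by
    rw [iteratedDeriv_zero, hP.f_eq t ⟨ht.1, by linarith [ht.2, hP.r_pos]⟩]
  have h_semigroup := hA.apply_eq_sum_of_mem_graph hT hτ 5 fun k hk => hP.graph k (by omega) t ht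
  rw [iteratedDeriv_zero] at h_semigroup
  simp only [phiF, h_semigroup, ← hT.phiCLM_apply 1 hτ, hf, Finset.sum_range_succ,
    Finset.sum_range_zero, map_sub]
  module

theorem SmoothProblem.exists_exact_step_bound (hT : IsC0Semigroup T) (hA : IsGenerator A T)
    (hP : SmoothProblem A g t₀ t₁ v f G H r K) : ∃ C : ℝ, 0 ≤ C ∧ ∀ h t, 0 < h → h ≤ 1 → t₀ ≤ t →
      t + h ≤ t₁ → ‖v (t + h) - (T h (v t) +
        ∑ k ∈ Finset.range 5, h ^ (k + 1) • hT.phiCLM (k + 1) h (iteratedDeriv k f t))‖ ≤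
          C * h ^ 6 := by
  obtain ⟨C, hC0, hC⟩ := exists_taylor_bound 5 hP.f_smooth t₀ t₁ 1
  obtain ⟨M, hM0, hM⟩ := hT.exists_norm_le 1
  refine ⟨M * C, by positivity, fun h t hh hh₁ ht htt => ?_⟩
  have hvc := hP.v_smooth.continuous
  have hfc := hP.f_smooth.continuous
  have h_voc := hA.variation_of_constants hT (y := fun s => v (t + s))
    (y' := fun s => deriv v (t + s)) (q := fun s => f (t + s)) hh.le (by fun_prop) (by fun_prop)
    (fun s _ => ((hP.v_smooth.differentiable (by norm_num) (t + s)).hasDerivAt.comp_const_add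
      t s).hasDerivWithinAt)
    (fun s hs => by
      simpa [iteratedDeriv_one] using hP.graph 0 (by norm_num) (t + s)
        ⟨by linarith [hs.1], by linarith [hs.2]⟩)
  have h_integrand : ∀ s ∈ uIoc 0 h, ‖T (h - s) (f (t + s)) -
      T (h - s) (∑ k ∈ Finset.range 5, (s ^ k / (k ! : ℝ)) • iteratedDeriv k f t)‖ ≤
        M * (C * h ^ 5) := by
    intro s hs
    rw [uIoc_of_le hh.le] at hs
    rw [← map_sub]
    refine (T _).le_of_opNorm_le_of_le (hM _ ⟨by linarith [hs.2], by linarith [hs.1]⟩) ?_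
    refine (hC t ⟨ht, by linarith⟩ s ⟨hs.1.le, by linarith [hs.2]⟩).trans ?_
    gcongr
    exacts [hs.1.le, hs.2]
  simp only [add_zero] at h_voc
  rw [h_voc, ← hT.integral_sum_pow_smul 5 _ hh.le, add_sub_add_left_eq_sub,
    ← intervalIntegral.integral_sub
      (hT.intervalIntegrable_sub_apply hh.le (Continuous.continuousOn (by fun_prop)))
      (hT.intervalIntegrable_sub_apply hh.le (Continuous.continuousOn (by fun_prop)))]
  refine (intervalIntegral.norm_integral_le_of_norm_le_const h_integrand).trans_eq ?_
  rw [sub_zero, abs_of_pos hh]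
  ring

end Exact

/-! ### Expansion of the local error -/

section Local

variable {X : Type v} [NormedAddCommGroup X] [NormedSpace ℝ X]
  {A : X →ₗ.[ℝ] X} {g : X → X} {t₀ t₁ : ℝ} {v f : ℝ → X} {G : ℝ → X →L[ℝ] X}
  {H : ℝ → X →L[ℝ] X →L[ℝ] X} {r K : ℝ}

theorem SmoothProblem.isOrd_expand (hP : SmoothProblem A g t₀ t₁ v f G H r K) (c : ℝ≥0)
    {E : ℝ × ℝ → X} (hE : IsOrd t₀ t₁ 2 E) :
    IsOrd t₀ t₁ 5 fun p => g (v (p.2 + c * p.1) + E p) - f (p.2 + c * p.1) -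
      G (p.2 + c * p.1) (E p) - (1 / 2 : ℝ) • H (p.2 + c * p.1) (E p) (E p) := by
  have h_cube : IsOrd t₀ t₁ 6 fun p => ‖E p‖ ^ 3 := by
    simpa only [IsOrd, ← pow_mul] using hE.norm_left.pow 3
  have h_small : ∀ᶠ p in stepFilter t₀ t₁, ‖E p‖ < r := by
    simpa using (hE.tendsto_zero two_ne_zero).norm.eventually_lt_const (by simpa using hP.r_pos)
  have h_time : ∀ᶠ p : ℝ × ℝ in stepFilter t₀ t₁, p.2 + c * p.1 ∈ Icc t₀ (t₁ + r) := by
    refine eventually_stepFilter.2 ⟨r / (c + 1), by have := hP.r_pos; positivity,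
      fun h t hh hhr ht => ?_⟩
    rw [le_div_iff₀ (by positivity)] at hhr
    have hch : 0 ≤ (c : ℝ) * h := by positivity
    constructor <;> dsimp only <;> linarith [ht.1, ht.2]
  refine IsOrd.mono (m := 6) (Asymptotics.IsBigO.trans ?_ h_cube) (by norm_num)
  refine Asymptotics.IsBigO.of_bound K ?_
  filter_upwards [h_small, h_time] with p hp ht
  simpa using hP.expand (p.2 + c * p.1) ht (E p) hp

theorem SmoothProblem.isOrd_increment [CompleteSpace X]
    (hP : SmoothProblem A g t₀ t₁ v f G H r K) (c : ℝ≥0)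
    {E e₂ e₃ e₄ : ℝ × ℝ → X} (h₂ : IsOrd t₀ t₁ 0 e₂) (h₃ : IsOrd t₀ t₁ 0 e₃)
    (h₄ : IsOrd t₀ t₁ 0 e₄)
    (hE : IsOrd t₀ t₁ 5 fun p => E p - (p.1 ^ 2 • e₂ p + p.1 ^ 3 • e₃ p + p.1 ^ 4 • e₄ p)) :
    IsOrd t₀ t₁ 5 fun p => g (v (p.2 + c * p.1) + E p) - g (v p.2) -
      (p.1 • (c : ℝ) • iteratedDeriv 1 f p.2 +
       p.1 ^ 2 • (((c : ℝ) ^ 2 / 2) • iteratedDeriv 2 f p.2 + G p.2 (e₂ p)) +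
       p.1 ^ 3 • (((c : ℝ) ^ 3 / 6) • iteratedDeriv 3 f p.2 + G p.2 (e₃ p) +
         (c : ℝ) • iteratedDeriv 1 G p.2 (e₂ p)) +
       p.1 ^ 4 • (((c : ℝ) ^ 4 / 24) • iteratedDeriv 4 f p.2 + G p.2 (e₄ p) +
         (c : ℝ) • iteratedDeriv 1 G p.2 (e₃ p) +
         ((c : ℝ) ^ 2 / 2) • iteratedDeriv 2 G p.2 (e₂ p) +
         (1 / 2 : ℝ) • H p.2 (e₂ p) (e₂ p))) := by
  have hE₄ : IsOrd t₀ t₁ 4 fun p => E p - (p.1 ^ 2 • e₂ p + p.1 ^ 3 • e₃ p) :=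
    ((hE.mono (by norm_num : 4 ≤ 5)).add (h₄.pow_smul 4)).congr fun h t _ _ => by abel
  have hE₃ : IsOrd t₀ t₁ 3 fun p => E p - p.1 ^ 2 • e₂ p :=
    ((hE₄.mono (by norm_num : 3 ≤ 4)).add (h₃.pow_smul 3)).congr fun h t _ _ => by abel
  have hE₂ : IsOrd t₀ t₁ 2 E :=
    ((hE₃.mono (by norm_num : 2 ≤ 3)).add (h₂.pow_smul 2)).congr fun h t _ _ => by abel
  have hG : ∀ k ≤ 4, IsOrd t₀ t₁ 0 fun p => iteratedDeriv k G p.2 := fun k hk =>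
    isOrd_iteratedDeriv hP.G_smooth hk
  have hH : IsOrd t₀ t₁ 0 fun p => H p.2 := isOrd_of_continuous hP.H_smooth.continuous
  -- The Taylor remainders of `g`, `f`, `G`, `H`, then those of replacing `E` by its expansion.
  have g_rem := hP.isOrd_expand c hE₂
  have f_rem := isOrd_taylor (t₀ := t₀) (t₁ := t₁) hP.f_smooth (le_refl 5) c
  have G_rem := (isOrd_taylor (t₀ := t₀) (t₁ := t₁) hP.G_smooth (by norm_num : 3 ≤ 4)
    c).clm_apply hE₂
  have H_rem := (((isOrd_taylor (t₀ := t₀) (t₁ := t₁) hP.H_smooth (by norm_num : 1 ≤ 3)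
    c).clm_apply hE₂).clm_apply hE₂).const_smul (1 / 2 : ℝ)
  have G₀_rem := (hG 0 (by norm_num)).clm_apply hE
  have G₁_rem := (((hG 1 (by norm_num)).clm_apply hE₄).const_smul (c : ℝ)).pow_smul 1
  have G₂_rem := (((hG 2 (by norm_num)).clm_apply hE₃).const_smul ((c : ℝ) ^ 2 / 2)).pow_smul 2
  have H₀_rem := (((hH.clm_apply hE₃).clm_apply hE₂).add
    ((hH.clm_apply (h₂.pow_smul 2)).clm_apply hE₃)).const_smul (1 / 2 : ℝ)
  refine (((((((g_rem.add f_rem).add G_rem).add H_rem).add G₀_rem).add G₁_rem).add G₂_rem).add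
    H₀_rem).congr fun h t _ ht => ?_
  have hf : g (v t) = f t := (hP.f_eq t ⟨ht.1, by linarith [ht.2, hP.r_pos]⟩).symm
  simp only [Finset.sum_range_succ, Finset.sum_range_zero, iteratedDeriv_zero, hf, map_sub, map_add,
    map_smul, sub_apply, add_apply, smul_apply, zero_add, pow_zero, Nat.factorial]
  push_cast
  module

end Local

section Expansion

variable {X : Type v} [NormedAddCommGroup X] [NormedSpace ℝ X] [CompleteSpace X]
  {T : ℝ → X →L[ℝ] X} (hT : IsC0Semigroup T) (M : Method) (f : ℝ → X) (G : ℝ → X →L[ℝ] X)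
  (H : ℝ → X →L[ℝ] X →L[ℝ] X)

/-- The coefficient of `h^2` in the error `U_{ni} - u(t_n + c_i h)` of the `i`-th stage, started
on the exact solution, at `p = (h, t_n)`. -/
def stageErr₂ (i : ℕ) (p : ℝ × ℝ) : X :=
  hT.coeffCLM p.1 (M.psiCoeff 2 i) (iteratedDeriv 1 f p.2)

/-- The coefficient of `h^3` in the error of the `i`-th stage. -/
def stageErr₃ (i : ℕ) (p : ℝ × ℝ) : X :=
  hT.coeffCLM p.1 (M.psiCoeff 3 i) (iteratedDeriv 2 f p.2) +
    ∑ j ∈ Finset.Ico 2 i, hT.coeffCLM p.1 (M.a i j) (G p.2 (stageErr₂ hT M f j p))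

/-- The coefficient of `h^4` in the error of the `i`-th stage. -/
def stageErr₄ (i : ℕ) (p : ℝ × ℝ) : X :=
  hT.coeffCLM p.1 (M.psiCoeff 4 i) (iteratedDeriv 3 f p.2) +
    ∑ j ∈ Finset.Ico 2 i, hT.coeffCLM p.1 (M.a i j) (G p.2 (stageErr₃ hT M f G j p) +
      (M.c j : ℝ) • iteratedDeriv 1 G p.2 (stageErr₂ hT M f j p))

/-- The coefficient of `h` in `g(U_{ni}) - g(u(t_n))`. -/
def incr₁ (i : ℕ) (p : ℝ × ℝ) : X := (M.c i : ℝ) • iteratedDeriv 1 f p.2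

/-- The coefficient of `h^2` in `g(U_{ni}) - g(u(t_n))`. -/
def incr₂ (i : ℕ) (p : ℝ × ℝ) : X :=
  ((M.c i : ℝ) ^ 2 / 2) • iteratedDeriv 2 f p.2 + G p.2 (stageErr₂ hT M f i p)

/-- The coefficient of `h^3` in `g(U_{ni}) - g(u(t_n))`. -/
def incr₃ (i : ℕ) (p : ℝ × ℝ) : X :=
  ((M.c i : ℝ) ^ 3 / 6) • iteratedDeriv 3 f p.2 + G p.2 (stageErr₃ hT M f G i p) +
    (M.c i : ℝ) • iteratedDeriv 1 G p.2 (stageErr₂ hT M f i p)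

/-- The coefficient of `h^4` in `g(U_{ni}) - g(u(t_n))`. -/
def incr₄ (i : ℕ) (p : ℝ × ℝ) : X :=
  ((M.c i : ℝ) ^ 4 / 24) • iteratedDeriv 4 f p.2 + G p.2 (stageErr₄ hT M f G i p) +
    (M.c i : ℝ) • iteratedDeriv 1 G p.2 (stageErr₃ hT M f G i p) +
    ((M.c i : ℝ) ^ 2 / 2) • iteratedDeriv 2 G p.2 (stageErr₂ hT M f i p) +
    (1 / 2 : ℝ) • H p.2 (stageErr₂ hT M f i p) (stageErr₂ hT M f i p)

theorem coeffCLM_psiCoeff (k i : ℕ) (h : ℝ) : hT.coeffCLM h (M.psiCoeff k i) =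
    ∑ j ∈ Finset.Ico 2 i, ((M.c j : ℝ) ^ (k - 1) / ((k - 1)! : ℝ)) • hT.coeffCLM h (M.a i j) -
      (M.c i : ℝ) ^ k • hT.phiCLM k (M.c i * h) := by
  rw [Method.psiCoeff, map_sub, map_sum, hT.coeffCLM_single]
  simp only [map_smul]

theorem stageErr₂_eq (i : ℕ) (p : ℝ × ℝ) : stageErr₂ hT M f i p =
    ∑ j ∈ Finset.Ico 2 i, hT.coeffCLM p.1 (M.a i j) (incr₁ M f j p) -
      (M.c i : ℝ) ^ 2 • hT.phiCLM 2 (M.c i * p.1) (iteratedDeriv 1 f p.2) := by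
  simp [stageErr₂, coeffCLM_psiCoeff, incr₁, sum_apply]

theorem stageErr₃_eq (i : ℕ) (p : ℝ × ℝ) : stageErr₃ hT M f G i p =
    ∑ j ∈ Finset.Ico 2 i, hT.coeffCLM p.1 (M.a i j) (incr₂ hT M f G j p) -
      (M.c i : ℝ) ^ 3 • hT.phiCLM 3 (M.c i * p.1) (iteratedDeriv 2 f p.2) := by
  simp only [stageErr₃, coeffCLM_psiCoeff, incr₂, sum_apply, sub_apply, smul_apply, map_add,
    map_smul, Finset.sum_add_distrib, Nat.factorial]
  norm_num
  abel

theorem stageErr₄_eq (i : ℕ) (p : ℝ × ℝ) : stageErr₄ hT M f G i p =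
    ∑ j ∈ Finset.Ico 2 i, hT.coeffCLM p.1 (M.a i j) (incr₃ hT M f G j p) -
      (M.c i : ℝ) ^ 4 • hT.phiCLM 4 (M.c i * p.1) (iteratedDeriv 3 f p.2) := by
  simp only [stageErr₄, coeffCLM_psiCoeff, incr₃, sum_apply, sub_apply, smul_apply, map_add,
    map_smul, Finset.sum_add_distrib, Nat.factorial]
  norm_num
  abel

variable {M f G H} {A : X →ₗ.[ℝ] X} {g : X → X} {t₀ t₁ : ℝ} {v : ℝ → X} {r K : ℝ}

theorem SmoothProblem.isOrd_stageErr₂ (hP : SmoothProblem A g t₀ t₁ v f G H r K) (i : ℕ) :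
    IsOrd t₀ t₁ 0 (stageErr₂ hT M f i) :=
  (isOrd_coeffCLM hT _).clm_apply (isOrd_iteratedDeriv hP.f_smooth (by norm_num))

theorem SmoothProblem.isOrd_stageErr₃ (hP : SmoothProblem A g t₀ t₁ v f G H r K) (i : ℕ) :
    IsOrd t₀ t₁ 0 (stageErr₃ hT M f G i) :=
  ((isOrd_coeffCLM hT _).clm_apply (isOrd_iteratedDeriv hP.f_smooth (by norm_num))).add
    (IsOrd.sum fun j _ => (isOrd_coeffCLM hT _).clm_apply
      ((isOrd_of_continuous hP.G_smooth.continuous).clm_apply (hP.isOrd_stageErr₂ hT j)))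

theorem SmoothProblem.isOrd_stageErr₄ (hP : SmoothProblem A g t₀ t₁ v f G H r K) (i : ℕ) :
    IsOrd t₀ t₁ 0 (stageErr₄ hT M f G i) :=
  ((isOrd_coeffCLM hT _).clm_apply (isOrd_iteratedDeriv hP.f_smooth (by norm_num))).add
    (IsOrd.sum fun j _ => (isOrd_coeffCLM hT _).clm_apply
      (((isOrd_of_continuous hP.G_smooth.continuous).clm_apply (hP.isOrd_stageErr₃ hT j)).add
        (((isOrd_iteratedDeriv hP.G_smooth (by norm_num)).clm_apply
          (hP.isOrd_stageErr₂ hT j)).const_smul _)))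

theorem SmoothProblem.isOrd_incr₄ (hP : SmoothProblem A g t₀ t₁ v f G H r K) (i : ℕ) :
    IsOrd t₀ t₁ 0 (incr₄ hT M f G H i) :=
  (((((isOrd_iteratedDeriv hP.f_smooth (by norm_num)).const_smul _).add
    ((isOrd_of_continuous hP.G_smooth.continuous).clm_apply (hP.isOrd_stageErr₄ hT i))).add
    (((isOrd_iteratedDeriv hP.G_smooth (by norm_num)).clm_apply
      (hP.isOrd_stageErr₃ hT i)).const_smul _)).add
    (((isOrd_iteratedDeriv hP.G_smooth (by norm_num)).clm_apply
      (hP.isOrd_stageErr₂ hT i)).const_smul _)).add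
    ((((isOrd_of_continuous hP.H_smooth.continuous).clm_apply (hP.isOrd_stageErr₂ hT i)).clm_apply
      (hP.isOrd_stageErr₂ hT i)).const_smul _)

theorem SmoothProblem.isOrd_incr_of_stage (hP : SmoothProblem A g t₀ t₁ v f G H r K) {i : ℕ}
    (hi : IsOrd t₀ t₁ 5 fun p => stage M T g p.1 (v p.2) i - v (p.2 + M.c i * p.1) -
      (p.1 ^ 2 • stageErr₂ hT M f i p + p.1 ^ 3 • stageErr₃ hT M f G i p +
        p.1 ^ 4 • stageErr₄ hT M f G i p)) :
    IsOrd t₀ t₁ 5 fun p => g (stage M T g p.1 (v p.2) i) - g (v p.2) -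
      (p.1 • incr₁ M f i p + p.1 ^ 2 • incr₂ hT M f G i p + p.1 ^ 3 • incr₃ hT M f G i p +
        p.1 ^ 4 • incr₄ hT M f G H i p) := by
  refine (hP.isOrd_increment (M.c i) (hP.isOrd_stageErr₂ hT i) (hP.isOrd_stageErr₃ hT i)
    (hP.isOrd_stageErr₄ hT i) hi).congr fun h t _ _ => ?_
  simp only [add_sub_cancel]
  rfl

theorem SmoothProblem.isOrd_stage (hA : IsGenerator A T)
    (hP : SmoothProblem A g t₀ t₁ v f G H r K) (i : ℕ) :
    IsOrd t₀ t₁ 5 fun p => stage M T g p.1 (v p.2) i - v (p.2 + M.c i * p.1) -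
      (p.1 ^ 2 • stageErr₂ hT M f i p + p.1 ^ 3 • stageErr₃ hT M f G i p +
        p.1 ^ 4 • stageErr₄ hT M f G i p) := by
  induction i using Nat.strong_induction_on with
  | _ i ih =>
  have h_rem : IsOrd t₀ t₁ 5 fun p => p.1 ^ 1 • ∑ j ∈ Finset.Ico 2 i, hT.coeffCLM p.1 (M.a i j)
      (g (stage M T g p.1 (v p.2) j) - g (v p.2) -
      (p.1 • incr₁ M f j p + p.1 ^ 2 • incr₂ hT M f G j p + p.1 ^ 3 • incr₃ hT M f G j p +
        p.1 ^ 4 • incr₄ hT M f G H j p)) :=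
    ((IsOrd.sum fun j hj => (isOrd_coeffCLM hT (M.a i j)).clm_apply
      (hP.isOrd_incr_of_stage hT (ih j (Finset.mem_Ico.1 hj).2))).pow_smul 1).mono (by norm_num)
  have h_incr₄ : IsOrd t₀ t₁ 5 fun p => p.1 ^ 5 • ∑ j ∈ Finset.Ico 2 i,
      hT.coeffCLM p.1 (M.a i j) (incr₄ hT M f G H j p) :=
    (IsOrd.sum fun j _ => (isOrd_coeffCLM hT (M.a i j)).clm_apply (hP.isOrd_incr₄ hT j)).pow_smul 5
  refine ((h_rem.add h_incr₄).sub (hP.isOrd_node hT hA (M.c i))).congr fun h t hh _ => ?_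
  rw [stage_eq, stageErr₂_eq, stageErr₃_eq, stageErr₄_eq]
  simp only [← hT.coeffCLM_apply _ hh.le, map_sub, map_add, map_smul, Finset.sum_sub_distrib,
    Finset.sum_add_distrib, ← Finset.smul_sum]
  module

theorem SmoothProblem.isOrd_incr (hA : IsGenerator A T)
    (hP : SmoothProblem A g t₀ t₁ v f G H r K) (i : ℕ) :
    IsOrd t₀ t₁ 5 fun p => g (stage M T g p.1 (v p.2) i) - g (v p.2) -
      (p.1 • incr₁ M f i p + p.1 ^ 2 • incr₂ hT M f G i p + p.1 ^ 3 • incr₃ hT M f G i p +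
        p.1 ^ 4 • incr₄ hT M f G H i p) :=
  hP.isOrd_incr_of_stage hT (hP.isOrd_stage hT hA i)

end Expansion

/-! ### The order conditions on a Banach space -/

section OrderConditions

variable {X : Type v} [NormedAddCommGroup X] [NormedSpace ℝ X] [CompleteSpace X]
  {T : ℝ → X →L[ℝ] X} (hT : IsC0Semigroup T) {M : Method} (f : ℝ → X) (G : ℝ → X →L[ℝ] X)
  (H : ℝ → X →L[ℝ] X →L[ℝ] X) {p : ℝ × ℝ}

theorem sum_smul_coeffCLM_eq_phiCLM {m : ℕ} (hM : ∀ Z : Mat 1, M.QuadCond m Z) {h : ℝ}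
    (hh : 0 ≤ h) (x : X) :
    ∑ i ∈ Finset.Icc 2 M.s, ((M.c i : ℝ) ^ m / (m ! : ℝ)) • hT.coeffCLM h (M.b i) x =
      hT.phiCLM (m + 1) h x := by
  have h_zero := hT.coeffCLM_eq_zero hh
    (f := ∑ i ∈ Finset.Icc 2 M.s, ((M.c i : ℝ) ^ m / (m ! : ℝ)) • M.b i -
      Finsupp.single (m + 1, 1) 1) (fun z => by
        rw [map_sub, ← (hM (z • 1)).eval_eq (x := EuclideanSpace.single 0 1) (by simp) (by simp)]
        simp)
  rw [map_sub, hT.coeffCLM_single, sub_eq_zero, NNReal.coe_one, one_mul, one_smul] at h_zero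
  simp [← h_zero, sum_apply]

namespace Method.FullConditions

variable (hM : M.FullConditions) (hp : 0 ≤ p.1)

include hM hp

theorem sum_coeffCLM_stageErr₂ (J : X →L[ℝ] X) :
    ∑ i ∈ Finset.Icc 2 M.s, hT.coeffCLM p.1 (M.b i) (J (stageErr₂ hT M f i p)) = 0 :=
  hT.sum_coeffCLM_comp_coeffCLM_eq_zero hp _ _ _ hM.eval_cond3 J _

theorem sum_coeffCLM_smul_stageErr₂ (J : X →L[ℝ] X) :
    ∑ i ∈ Finset.Icc 2 M.s,
      hT.coeffCLM p.1 (M.b i) ((M.c i : ℝ) • J (stageErr₂ hT M f i p)) = 0 := by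
  simpa only [stageErr₂, map_smul, smul_apply] using
    hT.sum_coeffCLM_comp_coeffCLM_eq_zero hp _ _ _ hM.eval_cond7 J (iteratedDeriv 1 f p.2)

theorem sum_coeffCLM_stageErr₃ :
    ∑ i ∈ Finset.Icc 2 M.s, hT.coeffCLM p.1 (M.b i) (G p.2 (stageErr₃ hT M f G i p)) = 0 := by
  have h_psi := hT.sum_coeffCLM_comp_coeffCLM_eq_zero hp _ _ _ hM.eval_cond5 (G p.2)
    (iteratedDeriv 2 f p.2)
  have h_nested := hT.sum_coeffCLM_comp_sum_coeffCLM_comp_coeffCLM_eq_zero hp _ _ _ _ _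
    hM.eval_cond6 (G p.2) (G p.2) (iteratedDeriv 1 f p.2)
  simp only [stageErr₃, stageErr₂, _root_.map_add, Finset.sum_add_distrib, h_psi, h_nested,
    add_zero]

theorem sum_coeffCLM_incr₁ :
    ∑ i ∈ Finset.Icc 2 M.s, hT.coeffCLM p.1 (M.b i) (incr₁ M f i p) =
      hT.phiCLM 2 p.1 (iteratedDeriv 1 f p.2) := by
  rw [← sum_smul_coeffCLM_eq_phiCLM hT (hM.cond1 1) hp]
  simp [incr₁]

theorem sum_coeffCLM_incr₂ :
    ∑ i ∈ Finset.Icc 2 M.s, hT.coeffCLM p.1 (M.b i) (incr₂ hT M f G i p) =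
      hT.phiCLM 3 p.1 (iteratedDeriv 2 f p.2) := by
  simp only [incr₂, map_add, map_smul, Finset.sum_add_distrib,
    hM.sum_coeffCLM_stageErr₂ hT f hp, ← sum_smul_coeffCLM_eq_phiCLM hT (hM.cond2 1) hp]
  simp [Nat.factorial]

theorem sum_coeffCLM_incr₃ :
    ∑ i ∈ Finset.Icc 2 M.s, hT.coeffCLM p.1 (M.b i) (incr₃ hT M f G i p) =
      hT.phiCLM 4 p.1 (iteratedDeriv 3 f p.2) := by
  simp only [incr₃, map_add, Finset.sum_add_distrib, hM.sum_coeffCLM_stageErr₃ hT f G hp,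
    hM.sum_coeffCLM_smul_stageErr₂ hT f hp, ← sum_smul_coeffCLM_eq_phiCLM hT (hM.cond4 1) hp]
  simp [Nat.factorial]

end Method.FullConditions

namespace Method.WeakConditions

variable (hM : M.WeakConditions)

include hM

theorem sum_eval_smul_pow_four_smul (x : X) :
    ∑ i ∈ Finset.Icc 2 M.s, Coeff.eval 0 (M.b i) • ((M.c i : ℝ) ^ 4 / 24) • x =
      hT.coeffCLM 0 (Finsupp.single (5, 1) 1) x := by
  rw [hT.coeffCLM_zero_apply,
    ← (hM.cond8 1).eval_eq (x := EuclideanSpace.single 0 1) (by simp) (by simp), Finset.sum_smul]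
  simp [Nat.factorial, smul_smul, mul_comm]

variable (hp : 0 ≤ p.1)

include hp

theorem sum_eval_smul_sq_smul_stageErr₂ :
    ∑ i ∈ Finset.Icc 2 M.s,
      Coeff.eval 0 (M.b i) • (M.c i : ℝ) ^ 2 • stageErr₂ hT M f i p = 0 := by
  simpa only [stageErr₂, sum_apply, mul_smul, smul_apply, zero_apply] using
    congrArg (fun P : X →L[ℝ] X => P (iteratedDeriv 1 f p.2))
      (hT.sum_smul_coeffCLM_eq_zero hp _ _ _ hM.eval_cond16)

theorem sum_eval_smul_bilin_stageErr₂ (B : X →L[ℝ] X →L[ℝ] X) :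
    ∑ i ∈ Finset.Icc 2 M.s,
      Coeff.eval 0 (M.b i) • B (stageErr₂ hT M f i p) (stageErr₂ hT M f i p) = 0 :=
  hT.sum_smul_bilin_coeffCLM_eq_zero hp _ _ _ hM.eval_cond15 B _ _

theorem sum_eval_smul_smul_stageErr₃ :
    ∑ i ∈ Finset.Icc 2 M.s, Coeff.eval 0 (M.b i) • (M.c i : ℝ) • stageErr₃ hT M f G i p = 0 := by
  have h_psi : ∑ i ∈ Finset.Icc 2 M.s, Coeff.eval 0 (M.b i) • (M.c i : ℝ) •
      hT.coeffCLM p.1 (M.psiCoeff 3 i) (iteratedDeriv 2 f p.2) = 0 := by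
    simpa [sum_apply, mul_smul] using congrArg (fun P : X →L[ℝ] X => P (iteratedDeriv 2 f p.2))
      (hT.sum_smul_coeffCLM_eq_zero hp _ _ _ hM.eval_cond13)
  have h_nested := hT.sum_sum_coeffCLM_comp_coeffCLM_eq_zero hp _ _ _ _ hM.eval_cond14 (G p.2)
    (iteratedDeriv 1 f p.2)
  simp only [map_smul, smul_apply, mul_smul, ← Finset.smul_sum] at h_nested
  simp only [stageErr₃, stageErr₂, smul_add, Finset.sum_add_distrib, h_psi, h_nested, add_zero]

theorem sum_eval_smul_stageErr₄ :
    ∑ i ∈ Finset.Icc 2 M.s, Coeff.eval 0 (M.b i) • stageErr₄ hT M f G i p = 0 := by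
  have h_psi : ∑ i ∈ Finset.Icc 2 M.s, Coeff.eval 0 (M.b i) •
      hT.coeffCLM p.1 (M.psiCoeff 4 i) (iteratedDeriv 3 f p.2) = 0 := by
    simpa [sum_apply] using congrArg (fun P : X →L[ℝ] X => P (iteratedDeriv 3 f p.2))
      (hT.sum_smul_coeffCLM_eq_zero hp _ _ _ hM.eval_cond9)
  have h_nested₂ := hT.sum_sum_coeffCLM_comp_coeffCLM_eq_zero hp _ _ _ _ hM.eval_cond10 (G p.2)
    (iteratedDeriv 2 f p.2)
  have h_nested₃ := hT.sum_coeffCLM_comp_sum_coeffCLM_comp_coeffCLM_eq_zero hp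
    ((Finset.Icc 2 M.s).sigma fun i => Finset.Ico 2 i) (fun q => Finset.Ico 2 q.2)
    (fun q => Coeff.eval 0 (M.b q.1) • M.a q.1 q.2) (fun q k => M.a q.2 k)
    (fun _ k => M.psiCoeff 2 k)
    (fun z₁ z₂ z₃ => by rw [Finset.sum_sigma]; exact hM.eval_cond11 z₁ z₂ z₃) (G p.2) (G p.2)
    (iteratedDeriv 1 f p.2)
  rw [Finset.sum_sigma] at h_nested₃
  have h_nested₁ := hT.sum_sum_coeffCLM_comp_coeffCLM_eq_zero hp _ _ _ _ hM.eval_cond12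
    (iteratedDeriv 1 G p.2) (iteratedDeriv 1 f p.2)
  simp only [map_smul, smul_apply, smul_comm (M.c _ : ℝ), ← Finset.smul_sum]
    at h_nested₁ h_nested₂ h_nested₃
  simp only [stageErr₄, stageErr₃, stageErr₂, map_add, map_smul, smul_add, Finset.sum_add_distrib,
    h_psi, h_nested₁, h_nested₂, h_nested₃, add_zero]

theorem sum_coeffCLM_zero_incr₄ :
    ∑ i ∈ Finset.Icc 2 M.s, hT.coeffCLM 0 (M.b i) (incr₄ hT M f G H i p) =
      hT.coeffCLM 0 (Finsupp.single (5, 1) 1) (iteratedDeriv 4 f p.2) := by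
  have h_stageErr₄ := congrArg (fun x => G p.2 x) (hM.sum_eval_smul_stageErr₄ hT f G hp)
  have h_stageErr₃ := congrArg (fun x => iteratedDeriv 1 G p.2 x)
    (hM.sum_eval_smul_smul_stageErr₃ hT f G hp)
  have h_stageErr₂ := congrArg (fun x => (1 / 2 : ℝ) • iteratedDeriv 2 G p.2 x)
    (hM.sum_eval_smul_sq_smul_stageErr₂ hT f hp)
  have h_bilin := hM.sum_eval_smul_bilin_stageErr₂ hT f hp ((1 / 2 : ℝ) • H p.2)
  simp only [map_sum, map_smul, map_zero, smul_apply, smul_zero, Finset.smul_sum]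
    at h_stageErr₄ h_stageErr₃ h_stageErr₂ h_bilin
  simp only [hT.coeffCLM_zero_apply (M.b _), incr₄, smul_add, Finset.sum_add_distrib,
    hM.sum_eval_smul_pow_four_smul hT, h_stageErr₄, h_stageErr₃, h_bilin, add_zero]
  rw [add_eq_left, ← h_stageErr₂]
  exact Finset.sum_congr rfl fun i _ => by module

end Method.WeakConditions

end OrderConditions

section LocalError

variable {X : Type v} [NormedAddCommGroup X] [NormedSpace ℝ X] [CompleteSpace X]
  {T : ℝ → X →L[ℝ] X} (hT : IsC0Semigroup T) {M : Method} {f : ℝ → X} {G : ℝ → X →L[ℝ] X}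
  {H : ℝ → X →L[ℝ] X →L[ℝ] X} {A : X →ₗ.[ℝ] X} {g : X → X} {t₀ t₁ : ℝ} {v : ℝ → X} {r K : ℝ}

/-- The coefficient of `h^5` in the local error at `p = (h, t_n)`. By the weakened conditions it
only involves differences between the coefficient functions at `hA` and at `0`. -/
def localErr (M : Method) (f : ℝ → X) (G : ℝ → X →L[ℝ] X) (H : ℝ → X →L[ℝ] X →L[ℝ] X)
    (p : ℝ × ℝ) : X :=
  ∑ i ∈ Finset.Icc 2 M.s,
      (hT.coeffCLM p.1 (M.b i) - hT.coeffCLM 0 (M.b i)) (incr₄ hT M f G H i p) -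
    (hT.coeffCLM p.1 (Finsupp.single (5, 1) 1) - hT.coeffCLM 0 (Finsupp.single (5, 1) 1))
      (iteratedDeriv 4 f p.2)

theorem SmoothProblem.isOrd_step (hA : IsGenerator A T)
    (hP : SmoothProblem A g t₀ t₁ v f G H r K) (hM : M.FullConditions) (hW : M.WeakConditions) :
    IsOrd t₀ t₁ 6 fun p => step M T g p.1 (v p.2) - (T p.1 (v p.2) +
      ∑ k ∈ Finset.range 5, p.1 ^ (k + 1) • hT.phiCLM (k + 1) p.1 (iteratedDeriv k f p.2)) -
        p.1 ^ 5 • localErr hT M f G H p := by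
  have h_rem : IsOrd t₀ t₁ 6 fun p => p.1 ^ 1 • ∑ i ∈ Finset.Icc 2 M.s, hT.coeffCLM p.1 (M.b i)
      (g (stage M T g p.1 (v p.2) i) - g (v p.2) -
      (p.1 • incr₁ M f i p + p.1 ^ 2 • incr₂ hT M f G i p + p.1 ^ 3 • incr₃ hT M f G i p +
        p.1 ^ 4 • incr₄ hT M f G H i p)) :=
    (IsOrd.sum fun i _ => (isOrd_coeffCLM hT (M.b i)).clm_apply
      (hP.isOrd_incr hT hA i)).pow_smul 1
  refine h_rem.congr fun h t hh ht => ?_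
  have hf : g (v t) = f t := (hP.f_eq t ⟨ht.1, by linarith [ht.2, hP.r_pos]⟩).symm
  simp only [step, phiF, localErr, ← hT.coeffCLM_apply _ hh.le, ← hT.phiCLM_apply 1 hh.le, map_sub,
    map_add, map_smul, Finset.sum_sub_distrib, Finset.sum_add_distrib, ← Finset.smul_sum, sub_apply,
    Finset.sum_range_succ, Finset.sum_range_zero, iteratedDeriv_zero, hf,
    hW.sum_coeffCLM_zero_incr₄ hT f G H (p := (h, t)) hh.le]
  rw [hM.sum_coeffCLM_incr₁ hT f (p := (h, t)) hh.le,
    hM.sum_coeffCLM_incr₂ hT f G (p := (h, t)) hh.le,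
    hM.sum_coeffCLM_incr₃ hT f G (p := (h, t)) hh.le,
    hT.coeffCLM_single 5 1 1 h, NNReal.coe_one, one_mul, one_smul]
  module

end LocalError

/-! ### Propagation of the local errors -/

section BddLip

variable {E E' : Type*} [NormedAddCommGroup E] [NormedAddCommGroup E'] {t₀ t₁ : ℝ}

/-- `F(h, t)` is bounded and Lipschitz continuous in `t ∈ [t₀, t₁]`, uniformly in `h ∈ (0, 1]`. -/
def IsBddLip (t₀ t₁ : ℝ) (F : ℝ × ℝ → E) : Prop :=
  ∃ C : ℝ, 0 ≤ C ∧ ∀ h, 0 < h → h ≤ 1 → ∀ t ∈ Icc t₀ t₁,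
    ‖F (h, t)‖ ≤ C ∧ ∀ t' ∈ Icc t₀ t₁, ‖F (h, t) - F (h, t')‖ ≤ C * |t - t'|

theorem IsBddLip.add {F F' : ℝ × ℝ → E} (hF : IsBddLip t₀ t₁ F) (hF' : IsBddLip t₀ t₁ F') :
    IsBddLip t₀ t₁ fun p => F p + F' p := by
  obtain ⟨C, hC0, hC⟩ := hF
  obtain ⟨C', hC0', hC'⟩ := hF'
  refine ⟨C + C', by positivity, fun h hh hh₁ t ht => ⟨?_, fun t' ht' => ?_⟩⟩
  · exact norm_add_le_of_le (hC h hh hh₁ t ht).1 (hC' h hh hh₁ t ht).1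
  · rw [add_sub_add_comm, add_mul]
    exact norm_add_le_of_le ((hC h hh hh₁ t ht).2 t' ht') ((hC' h hh hh₁ t ht).2 t' ht')

theorem IsBddLip.sum {ι : Type*} {s : Finset ι} {F : ι → ℝ × ℝ → E}
    (hF : ∀ i ∈ s, IsBddLip t₀ t₁ (F i)) : IsBddLip t₀ t₁ fun p => ∑ i ∈ s, F i p := by
  classical
  induction s using Finset.induction_on with
  | empty => exact ⟨0, le_rfl, by simp⟩
  | insert i s hi ih =>
    simp only [Finset.sum_insert hi]
    exact (hF i (Finset.mem_insert_self i s)).add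
      (ih fun j hj => hF j (Finset.mem_insert_of_mem hj))

theorem IsBddLip.exists_norm_add_sum_norm_sub_le {w : ℝ × ℝ → E} (hw : IsBddLip t₀ t₁ w) :
    ∃ C : ℝ, ∀ h, 0 < h → h ≤ 1 → ∀ n : ℕ, t₀ + n * h ≤ t₁ →
      ‖w (h, t₀)‖ + ∑ j ∈ Finset.range n,
        ‖w (h, t₀ + ((j + 1 : ℕ) : ℝ) * h) - w (h, t₀ + j * h)‖ ≤ C := by
  obtain ⟨L, hL0, hL⟩ := hw
  refine ⟨L + L * (t₁ - t₀), fun h hh hh₁ n hn => ?_⟩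
  have h_mem : ∀ j ≤ n, t₀ + j * h ∈ Icc t₀ t₁ := fun j hj => by
    have h_le : (j : ℝ) * h ≤ n * h := by gcongr
    have h_nonneg : 0 ≤ (j : ℝ) * h := by positivity
    exact ⟨by linarith, by linarith⟩
  have h_incr : ∀ j ∈ Finset.range n,
      ‖w (h, t₀ + ((j + 1 : ℕ) : ℝ) * h) - w (h, t₀ + j * h)‖ ≤ L * h := by
    intro j hj
    have hjn := Finset.mem_range.1 hj
    refine ((hL h hh hh₁ _ (h_mem (j + 1) hjn)).2 _ (h_mem j hjn.le)).trans_eq ?_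
    rw [show t₀ + ((j + 1 : ℕ) : ℝ) * h - (t₀ + j * h) = h by push_cast; ring, abs_of_pos hh]
  gcongr
  · simpa using (hL h hh hh₁ _ (h_mem 0 n.zero_le)).1
  · calc _ ≤ n * (L * h) := by simpa using Finset.sum_le_sum h_incr
      _ = L * (n * h) := by ring
      _ ≤ L * (t₁ - t₀) := by gcongr; linarith

variable [NormedSpace ℝ E] [NormedSpace ℝ E']

theorem IsBddLip.clm_apply {P : ℝ × ℝ → E →L[ℝ] E'} {F : ℝ × ℝ → E} (hP : IsBddLip t₀ t₁ P)
    (hF : IsBddLip t₀ t₁ F) : IsBddLip t₀ t₁ fun p => P p (F p) := by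
  obtain ⟨C, hC0, hC⟩ := hP
  obtain ⟨C', hC0', hC'⟩ := hF
  refine ⟨2 * (C * C'), by positivity, fun h hh hh₁ t ht => ⟨?_, fun t' ht' => ?_⟩⟩
  · refine ((P _).le_of_opNorm_le_of_le (hC h hh hh₁ t ht).1 (hC' h hh hh₁ t ht).1).trans ?_
    exact le_mul_of_one_le_left (by positivity) one_le_two
  · calc ‖P (h, t) (F (h, t)) - P (h, t') (F (h, t'))‖
        = ‖P (h, t) (F (h, t) - F (h, t')) + (P (h, t) - P (h, t')) (F (h, t'))‖ := by simp
      _ ≤ C * (C' * |t - t'|) + C * |t - t'| * C' := norm_add_le_of_le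
          ((P _).le_of_opNorm_le_of_le (hC h hh hh₁ t ht).1 ((hC' h hh hh₁ t ht).2 t' ht'))
          ((P _ - P _).le_of_opNorm_le_of_le ((hC h hh hh₁ t ht).2 t' ht')
            (hC' h hh hh₁ t' ht').1)
      _ = 2 * (C * C') * |t - t'| := by ring

theorem IsBddLip.const_smul {F : ℝ × ℝ → E} (hF : IsBddLip t₀ t₁ F) (c : ℝ) :
    IsBddLip t₀ t₁ fun p => c • F p := by
  obtain ⟨C, hC0, hC⟩ := hF
  refine ⟨|c| * C, by positivity, fun h hh hh₁ t ht => ⟨?_, fun t' ht' => ?_⟩⟩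
  · rw [norm_smul, Real.norm_eq_abs]
    exact mul_le_mul_of_nonneg_left (hC h hh hh₁ t ht).1 (abs_nonneg c)
  · rw [← smul_sub, norm_smul, Real.norm_eq_abs, mul_assoc]
    exact mul_le_mul_of_nonneg_left ((hC h hh hh₁ t ht).2 t' ht') (abs_nonneg c)

theorem isBddLip_iteratedDeriv {w : ℝ → E} {n k : ℕ} (hw : ContDiff ℝ n w) (hk : k < n) :
    IsBddLip t₀ t₁ fun p => iteratedDeriv k w p.2 := by
  obtain ⟨C, hC⟩ := isCompact_Icc.exists_bound_of_continuousOn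
    ((hw.continuous_iteratedDeriv k (by exact_mod_cast hk.le)).continuousOn (s := Icc t₀ t₁))
  obtain ⟨C', hC'⟩ := isCompact_Icc.exists_bound_of_continuousOn
    ((hw.continuous_iteratedDeriv (k + 1) (by exact_mod_cast hk)).continuousOn (s := Icc t₀ t₁))
  refine ⟨max (max C C') 0, le_max_right _ _, fun _ _ _ t ht => ⟨?_, fun t' ht' => ?_⟩⟩
  · exact (hC t ht).trans ((le_max_left _ _).trans (le_max_left _ _))
  · exact (convex_Icc t₀ t₁).norm_image_sub_le_of_norm_hasDerivWithin_le
      (fun s _ => (hasDerivAt_iteratedDeriv hw hk s).hasDerivWithinAt)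
      (fun s hs => (hC' s hs).trans ((le_max_right _ _).trans (le_max_left _ _))) ht' ht

theorem isBddLip_of_contDiff {w : ℝ → E} {n : ℕ} (hw : ContDiff ℝ n w) (hn : 0 < n) :
    IsBddLip t₀ t₁ fun p => w p.2 := by
  simpa using isBddLip_iteratedDeriv (t₀ := t₀) (t₁ := t₁) hw hn

variable {X : Type v} [NormedAddCommGroup X] [NormedSpace ℝ X] [CompleteSpace X]
  {T : ℝ → X →L[ℝ] X}

theorem isBddLip_coeffCLM (hT : IsC0Semigroup T) (f : Coeff) :
    IsBddLip t₀ t₁ fun p => hT.coeffCLM p.1 f := by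
  obtain ⟨C, hC0, hC⟩ := hT.exists_norm_coeffCLM_le f 1
  refine ⟨C, hC0.le, fun h _ hh₁ t _ => ⟨hC h hh₁, fun t' _ => ?_⟩⟩
  simp only [sub_self, norm_zero]
  positivity

theorem IsAnalyticSemigroup.exists_norm_convolution_le (hT : IsAnalyticSemigroup T) (f : Coeff)
    {w : ℝ × ℝ → X} (hw : IsBddLip t₀ t₁ w) : ∃ C : ℝ, ∀ h, 0 < h → h ≤ 1 → ∀ n : ℕ,
      t₀ + n * h ≤ t₁ → ‖∑ j ∈ Finset.range n, T (((n - 1 - j : ℕ) : ℝ) * h)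
        ((hT.1.coeffCLM h f - hT.1.coeffCLM 0 f) (w (h, t₀ + j * h)))‖ ≤ C := by
  obtain ⟨C, hC0, hC⟩ := hT.exists_norm_sum_coeffCLM_sub_le (t₁ - t₀) f
  obtain ⟨V, hV⟩ := hw.exists_norm_add_sum_norm_sub_le
  refine ⟨C * V, fun h hh hh₁ n hn => ?_⟩
  have h_abel := norm_sum_convolution_le
    (fun j : ℕ => (T (j * h)).comp (hT.1.coeffCLM h f - hT.1.coeffCLM 0 f)) n
    (fun m hm x => hC h hh m ((by gcongr : (m : ℝ) * h ≤ n * h).trans (by linarith)) x)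
    fun j => w (h, t₀ + j * h)
  refine h_abel.trans (mul_le_mul_of_nonneg_left ?_ hC0.le)
  simpa using hV h hh hh₁ n hn

variable {A : X →ₗ.[ℝ] X} {g : X → X} {v f : ℝ → X} {G : ℝ → X →L[ℝ] X}
  {H : ℝ → X →L[ℝ] X →L[ℝ] X} {r K : ℝ} {M : Method}

theorem SmoothProblem.isBddLip_incr₄ (hT : IsC0Semigroup T)
    (hP : SmoothProblem A g t₀ t₁ v f G H r K) (i : ℕ) :
    IsBddLip t₀ t₁ (incr₄ hT M f G H i) := by
  have hf : ∀ k < 5, IsBddLip t₀ t₁ fun p => iteratedDeriv k f p.2 := fun k hk =>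
    isBddLip_iteratedDeriv hP.f_smooth hk
  have hG : ∀ k < 4, IsBddLip t₀ t₁ fun p => iteratedDeriv k G p.2 := fun k hk =>
    isBddLip_iteratedDeriv hP.G_smooth hk
  have hG₀ : IsBddLip t₀ t₁ fun p => G p.2 := isBddLip_of_contDiff hP.G_smooth (by norm_num)
  have hH : IsBddLip t₀ t₁ fun p => H p.2 := isBddLip_of_contDiff hP.H_smooth (by norm_num)
  have h_stageErr₂ : ∀ i, IsBddLip t₀ t₁ (stageErr₂ hT M f i) := fun i =>
    (isBddLip_coeffCLM hT _).clm_apply (hf 1 (by norm_num))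
  have h_stageErr₃ : ∀ i, IsBddLip t₀ t₁ (stageErr₃ hT M f G i) := fun i =>
    ((isBddLip_coeffCLM hT _).clm_apply (hf 2 (by norm_num))).add
      (IsBddLip.sum fun j _ => (isBddLip_coeffCLM hT _).clm_apply
        (hG₀.clm_apply (h_stageErr₂ j)))
  have h_stageErr₄ : ∀ i, IsBddLip t₀ t₁ (stageErr₄ hT M f G i) := fun i =>
    ((isBddLip_coeffCLM hT _).clm_apply (hf 3 (by norm_num))).add
      (IsBddLip.sum fun j _ => (isBddLip_coeffCLM hT _).clm_apply
        ((hG₀.clm_apply (h_stageErr₃ j)).add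
          (((hG 1 (by norm_num)).clm_apply (h_stageErr₂ j)).const_smul _)))
  exact (((((hf 4 (by norm_num)).const_smul _).add (hG₀.clm_apply (h_stageErr₄ i))).add
    (((hG 1 (by norm_num)).clm_apply (h_stageErr₃ i)).const_smul _)).add
    (((hG 2 (by norm_num)).clm_apply (h_stageErr₂ i)).const_smul _)).add
    (((hH.clm_apply (h_stageErr₂ i)).clm_apply (h_stageErr₂ i)).const_smul _)

theorem SmoothProblem.exists_norm_sum_localErr_le (hT : IsAnalyticSemigroup T)
    (hP : SmoothProblem A g t₀ t₁ v f G H r K) : ∃ C : ℝ, ∀ h, 0 < h → h ≤ 1 → ∀ n : ℕ,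
      t₀ + n * h ≤ t₁ → ‖∑ j ∈ Finset.range n, T (((n - 1 - j : ℕ) : ℝ) * h)
        (localErr hT.1 M f G H (h, t₀ + j * h))‖ ≤ C := by
  choose C hC using fun i =>
    hT.exists_norm_convolution_le (M.b i) (hP.isBddLip_incr₄ (M := M) hT.1 i)
  obtain ⟨C', hC'⟩ := hT.exists_norm_convolution_le (Finsupp.single (5, 1) 1)
    (isBddLip_iteratedDeriv (t₀ := t₀) (t₁ := t₁) hP.f_smooth (by norm_num : 4 < 5))
  refine ⟨∑ i ∈ Finset.Icc 2 M.s, C i + C', fun h hh hh₁ n hn => ?_⟩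
  simp only [localErr, map_sub, map_sum, Finset.sum_sub_distrib]
  rw [Finset.sum_comm]
  exact norm_sub_le_of_le (norm_sum_le_of_le _ fun i _ => hC i h hh hh₁ n hn) (hC' h hh hh₁ n hn)

end BddLip

/-! ### Stability and convergence -/

section Stability

open Asymptotics

variable {X : Type v} [NormedAddCommGroup X] {t₀ t₁ : ℝ}

/-- The filter along which the step size `h` of `((h, t), e)` tends to `0+` and the perturbation
`e` to `0`, uniformly in the time `t ∈ [t₀, t₁)`. -/
def perturbFilter (X : Type*) [NormedAddCommGroup X] (t₀ t₁ : ℝ) : Filter ((ℝ × ℝ) × X) :=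
  stepFilter t₀ t₁ ×ˢ 𝓝 0

theorem eventually_mem_Ico_perturbFilter :
    ∀ᶠ q in perturbFilter X t₀ t₁, q.1.2 ∈ Ico t₀ t₁ ∧ 0 < q.1.1 := by
  have h_step : ∀ᶠ p in stepFilter t₀ t₁, p.2 ∈ Ico t₀ t₁ ∧ 0 < p.1 :=
    eventually_stepFilter.2 ⟨1, one_pos, fun _ _ hh _ ht => ⟨ht, hh⟩⟩
  exact tendsto_fst.eventually h_step

theorem IsOrd.clm_apply_perturb {E E' : Type*} [NormedAddCommGroup E] [NormedSpace ℝ E]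
    [NormedAddCommGroup E'] [NormedSpace ℝ E'] {P : ℝ × ℝ → E →L[ℝ] E'} {w : (ℝ × ℝ) × X → E}
    (hP : IsOrd t₀ t₁ 0 P) (hw : w =O[perturbFilter X t₀ t₁] Prod.snd) :
    (fun q => P q.1 (w q)) =O[perturbFilter X t₀ t₁] Prod.snd := by
  obtain ⟨C, h₀, hh₀, -, hC⟩ := isOrd_iff.1 hP
  have h_bound : ∀ᶠ p in stepFilter t₀ t₁, ‖P p‖ ≤ C :=
    eventually_stepFilter.2 ⟨h₀, hh₀, by simpa using hC⟩
  exact (IsBigO.of_bound C ((tendsto_fst.eventually h_bound).mono fun q hq =>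
    (P q.1).le_of_opNorm_le hq (w q))).trans hw

variable [NormedSpace ℝ X] {A : X →ₗ.[ℝ] X} {g : X → X} {v f : ℝ → X} {G : ℝ → X →L[ℝ] X}
  {H : ℝ → X →L[ℝ] X →L[ℝ] X} {r K : ℝ} {M : Method}

theorem SmoothProblem.isBigO_sub (hP : SmoothProblem A g t₀ t₁ v f G H r K)
    {S : (ℝ × ℝ) × X → X} {S₀ : ℝ × ℝ → X}
    (hS₀ : Tendsto (fun p => S₀ p - v p.2) (stepFilter t₀ t₁) (𝓝 0))
    (hS : (fun q => S q - S₀ q.1) =O[perturbFilter X t₀ t₁] Prod.snd) :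
    (fun q => g (S q) - g (S₀ q.1)) =O[perturbFilter X t₀ t₁] Prod.snd := by
  have h_base : Tendsto (fun q : (ℝ × ℝ) × X => S₀ q.1 - v q.1.2) (perturbFilter X t₀ t₁) (𝓝 0) :=
    hS₀.comp tendsto_fst
  have h_pert : Tendsto (fun q => S q - v q.1.2) (perturbFilter X t₀ t₁) (𝓝 0) := by
    simpa using (hS.trans_tendsto tendsto_snd).add h_base
  refine IsBigO.trans (IsBigO.of_bound K ?_) hS
  filter_upwards [h_base.eventually (Metric.ball_mem_nhds 0 hP.r_pos),
    h_pert.eventually (Metric.ball_mem_nhds 0 hP.r_pos), eventually_mem_Ico_perturbFilter]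
    with q hq_base hq_pert hq
  exact hP.lip q.1.2 (Ico_subset_Icc_self hq.1) _ (by simpa [dist_eq_norm] using hq_pert)
    _ (by simpa [dist_eq_norm] using hq_base)

theorem SmoothProblem.isBigO_sub_self (hP : SmoothProblem A g t₀ t₁ v f G H r K) :
    (fun q => g (v q.1.2 + q.2) - g (v q.1.2)) =O[perturbFilter X t₀ t₁] Prod.snd :=
  hP.isBigO_sub (S := fun q => v q.1.2 + q.2) (S₀ := fun p => v p.2)
    (by simpa using tendsto_const_nhds)
    (by simpa using isBigO_refl _ _)

variable [CompleteSpace X] {T : ℝ → X →L[ℝ] X}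

theorem SmoothProblem.tendsto_stage (hT : IsC0Semigroup T) (hA : IsGenerator A T)
    (hP : SmoothProblem A g t₀ t₁ v f G H r K) (i : ℕ) :
    Tendsto (fun p => stage M T g p.1 (v p.2) i - v p.2) (stepFilter t₀ t₁) (𝓝 0) := by
  have h_stage := (hP.isOrd_stage (M := M) hT hA i).mono (by norm_num : 1 ≤ 5)
  have h_err₂ := ((hP.isOrd_stageErr₂ (M := M) hT i).pow_smul 2).mono (by norm_num : 1 ≤ 2)
  have h_err₃ := ((hP.isOrd_stageErr₃ (M := M) hT i).pow_smul 3).mono (by norm_num : 1 ≤ 3)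
  have h_err₄ := ((hP.isOrd_stageErr₄ (M := M) hT i).pow_smul 4).mono (by norm_num : 1 ≤ 4)
  have h_taylor := isOrd_taylor (t₀ := t₀) (t₁ := t₁) hP.v_smooth (by norm_num : 1 ≤ 5) (M.c i)
  refine IsOrd.tendsto_zero one_ne_zero
    (((((h_stage.add h_err₂).add h_err₃).add h_err₄).add h_taylor).congr fun h t _ _ => ?_)
  simp only [Finset.range_one, Finset.sum_singleton, pow_zero, Nat.factorial_zero, Nat.cast_one,
    div_one, iteratedDeriv_zero, one_smul]
  abel

theorem phiF_add_sub (hT : IsC0Semigroup T) {τ : ℝ} (hτ : 0 ≤ τ) (w e : X) :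
    w + e + phiF T g τ (w + e) - (w + phiF T g τ w) =
      T τ e + τ • hT.phiCLM 1 τ (g (w + e) - g w) := by
  simp only [phiF, ← hT.phiCLM_apply 1 hτ, map_sub, map_add]
  module

theorem SmoothProblem.isBigO_stage_sub (hT : IsC0Semigroup T) (hA : IsGenerator A T)
    (hP : SmoothProblem A g t₀ t₁ v f G H r K) (i : ℕ) :
    (fun q => stage M T g q.1.1 (v q.1.2 + q.2) i - stage M T g q.1.1 (v q.1.2) i)
      =O[perturbFilter X t₀ t₁] Prod.snd := by
  induction i using Nat.strong_induction_on with
  | _ i ih =>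
  have h_init := (isOrd_phiCLM (t₀ := t₀) (t₁ := t₁) hT 0 (M.c i)).clm_apply_perturb
    (isBigO_refl (Prod.snd : _ → X) _)
  have h_euler := ((((isOrd_phiCLM hT 1 (M.c i)).const_smul (M.c i)).pow_smul 1).mono
    zero_le_one).clm_apply_perturb hP.isBigO_sub_self
  have h_incr := IsBigO.fun_sum (s := Finset.Ico 2 i) fun j hj =>
    (((isOrd_coeffCLM hT (M.a i j)).pow_smul 1).mono zero_le_one).clm_apply_perturb
      ((hP.isBigO_sub (hP.tendsto_stage hT hA j) (ih j (Finset.mem_Ico.1 hj).2)).sub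
        hP.isBigO_sub_self)
  refine ((h_init.add h_euler).add h_incr).congr' ?_ EventuallyEq.rfl
  filter_upwards [eventually_mem_Ico_perturbFilter] with q hq
  have hτ : 0 ≤ (M.c i : ℝ) * q.1.1 := mul_nonneg (NNReal.coe_nonneg _) hq.2.le
  rw [stage_eq, stage_eq, add_sub_add_comm, phiF_add_sub hT hτ, hT.phiCLM_zero_left hτ]
  simp only [← hT.coeffCLM_apply _ hq.2.le, map_sub, Finset.sum_sub_distrib, smul_apply,
    pow_one, Finset.smul_sum, smul_sub]
  module

theorem SmoothProblem.exists_step_sub_bound (hT : IsC0Semigroup T) (hA : IsGenerator A T)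
    (hP : SmoothProblem A g t₀ t₁ v f G H r K) : ∃ L h₀ ε : ℝ, 0 ≤ L ∧ 0 < h₀ ∧ 0 < ε ∧
      ∀ h t e, 0 < h → h ≤ h₀ → t ∈ Ico t₀ t₁ → ‖e‖ ≤ ε →
      ‖step M T g h (v t + e) - step M T g h (v t) - T h e‖ ≤ L * h * ‖e‖ := by
  have h_euler := (isOrd_phiCLM hT 1 1).clm_apply_perturb hP.isBigO_sub_self
  have h_incr := IsBigO.fun_sum (s := Finset.Icc 2 M.s) fun i _ =>
    (isOrd_coeffCLM hT (M.b i)).clm_apply_perturb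
      ((hP.isBigO_sub (hP.tendsto_stage (M := M) hT hA i) (hP.isBigO_stage_sub hT hA i)).sub
        hP.isBigO_sub_self)
  obtain ⟨L, hL0, hL⟩ := (h_euler.add h_incr).exists_nonneg
  obtain ⟨p_step, h_step, p_pert, h_pert, hL⟩ := eventually_prod_iff.1 hL.bound
  obtain ⟨h₀, hh₀, h_step⟩ := eventually_stepFilter.1 h_step
  obtain ⟨ε, hε, h_pert⟩ := Metric.nhds_basis_closedBall.eventually_iff.1 h_pert
  refine ⟨L, h₀, ε, hL0, hh₀, hε, fun h t e hh hhh₀ ht he => ?_⟩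
  have h_eq : step M T g h (v t + e) - step M T g h (v t) - T h e =
      h • (hT.phiCLM 1 ((1 : ℝ≥0) * h) (g (v t + e) - g (v t)) +
        ∑ i ∈ Finset.Icc 2 M.s, hT.coeffCLM h (M.b i) (g (stage M T g h (v t + e) i) -
          g (stage M T g h (v t) i) - (g (v t + e) - g (v t)))) := by
    rw [step, step, add_sub_add_comm, phiF_add_sub hT hh.le]
    simp only [← hT.coeffCLM_apply _ hh.le, map_sub, Finset.sum_sub_distrib, NNReal.coe_one,
      one_mul]
    module
  rw [h_eq, norm_smul, Real.norm_of_nonneg hh.le, mul_comm L, mul_assoc]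
  exact mul_le_mul_of_nonneg_left (hL (h_step h t hh hhh₀ ht) (h_pert (by simpa using he))) hh.le

end Stability

section Convergence

/-- The Gronwall estimate is only required as long as the sequence stays below a threshold `ε`,
because the numerical solution is controlled only near the exact one. -/
theorem discrete_gronwall_of_threshold {e : ℕ → ℝ} {a b ε : ℝ} {N : ℕ} (ha : 0 ≤ a) (hb : 0 ≤ b)
    (hε : a * Real.exp (N * b) ≤ ε)
    (he : ∀ n ≤ N, (∀ j < n, e j ≤ ε) → e n ≤ a + b * ∑ j ∈ Finset.range n, e j) {n : ℕ}
    (hn : n ≤ N) : e n ≤ a * Real.exp (n * b) := by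
  have h_sum : ∀ n : ℕ, 1 + b * ∑ j ∈ Finset.range n, Real.exp (j * b) ≤ Real.exp (n * b) := by
    intro n
    induction n with
    | zero => simp
    | succ n ih =>
      calc 1 + b * ∑ j ∈ Finset.range (n + 1), Real.exp (j * b)
          ≤ Real.exp (n * b) + b * Real.exp (n * b) := by
            rw [Finset.sum_range_succ]
            linarith
        _ = (b + 1) * Real.exp (n * b) := by ring
        _ ≤ Real.exp b * Real.exp (n * b) := by gcongr; exact Real.add_one_le_exp b
        _ = Real.exp ((n + 1 : ℕ) * b) := by rw [← Real.exp_add]; push_cast; ring_nf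
  induction n using Nat.strong_induction_on with
  | _ n ih =>
  have h_small : ∀ j < n, e j ≤ ε := fun j hj => by
    refine (ih j hj (by omega)).trans (le_trans ?_ hε)
    gcongr
    omega
  calc e n ≤ a + b * ∑ j ∈ Finset.range n, e j := he n hn h_small
    _ ≤ a + b * ∑ j ∈ Finset.range n, a * Real.exp (j * b) := by
      gcongr with j hj
      have hjn := Finset.mem_range.1 hj
      exact ih j hjn (by omega)
    _ = a * (1 + b * ∑ j ∈ Finset.range n, Real.exp (j * b)) := by rw [← Finset.mul_sum]; ring
    _ ≤ a * Real.exp (n * b) := mul_le_mul_of_nonneg_left (h_sum n) ha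

variable {X : Type v} [NormedAddCommGroup X] [NormedSpace ℝ X] {T : ℝ → X →L[ℝ] X}

theorem IsC0Semigroup.eq_sum_of_recursion (hT : IsC0Semigroup T) {h : ℝ} (hh : 0 ≤ h)
    {e d : ℕ → X} {n : ℕ} (h0 : e 0 = 0) (he : ∀ j < n, e (j + 1) = T h (e j) + d j) :
    e n = ∑ j ∈ Finset.range n, T (((n - 1 - j : ℕ) : ℝ) * h) (d j) := by
  induction n with
  | zero => simpa using h0
  | succ n ih =>
    rw [he n n.lt_succ_self, ih fun j hj => he j (hj.trans n.lt_succ_self), map_sum,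
      Finset.sum_range_succ]
    congr 1
    · refine Finset.sum_congr rfl fun j hj => ?_
      obtain ⟨m, rfl⟩ := Nat.exists_eq_add_of_lt (Finset.mem_range.1 hj)
      rw [← hT.apply_add hh (by positivity), show j + m + 1 - 1 - j = m by omega,
        show j + m + 1 + 1 - 1 - j = m + 1 by omega]
      congr 2
      push_cast
      ring
    · simp [hT.map_zero]

theorem IsC0Semigroup.norm_le_of_recursion (hT : IsC0Semigroup T) {h a b B D ε : ℝ} {N : ℕ}
    {e d : ℕ → X} (hh : 0 ≤ h) (ha : 0 ≤ a) (hb : 0 ≤ b) (h0 : e 0 = 0)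
    (hB : ∀ j ≤ N, ‖T (j * h)‖ ≤ B)
    (hD : ∀ n ≤ N, ‖∑ j ∈ Finset.range n, T (((n - 1 - j : ℕ) : ℝ) * h) (d j)‖ ≤ D)
    (he : ∀ j < N, ‖e j‖ ≤ ε → ‖e (j + 1) - T h (e j) - d j‖ ≤ a + b * ‖e j‖)
    (hε : (D + B * (N * a)) * Real.exp (N * (B * b)) ≤ ε) :
    ‖e N‖ ≤ (D + B * (N * a)) * Real.exp (N * (B * b)) := by
  have hB0 : 0 ≤ B := (norm_nonneg _).trans (hB 0 N.zero_le)
  have hD0 : 0 ≤ D := (norm_nonneg _).trans (hD 0 N.zero_le)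
  refine discrete_gronwall_of_threshold (e := fun n => ‖e n‖) (by positivity) (by positivity) hε
    (fun n hn h_small => ?_) le_rfl
  set ρ : ℕ → X := fun j => e (j + 1) - T h (e j) - d j with hρ
  have h_sum : e n = ∑ j ∈ Finset.range n, T (((n - 1 - j : ℕ) : ℝ) * h) (d j) +
      ∑ j ∈ Finset.range n, T (((n - 1 - j : ℕ) : ℝ) * h) (ρ j) := by
    rw [hT.eq_sum_of_recursion hh (d := fun j => d j + ρ j) h0 fun j _ => by simp [hρ],
      ← Finset.sum_add_distrib]
    simp only [_root_.map_add]
  have h_rem : ‖∑ j ∈ Finset.range n, T (((n - 1 - j : ℕ) : ℝ) * h) (ρ j)‖ ≤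
      ∑ j ∈ Finset.range n, B * (a + b * ‖e j‖) := by
    refine norm_sum_le_of_le _ fun j hj => ?_
    have hjn := Finset.mem_range.1 hj
    exact (T _).le_of_opNorm_le_of_le (hB _ (by omega)) (he j (hjn.trans_le hn) (h_small j hjn))
  calc ‖e n‖ ≤ D + ∑ j ∈ Finset.range n, B * (a + b * ‖e j‖) :=
        h_sum ▸ norm_add_le_of_le (hD n hn) h_rem
    _ = D + B * (n * a) + B * b * ∑ j ∈ Finset.range n, ‖e j‖ := by
      rw [← Finset.mul_sum, Finset.sum_add_distrib, ← Finset.mul_sum, Finset.sum_const,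
        Finset.card_range, nsmul_eq_mul]
      ring
    _ ≤ D + B * (N * a) + B * b * ∑ j ∈ Finset.range n, ‖e j‖ := by gcongr

variable [CompleteSpace X] {A : X →ₗ.[ℝ] X} {g : X → X} {t₀ t₁ : ℝ} {v f : ℝ → X}
  {G : ℝ → X →L[ℝ] X} {H : ℝ → X →L[ℝ] X →L[ℝ] X} {r K : ℝ} {M : Method}

theorem SmoothProblem.exists_error_recursion (hT : IsC0Semigroup T) (hA : IsGenerator A T)
    (hP : SmoothProblem A g t₀ t₁ v f G H r K) (hM : M.FullConditions) (hW : M.WeakConditions) :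
    ∃ L C h₀ ε : ℝ, 0 ≤ L ∧ 0 ≤ C ∧ 0 < h₀ ∧ 0 < ε ∧ ∀ h t e, 0 < h → h ≤ h₀ → t₀ ≤ t →
      t + h ≤ t₁ → ‖e‖ ≤ ε →
      ‖step M T g h (v t + e) - v (t + h) - T h e - h ^ 5 • localErr hT M f G H (h, t)‖ ≤
        C * h ^ 6 + L * h * ‖e‖ := by
  obtain ⟨L, h₁, ε, hL, hh₁, hε, h_stable⟩ := hP.exists_step_sub_bound (M := M) hT hA
  obtain ⟨C, h₂, hh₂, hC, h_step⟩ := isOrd_iff.1 (hP.isOrd_step hT hA hM hW)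
  obtain ⟨C', hC', h_exact⟩ := hP.exists_exact_step_bound hT hA
  refine ⟨L, C + C', min h₁ (min h₂ 1), ε, hL, by positivity, by positivity, hε,
    fun h t e hh hhh ht hth he => ?_⟩
  obtain ⟨hhh₁, hhh₂, hh_one⟩ : h ≤ h₁ ∧ h ≤ h₂ ∧ h ≤ 1 := by simpa [le_min_iff] using hhh
  have htI : t ∈ Ico t₀ t₁ := ⟨ht, by linarith⟩
  set P := T h (v t) +
    ∑ k ∈ Finset.range 5, h ^ (k + 1) • hT.phiCLM (k + 1) h (iteratedDeriv k f t)
  calc ‖step M T g h (v t + e) - v (t + h) - T h e - h ^ 5 • localErr hT M f G H (h, t)‖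
      = ‖(step M T g h (v t + e) - step M T g h (v t) - T h e) +
          (step M T g h (v t) - P - h ^ 5 • localErr hT M f G H (h, t)) - (v (t + h) - P)‖ := by
        congr 1
        abel
    _ ≤ L * h * ‖e‖ + C * h ^ 6 + C' * h ^ 6 :=
        norm_sub_le_of_le (norm_add_le_of_le (h_stable h t e hh hhh₁ htI he)
          (h_step h t hh hhh₂ htI)) (h_exact h t hh hh_one ht hth)
    _ = (C + C') * h ^ 6 + L * h * ‖e‖ := by ring

theorem exists_error_constant {a B C L R ε : ℝ} (ha : 0 ≤ a) (hB : 0 ≤ B) (hC : 0 ≤ C)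
    (hL : 0 ≤ L) (hR : 0 ≤ R) (hε : 0 < ε) : ∃ C₀ h₀ : ℝ, 0 < h₀ ∧ ∀ h, 0 < h → h ≤ h₀ →
      C₀ * h ^ 5 ≤ ε ∧ ∀ N : ℕ, N * h ≤ R →
        (h ^ 5 * a + B * (N * (C * h ^ 6))) * Real.exp (N * (B * (L * h))) ≤ C₀ * h ^ 5 := by
  set C₀ := (a + B * C * R) * Real.exp (B * L * R) with hC₀
  have : 0 ≤ C₀ := by positivity
  refine ⟨C₀, min 1 (ε / (C₀ + 1)), by positivity, fun h hh hhh => ⟨?_, fun N hN => ?_⟩⟩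
  · obtain ⟨hh_one, hh_small⟩ := le_min_iff.1 hhh
    calc C₀ * h ^ 5 ≤ (C₀ + 1) * h := by
          gcongr
          · linarith
          · exact pow_le_of_le_one hh.le hh_one (by norm_num)
      _ ≤ ε := by rwa [mul_comm, ← le_div_iff₀ (by positivity)]
  · calc (h ^ 5 * a + B * (N * (C * h ^ 6))) * Real.exp (N * (B * (L * h)))
        = (a + B * C * (N * h)) * Real.exp (B * L * (N * h)) * h ^ 5 := by ring_nf
      _ ≤ C₀ * h ^ 5 := by rw [hC₀]; gcongr

theorem SmoothProblem.exists_convergence (hT : IsAnalyticSemigroup T) (hA : IsGenerator A T)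
    (hP : SmoothProblem A g t₀ t₁ v f G H r K) (ht : t₀ < t₁) (hM : M.FullConditions)
    (hW : M.WeakConditions) :
    ∃ C h₀ : ℝ, 0 < h₀ ∧ ∀ h : ℝ, 0 < h → h ≤ h₀ → ∀ n : ℕ, t₀ + n * h ≤ t₁ →
      ‖numSol M T g h (v t₀) n - v (t₀ + n * h)‖ ≤ C * h ^ 5 := by
  obtain ⟨L, C, h₁, ε, hL, hC, hh₁, hε, h_rec⟩ := hP.exists_error_recursion hT.1 hA hM hW
  obtain ⟨C', hC'⟩ := hP.exists_norm_sum_localErr_le (M := M) hT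
  obtain ⟨B, hB0, hB⟩ := hT.1.exists_norm_le (t₁ - t₀)
  have hC'0 : 0 ≤ C' := (norm_nonneg _).trans (hC' 1 one_pos le_rfl 0 (by simpa using ht.le))
  obtain ⟨C₀, h₂, hh₂, hC₀⟩ :=
    exists_error_constant hC'0 hB0.le hC hL (sub_pos.2 ht).le hε
  refine ⟨C₀, min h₁ (min h₂ 1), by positivity, fun h hh hhh N hN => ?_⟩
  obtain ⟨hhh₁, hhh₂, hh_one⟩ : h ≤ h₁ ∧ h ≤ h₂ ∧ h ≤ 1 := by
    simpa only [le_min_iff] using hhh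
  obtain ⟨h_small, h_const⟩ := hC₀ h hh hhh₂
  have h_time : ∀ j ≤ N, (j : ℝ) * h ≤ t₁ - t₀ := fun j hj =>
    calc (j : ℝ) * h ≤ N * h := by gcongr
      _ ≤ t₁ - t₀ := by linarith
  have hN_const := h_const N (h_time N le_rfl)
  refine (hT.1.norm_le_of_recursion (N := N) (b := L * h)
    (e := fun n => numSol M T g h (v t₀) n - v (t₀ + n * h))
    (d := fun j => h ^ 5 • localErr hT.1 M f G H (h, t₀ + j * h)) hh.le (by positivity)
    (by positivity) (by simp [numSol]) (fun j hj => hB _ ⟨by positivity, h_time j hj⟩)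
    (fun n hn => ?_) (fun j hj hej => ?_) (hN_const.trans h_small)).trans hN_const
  · simp only [map_smul, ← Finset.smul_sum]
    rw [norm_smul, Real.norm_of_nonneg (by positivity)]
    gcongr
    exact hC' h hh hh_one n (by linarith [h_time n hn])
  · have h_next : t₀ + ((j + 1 : ℕ) : ℝ) * h = t₀ + j * h + h := by push_cast; ring
    have hj0 : 0 ≤ (j : ℝ) * h := by positivity
    have h_step := h_rec h (t₀ + j * h) _ hh hhh₁ (by linarith)
      (by linarith [h_time (j + 1) hj]) hej
    simpa only [numSol, h_next, add_sub_cancel] using h_step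

end Convergence

end

end ExpRK

theorem theorem4p1 {X : Type*} [NormedAddCommGroup X] [NormedSpace ℝ X] [CompleteSpace X]
    (A : X →ₗ.[ℝ] X) (T : ℝ → X →L[ℝ] X)
    (hT : ExpRK.IsAnalyticSemigroup T) (hA : ExpRK.IsGenerator A T)
    (g : X → X) (t₀ t₁ : ℝ) (ht : t₀ < t₁) (u : ℝ → X)
    (hu : ExpRK.IsSolution A g t₀ t₁ u) (hreg : ExpRK.IsRegular g t₀ t₁ u)
    (M : ExpRK.Method) (hfull : M.FullConditions) (hweak : M.WeakConditions) :
    ∃ C h₀ : ℝ, 0 < h₀ ∧ ∀ h : ℝ, 0 < h → h ≤ h₀ → ∀ n : ℕ, t₀ + n * h ≤ t₁ →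
      ‖ExpRK.numSol M T g h (u t₀) n - u (t₀ + n * h)‖ ≤ C * h ^ 5 := by
  obtain ⟨v, f, G, H, r, K, hP, hvu⟩ :=
    ExpRK.exists_smoothProblem (hA.isClosed_graph hT.1) ht hu hreg
  obtain ⟨C, h₀, hh₀, hC⟩ := hP.exists_convergence hT hA ht hfull hweak
  refine ⟨C, h₀, hh₀, fun h h0 hh n hn => ?_⟩
  have hn0 : 0 ≤ (n : ℝ) * h := by positivity
  rw [← hvu (left_mem_Icc.2 ht.le), ← hvu ⟨by linarith, hn⟩]
  exact hC h h0 hh n hn
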